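/- **Theorem 1.** Notation. Let $d\ge 1$, $\beta\ge 2$, let $\ell$ be the biggest integer strictly smaller than $\beta$, and for $u\in\mathbb R^d$ let $U(u)=(u^{m}/m!)_{|m|\le \ell}$ be the vector of normalized monomials indexed by the multi-indices $m\in\mathbb N^d$, $|m|\le\ell$. Let $\Theta\subset\mathbb R^d$ be compact and convex, $\Theta'=\{x+y:x\in\Theta,\ \|y\|\le1\}$, with $\|\cdot\|$ the Euclidean norm. Assumptions. 1. (Kernel) $K:\mathbb R^d\to[0,\infty)$ is bounded and $L_K$-Lipschitz, its support is contained in the closed unit ball, and $\int K=1$. 2. (Regression function) $f:\mathbb R^d\to\mathbb R$ attains its minimum over $\Theta$ at $x^*\in\Theta$; $f$ is $\ell$ times differentiable and $\big|f(x')-\sum_{|m|\le\ell}\frac1{m!}D^mf(x)(x'-x)^m\big|\le L\|x'-x\|^\beta$ for all $x,x'\in\mathbb R^d$, where $L>0$; $f(y)\ge f(x)+\langle\nabla f(x),y-x\rangle+\frac\alpha2\|x-y\|^2$ for all $x,y\in\Theta$, where $\alpha>0$; $|f|\le M$ on $\Theta'$; and $\nabla f(x^*)=0$. 3. (Design) $x_1,\dots,x_n$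 are i.i.d. random vectors with a density $p$ with respect to the Lebesgue measure, and $0<p_{\min}\le p(x)\le p_{\max}<\infty$ for all $x\in\Theta'$. 4. (Noise) $\xi_1,\dots,\xi_n$ are independent random variables, the vector $(\xi_1,\dots,\xi_n)$ is independent of $(x_1,\dots,x_n)$, and for every $i$: $\mathbf E[\xi_i]=0$ and $\mathbf E[\exp(|\xi_i|/\sigma)]\le 2$, where $\sigma>0$. Algorithm. One observes $(x_i,y_i)$ with $y_i=f(x_i)+\xi_i$, $i=1,\dots,n$. For $k\ge1$ put $h_k=\big(\frac{\log(k+1)}{k}\big)^{1/(2\beta+d)}$, $\lambda_k=h_k^\beta$, $\eta_k=\frac{2}{\alpha k}$, $$B_k(z)=\frac1{kh_k^d}\sum_{i=1}^kU\Big(\frac{x_i-z}{h_k}\Big)U^\top\Big(\frac{x_i-z}{h_k}\Big)K\Big(\frac{x_i-z}{h_k}\Big),\qquad D_k(z)=\frac1{kh_k^d}\sum_{i=1}^ky_i\,U\Big(\frac{x_i-z}{h_k}\Big)K\Big(\frac{x_i-z}{h_k}\Big),$$ and $g_k(z)=h_k^{-1}A\,(B_k(z)+\lambda_kI)^{-1}D_k(z)$,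 where $A$ extracts the $d$ coordinates with the multi-indices $e_1,\dots,e_d$ (the unit vectors). Starting from an arbitrary $z_1\in\Theta$, set $z_{k+1}=\mathrm{Proj}_\Theta\big(z_k-\eta_kg_k(z_k)\big)$, where $\mathrm{Proj}_\Theta$ is the Euclidean projection onto $\Theta$. Conclusion. For all $n\ge2$ (and all $d$, $\Theta$, $K$, $f$, $\alpha$, $z_1$ and laws of the data as above), $\|z_n-x^*\|^2$ is integrable and $$\mathbf E\|z_n-x^*\|^2\le C\min\Big(1,\Big(\frac{\log n}{n}\Big)^{\frac{2(\beta-1)}{2\beta+d}}\alpha^{-2}\Big),\qquad C=c\,d^{\,q},$$ where $q\in\mathbb N$ depends only on $\beta$, and $c>0$ depends only on $\beta$, $L$, $M$, $p_{\min}$, $p_{\max}$, $\sigma$, on $\Theta$ through its diameter, and on $K$ through $\sup K$, its Lipschitz constant $L_K$ and the smallest eigenvalue of the matrix $\int U(u)U^\top(u)K(u)\,du$. In particular $C$ does not depend on $n$ or $\alpha$. -/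

import Mathlib

open MeasureTheory ProbabilityTheory

namespace PassiveDesign

/-- `ℝ^d` with the Euclidean norm and Lebesgue measure. -/
abbrev Vec (d : ℕ) := EuclideanSpace ℝ (Fin d)

/-- The biggest integer strictly smaller than `β` (for `β > 0`). -/
noncomputable def order (β : ℝ) : ℕ := ⌈β⌉₊ - 1

/-- The multi-indices `m = (m_1, …, m_d)` with `|m| = m_1 + … + m_d ≤ ℓ`
(each entry is then automatically at most `ℓ`). -/
abbrev MultiIdx (d ℓ : ℕ) := {m : Fin d → Fin (ℓ + 1) // ∑ i, (m i : ℕ) ≤ ℓ}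

/-- The vector `U(u) = (u^m / m!)_{|m| ≤ ℓ}`. -/
noncomputable def U {d : ℕ} (ℓ : ℕ) (u : Vec d) : MultiIdx d ℓ → ℝ := fun m =>
  (∏ i, u i ^ (m.1 i : ℕ)) / ∏ i, ((m.1 i : ℕ).factorial : ℝ)

/-- The partial derivative `∂g/∂u_i`. -/
noncomputable def partialD {d : ℕ} (i : Fin d) (g : Vec d → ℝ) : Vec d → ℝ :=
  fun x => fderiv ℝ g x (EuclideanSpace.single i 1)

/-- The differential operator `D^m = ∂^{|m|} / (∂u_1^{m_1} ⋯ ∂u_d^{m_d})`. -/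
noncomputable def multiD {d : ℕ} (m : Fin d → ℕ) (f : Vec d → ℝ) : Vec d → ℝ :=
  (List.finRange d).foldr (fun i g => (partialD i)^[m i] g) f

/-- The Hölder class `F_β(L)`: `ℓ` times differentiable functions, `ℓ` the biggest integer smaller
than `β`, which differ from their Taylor polynomials of order `ℓ` by at most `L ‖x' - x‖^β`. -/
structure HolderClass {d : ℕ} (β L : ℝ) (f : Vec d → ℝ) : Prop where
  differentiable : ∀ j : ℕ, j < order β → Differentiable ℝ (iteratedFDeriv ℝ j f)
  taylor : ∀ x x' : Vec d,
    |f x' - ∑ m : MultiIdx d (order β), multiD (fun i => (m.1 i : ℕ)) f x * U (order β) (x' - x) m|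
      ≤ L * ‖x' - x‖ ^ β

/-- `Θ' = {x + y : x ∈ Θ, ‖y‖ ≤ 1}`. -/
def enlarge {d : ℕ} (Θ : Set (Vec d)) : Set (Vec d) :=
  {w | ∃ x ∈ Θ, ∃ y : Vec d, ‖y‖ ≤ 1 ∧ w = x + y}

/-- The regression function: it attains its minimum on `Θ` at `xstar`, belongs to `F_β(L)`, is
`α`-strongly convex on `Θ`, and is bounded by `M` on `Θ'`. -/
structure RegressionClass {d : ℕ} (Θ : Set (Vec d)) (β L α M : ℝ) (f : Vec d → ℝ)
    (xstar : Vec d) : Prop where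
  mem : xstar ∈ Θ
  isMin : IsMinOn f Θ xstar
  holder : HolderClass β L f
  strongConvex : ∀ x ∈ Θ, ∀ y ∈ Θ,
    f y ≥ f x + inner ℝ (gradient f x) (y - x) + α / 2 * ‖x - y‖ ^ 2
  bounded : ∀ x ∈ enlarge Θ, |f x| ≤ M

/-- Kernels: nonnegative, supported in the unit ball, of integral one, bounded,
`LK`-Lipschitz. -/
structure IsKernel {d : ℕ} (K : Vec d → ℝ) (LK : NNReal) : Prop where
  supp : tsupport K ⊆ Metric.closedBall 0 1
  nonneg : ∀ u, 0 ≤ K u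
  integral_eq_one : ∫ u, K u = 1
  bdd : BddAbove (Set.range K)
  lipschitz : LipschitzWith LK K

/-- The smallest eigenvalue of the matrix `∫ U(u) U(u)ᵀ K(u) du`. -/
noncomputable def kernelMinEig {d : ℕ} (ℓ : ℕ) (K : Vec d → ℝ) : ℝ :=
  sInf (spectrum ℝ
    (Matrix.of fun m m' => ∫ u, U ℓ u m * U ℓ u m' * K u : Matrix (MultiIdx d ℓ) (MultiIdx d ℓ) ℝ))

/-- The matrix `B_k(z)` computed from the first `k` design points `x 1, …, x k`. -/
noncomputable def matB {d : ℕ} (ℓ : ℕ) (K : Vec d → ℝ) (h : ℝ) (k : ℕ) (x : ℕ → Vec d)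
    (z : Vec d) : Matrix (MultiIdx d ℓ) (MultiIdx d ℓ) ℝ :=
  (1 / (k * h ^ d) : ℝ) • ∑ i ∈ Finset.Icc 1 k,
    K (h⁻¹ • (x i - z)) • Matrix.vecMulVec (U ℓ (h⁻¹ • (x i - z))) (U ℓ (h⁻¹ • (x i - z)))

/-- The vector `D_k(z)` computed from the first `k` observations `(x 1, y 1), …, (x k, y k)`. -/
noncomputable def vecD {d : ℕ} (ℓ : ℕ) (K : Vec d → ℝ) (h : ℝ) (k : ℕ) (x : ℕ → Vec d)
    (y : ℕ → ℝ) (z : Vec d) : MultiIdx d ℓ → ℝ :=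
  (1 / (k * h ^ d) : ℝ) • ∑ i ∈ Finset.Icc 1 k,
    (y i * K (h⁻¹ • (x i - z))) • U ℓ (h⁻¹ • (x i - z))

/-- The matrix `A` that extracts the coordinates of the multi-indices `e_1, …, e_d`. -/
def matA (d ℓ : ℕ) : Matrix (Fin d) (MultiIdx d ℓ) ℝ := fun i m =>
  if (fun j => (m.1 j : ℕ)) = Pi.single i 1 then 1 else 0

/-- The regularized estimator `h⁻¹ A (B_k(z) + lam I)⁻¹ D_k(z)` of the gradient at `z`. -/
noncomputable def gradEst {d : ℕ} (ℓ : ℕ) (K : Vec d → ℝ) (h lam : ℝ) (k : ℕ) (x : ℕ → Vec d)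
    (y : ℕ → ℝ) (z : Vec d) : Vec d :=
  h⁻¹ • WithLp.toLp 2 ((matA d ℓ).mulVec
    ((matB ℓ K h k x z + lam • (1 : Matrix (MultiIdx d ℓ) (MultiIdx d ℓ) ℝ))⁻¹.mulVec
      (vecD ℓ K h k x y z)))

open Classical in
/-- The Euclidean projection onto `Θ`: a point of `Θ` nearest to `x` (it exists and is unique when
`Θ` is nonempty, compact and convex). -/
noncomputable def proj {d : ℕ} (Θ : Set (Vec d)) (x : Vec d) : Vec d :=
  if hx : ∃ p ∈ Θ, ∀ q ∈ Θ, ‖x - p‖ ≤ ‖x - q‖ then hx.choose else x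

/-- The bandwidth `h_k = (log (k+1) / k)^{1/(2β+d)}`. -/
noncomputable def bandwidth (d : ℕ) (β : ℝ) (k : ℕ) : ℝ :=
  (Real.log (k + 1) / k) ^ (1 / (2 * β + d))

/-- The regularization parameter `λ_k = (log (k+1) / k)^{β/(2β+d)}`. -/
noncomputable def regParam (d : ℕ) (β : ℝ) (k : ℕ) : ℝ :=
  (Real.log (k + 1) / k) ^ (β / (2 * β + d))

/-- The iterates `z_1, z_2, …` of the projected gradient descent with estimated gradients and steps
`η_k = 2/(α k)`, started at `z₁`, run on the data `(x 1, y 1), (x 2, y 2), …`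
(the value at index `0` is a dummy). -/
noncomputable def iterate {d : ℕ} (Θ : Set (Vec d)) (β α : ℝ) (K : Vec d → ℝ) (z₁ : Vec d)
    (x : ℕ → Vec d) (y : ℕ → ℝ) : ℕ → Vec d
  | 0 => z₁
  | 1 => z₁
  | k + 2 =>
    let zk := iterate Θ β α K z₁ x y (k + 1)
    proj Θ (zk - (2 / (α * (k + 1 : ℕ))) •
      gradEst (order β) K (bandwidth d β (k + 1)) (regParam d β (k + 1)) (k + 1) x y zk)

/-- The design: `X 1, …, X n` are i.i.d. random vectors with a density with respect to the Lebesgue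
measure that lies between `pmin` and `pmax` on `Θ'`. -/
structure IsDesign {d : ℕ} {Ω : Type*} [MeasurableSpace Ω] (μ : Measure Ω) (n : ℕ)
    (Θ : Set (Vec d)) (pmin pmax : ℝ) (X : ℕ → Ω → Vec d) : Prop where
  measurable : ∀ i ∈ Finset.Icc 1 n, Measurable (X i)
  indep : iIndepFun (fun i : Finset.Icc 1 n => X i) μ
  density : ∃ p : Vec d → ℝ, Measurable p ∧ (∀ x, 0 ≤ p x) ∧
    (∀ i ∈ Finset.Icc 1 n, μ.map (X i) = volume.withDensity fun x => ENNReal.ofReal (p x)) ∧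
    ∀ x ∈ enlarge Θ, pmin ≤ p x ∧ p x ≤ pmax

/-- The noise: `ξ 1, …, ξ n` are independent, independent of the design, centered, and
sub-exponential with parameter `σ`. -/
structure IsNoise {d : ℕ} {Ω : Type*} [MeasurableSpace Ω] (μ : Measure Ω) (n : ℕ)
    (X : ℕ → Ω → Vec d) (σ : ℝ) (ξ : ℕ → Ω → ℝ) : Prop where
  measurable : ∀ i ∈ Finset.Icc 1 n, Measurable (ξ i)
  indep : iIndepFun (fun i : Finset.Icc 1 n => ξ i) μ
  indep_design : IndepFun (fun ω (i : Finset.Icc 1 n) => ξ i ω)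
    (fun ω (i : Finset.Icc 1 n) => X i ω) μ
  centered : ∀ i ∈ Finset.Icc 1 n, ∫ ω, ξ i ω ∂μ = 0
  subexp : ∀ i ∈ Finset.Icc 1 n, Integrable (fun ω => Real.exp (|ξ i ω| / σ)) μ ∧
    ∫ ω, Real.exp (|ξ i ω| / σ) ∂μ ≤ 2

/-- The quantities other than the dimension on which the constant of the risk bound may depend;
the dependence on `Θ` and on the kernel is through dimension-free characteristics. -/
structure ConstParams where
  β : ℝ
  L : ℝ
  M : ℝ
  pmin : ℝ
  pmax : ℝ
  σ : ℝ
  /-- diameter of `Θ` -/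
  diam : ℝ
  /-- supremum of the kernel -/
  supK : ℝ
  /-- Lipschitz constant of the kernel -/
  lipK : ℝ
  /-- smallest eigenvalue of `∫ U Uᵀ K` -/
  eigK : ℝ

end PassiveDesign

open PassiveDesign

/-!
# Passive zero-order optimization by locally polynomial gradient estimation

The risk bound rests on one estimate: uniformly over `z ∈ Θ`, the gradient estimator built from `k`
observations has mean squared error of order `h_k^{2(β-1)}`, up to a factor polynomial in `d`
(`exists_majorant_gradEst`). Uniformity in `z` is what makes this usable at the random point `z_k`,
which depends on the same data.

*Algebra.* Write `D_k(z) = B_k(z) θ + bias + noise`, with `θ` the Taylor coefficients of `f` at `z`.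
Then `w = (B_k(z) + λ)⁻¹ D_k(z) - θ` solves `(B_k(z) + λ) w = bias + noise - λ θ`. The mean of `B_k(z)`
is at least `μ₀ = pmin · kernelMinEig`, and if `T` bounds the entrywise deviation of `B_k(z)` from its
mean and `S` is the number of multi-indices, the two inequalities `λ ‖w‖ ≤ ‖r‖` and
`(μ₀ - S T) ‖w‖ ≤ ‖r‖` combine to `μ₀ ‖w‖ ≤ (1 + S T / λ) ‖r‖` (`norm_le_of_regularized_eq`). This
holds without any smallness of `T`, so no exceptional event has to be treated: it suffices that
`T / λ` and the noise divided by `λ` have fourth moments polynomial in `d`. The vector `θ` is bounded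
free of dimension because `kernelMinEig · ‖θ‖²` is at most the integral of the squared Taylor
polynomial against the kernel, and that polynomial is bounded by `M + L` on the unit ball.

*Probability.* Since `λ_k = h_k^β` and `k h_k^{2β+d} = log (k + 1)`, the deviations of the rescaled
sums are of order `λ_k`. They are sums of independent variables with exponential moments, bounded for
`B_k` and sub-exponential for the noise. A grid of mesh `k⁻²` has a size whose logarithm is
polynomial in `d` times `log (k + 1)`, and the maximum over the grid is controlled by the exponential
moment at `t ≈ log (k + 1) / λ_k` (`exists_majorant_pow_four`, `exists_majorant_rescaled_sum`). Suprema
are replaced throughout by integrable majorants, which avoids any question of measurability.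

*Recursion.* Strong convexity and the projection give
`r_{k+1} ≤ (1 - 2/k) r_k + F ρ_k / (α² k)` for `r_k = 𝐄‖z_k - x*‖²` and
`ρ_k = (log (k + 1) / k)^{2(β-1)/(2β+d)}`, whence `r_{k+1} ≤ F ρ_k / α²` by induction
(`le_of_recursion`). The other bound is `r_n ≤ diam² Θ`.
-/

namespace PassiveDesign

section Monomials

/-! ### Monomials and multi-indices -/

lemma one_le_order {β : ℝ} (hβ : 2 ≤ β) : 1 ≤ order β := by
  have : 2 ≤ ⌈β⌉₊ := by
    have h : (2 : ℝ) ≤ ⌈β⌉₊ := hβ.trans (Nat.le_ceil β)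
    exact_mod_cast h
  unfold order
  omega

lemma abs_apply_le_norm {d : ℕ} (u : Vec d) (i : Fin d) : |u i| ≤ ‖u‖ := by
  simpa using PiLp.norm_apply_le u i

lemma abs_prod_sub_prod_le {ι : Type*} (s : Finset ι) (a b : ι → ℝ)
    (ha : ∀ i ∈ s, |a i| ≤ 1) (hb : ∀ i ∈ s, |b i| ≤ 1) :
    |∏ i ∈ s, a i - ∏ i ∈ s, b i| ≤ ∑ i ∈ s, |a i - b i| := by
  classical
  induction s using Finset.induction_on with
  | empty => simp
  | insert j s hj ih =>
    rw [Finset.prod_insert hj, Finset.prod_insert hj, Finset.sum_insert hj]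
    have ih' := ih (fun i hi => ha i (Finset.mem_insert_of_mem hi))
      (fun i hi => hb i (Finset.mem_insert_of_mem hi))
    have hs : |∏ i ∈ s, b i| ≤ 1 := by
      rw [Finset.abs_prod]
      exact Finset.prod_le_one (fun _ _ => abs_nonneg _)
        (fun i hi => hb i (Finset.mem_insert_of_mem hi))
    have haj := ha j (Finset.mem_insert_self j s)
    calc |a j * ∏ i ∈ s, a i - b j * ∏ i ∈ s, b i|
        = |(a j - b j) * ∏ i ∈ s, b i + a j * (∏ i ∈ s, a i - ∏ i ∈ s, b i)| := by ring_nf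
      _ ≤ |a j - b j| * |∏ i ∈ s, b i| + |a j| * |∏ i ∈ s, a i - ∏ i ∈ s, b i| := by
          rw [← abs_mul, ← abs_mul]; exact abs_add_le _ _
      _ ≤ |a j - b j| * 1 + 1 * ∑ i ∈ s, |a i - b i| := by gcongr
      _ = _ := by ring

lemma abs_pow_sub_pow_le {a b : ℝ} (ha : |a| ≤ 1) (hb : |b| ≤ 1) (n : ℕ) :
    |a ^ n - b ^ n| ≤ n * |a - b| := by
  simpa using abs_prod_sub_prod_le (Finset.range n) (fun _ => a) (fun _ => b)
    (fun _ _ => ha) (fun _ _ => hb)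

lemma one_le_prod_factorial {d ℓ : ℕ} (m : MultiIdx d ℓ) :
    (1 : ℝ) ≤ ∏ i, ((m.1 i : ℕ).factorial : ℝ) := by
  have h : 0 < ∏ i, (m.1 i : ℕ).factorial := Finset.prod_pos fun i _ => Nat.factorial_pos _
  exact_mod_cast h

lemma abs_U_le_one {d : ℕ} (ℓ : ℕ) {u : Vec d} (hu : ‖u‖ ≤ 1) (m : MultiIdx d ℓ) :
    |U ℓ u m| ≤ 1 := by
  have h1 := one_le_prod_factorial m
  unfold U
  rw [abs_div, abs_of_nonneg (zero_le_one.trans h1), Finset.abs_prod]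
  refine div_le_one_of_le₀ (le_trans ?_ h1) (by positivity)
  refine Finset.prod_le_one (fun _ _ => abs_nonneg _) fun i _ => ?_
  rw [abs_pow]
  exact pow_le_one₀ (abs_nonneg _) ((abs_apply_le_norm u i).trans hu)

lemma abs_U_sub_U_le {d : ℕ} (ℓ : ℕ) {u v : Vec d} (hu : ‖u‖ ≤ 1) (hv : ‖v‖ ≤ 1)
    (m : MultiIdx d ℓ) : |U ℓ u m - U ℓ v m| ≤ ℓ * d * ‖u - v‖ := by
  have h1 := one_le_prod_factorial m
  unfold U
  rw [← sub_div, abs_div, abs_of_nonneg (zero_le_one.trans h1)]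
  refine (div_le_self (abs_nonneg _) h1).trans ?_
  have hle : ∀ {w : Vec d}, ‖w‖ ≤ 1 → ∀ i, |w i| ≤ 1 := fun hw i =>
    (abs_apply_le_norm _ i).trans hw
  calc |∏ i, u i ^ (m.1 i : ℕ) - ∏ i, v i ^ (m.1 i : ℕ)|
      ≤ ∑ i, |u i ^ (m.1 i : ℕ) - v i ^ (m.1 i : ℕ)| := by
        refine abs_prod_sub_prod_le _ _ _ (fun i _ => ?_) (fun i _ => ?_)
        · rw [abs_pow]; exact pow_le_one₀ (abs_nonneg _) (hle hu i)
        · rw [abs_pow]; exact pow_le_one₀ (abs_nonneg _) (hle hv i)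
    _ ≤ ∑ _i : Fin d, (ℓ : ℝ) * ‖u - v‖ := by
        refine Finset.sum_le_sum fun i _ => ?_
        refine (abs_pow_sub_pow_le (hle hu i) (hle hv i) _).trans ?_
        have h2 : ((m.1 i : ℕ) : ℝ) ≤ ℓ := by exact_mod_cast Nat.lt_succ_iff.1 (m.1 i).2
        have h3 : |u i - v i| ≤ ‖u - v‖ := by simpa using abs_apply_le_norm (u - v) i
        gcongr
    _ = ℓ * d * ‖u - v‖ := by simp; ring

lemma U_smul {d : ℕ} (ℓ : ℕ) (c : ℝ) (u : Vec d) (m : MultiIdx d ℓ) :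
    U ℓ (c • u) m = c ^ (∑ i, (m.1 i : ℕ)) * U ℓ u m := by
  unfold U
  simp only [PiLp.smul_apply, smul_eq_mul, mul_pow, Finset.prod_mul_distrib,
    Finset.prod_pow_eq_pow_sum]
  ring

@[fun_prop]
lemma continuous_U {d : ℕ} (ℓ : ℕ) (m : MultiIdx d ℓ) : Continuous fun u : Vec d => U ℓ u m := by
  unfold U
  fun_prop

/-- The multi-index `0`. -/
def zeroIdx (d ℓ : ℕ) : MultiIdx d ℓ := ⟨fun _ => 0, by simp⟩

@[simp]
lemma U_zeroIdx {d : ℕ} (ℓ : ℕ) (u : Vec d) : U ℓ u (zeroIdx d ℓ) = 1 := by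
  simp [U, zeroIdx]

/-- The number of multi-indices grows polynomially in the dimension, with a degree that depends
only on `ℓ`: each of them has weight at least `d^{-ℓ} / ℓ!` in the expansion of
`(∑ j ≤ ℓ, d^{-j} / j!)^d ≤ e`. -/
lemma card_multiIdx_le {d : ℕ} (hd : 1 ≤ d) (ℓ : ℕ) :
    (Fintype.card (MultiIdx d ℓ) : ℝ) ≤ 3 * ℓ.factorial * (d : ℝ) ^ ℓ := by
  have hd0 : (0 : ℝ) < d := by exact_mod_cast hd
  have hd1 : (d : ℝ)⁻¹ ≤ 1 := inv_le_one_of_one_le₀ (by exact_mod_cast hd)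
  let F : (Fin d → Fin (ℓ + 1)) → ℝ := fun m =>
    ∏ i, ((d : ℝ)⁻¹ ^ (m i : ℕ) / ((m i : ℕ).factorial : ℝ))
  have hF : ∀ m, 0 ≤ F m := fun m => Finset.prod_nonneg fun i _ => by positivity
  have hsum : ∑ m, F m ≤ 3 := by
    have h1 : ∑ m, F m = (∑ j : Fin (ℓ + 1), (d : ℝ)⁻¹ ^ (j : ℕ) / ((j : ℕ).factorial : ℝ)) ^ d := by
      have := Finset.prod_univ_sum (fun _ : Fin d => (Finset.univ : Finset (Fin (ℓ + 1))))
        (fun _ j => (d : ℝ)⁻¹ ^ (j : ℕ) / ((j : ℕ).factorial : ℝ))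
      simp only [Finset.prod_const, Finset.card_univ, Fintype.card_fin,
        Fintype.piFinset_univ] at this
      exact this.symm
    rw [h1]
    have h2 : ∑ j : Fin (ℓ + 1), (d : ℝ)⁻¹ ^ (j : ℕ) / ((j : ℕ).factorial : ℝ)
        ≤ Real.exp (d : ℝ)⁻¹ := by
      rw [Fin.sum_univ_eq_sum_range (fun j => (d : ℝ)⁻¹ ^ j / (j.factorial : ℝ)) (ℓ + 1)]
      exact Real.sum_le_exp_of_nonneg (by positivity) _
    calc _ ≤ Real.exp (d : ℝ)⁻¹ ^ d := by
          gcongr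
      _ = Real.exp 1 := by
          rw [← Real.exp_nat_mul, mul_inv_cancel₀ hd0.ne']
      _ ≤ 3 := by linarith [Real.exp_one_lt_d9]
  have hterm : ∀ m : MultiIdx d ℓ, ((d : ℝ) ^ ℓ * ℓ.factorial)⁻¹ ≤ F m.1 := by
    intro m
    have h1 : F m.1 = (d : ℝ)⁻¹ ^ (∑ i, (m.1 i : ℕ)) / ∏ i, ((m.1 i : ℕ).factorial : ℝ) := by
      simp only [F]
      rw [Finset.prod_div_distrib, Finset.prod_pow_eq_pow_sum]
    have h2 : ∏ i, ((m.1 i : ℕ).factorial : ℝ) ≤ ℓ.factorial := by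
      have h3 := Nat.le_of_dvd (Nat.factorial_pos _)
        (Nat.prod_factorial_dvd_factorial_sum Finset.univ (fun i => (m.1 i : ℕ)))
      exact_mod_cast h3.trans (Nat.factorial_le m.2)
    rw [h1, mul_inv, ← div_eq_mul_inv, ← inv_pow]
    have h4 := one_le_prod_factorial m
    gcongr ?_ / ?_
    exact pow_le_pow_of_le_one (by positivity) hd1 m.2
  have hle : (Fintype.card (MultiIdx d ℓ) : ℝ) * ((d : ℝ) ^ ℓ * ℓ.factorial)⁻¹ ≤ 3 := by
    calc _ = ∑ _m : MultiIdx d ℓ, ((d : ℝ) ^ ℓ * ℓ.factorial)⁻¹ := by simp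
      _ ≤ ∑ m : MultiIdx d ℓ, F m.1 := Finset.sum_le_sum fun m _ => hterm m
      _ ≤ ∑ m, F m := by
          calc ∑ m : MultiIdx d ℓ, F m.1
              = ∑ m ∈ Finset.univ.filter
                  (fun m : Fin d → Fin (ℓ + 1) => ∑ i, (m i : ℕ) ≤ ℓ), F m :=
                (Finset.sum_subtype _ (by simp) F).symm
            _ ≤ _ := Finset.sum_le_univ_sum_of_nonneg hF
      _ ≤ 3 := hsum
  rw [mul_inv_le_iff₀ (by positivity)] at hle
  linarith

/-! ### Localized monomials weighted by the kernel -/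

/-- The function `U_m U_{m'} K`: its rescaled empirical averages are the entries of `B_k`, and, for
`m' = 0`, the noise part of `D_k`. -/
noncomputable def kerMon {d : ℕ} (ℓ : ℕ) (K : Vec d → ℝ) (m m' : MultiIdx d ℓ) (u : Vec d) : ℝ :=
  U ℓ u m * U ℓ u m' * K u

variable {d : ℕ} {K : Vec d → ℝ} {LK : NNReal}

lemma IsKernel.eq_zero (hK : IsKernel K LK) {u : Vec d} (hu : 1 < ‖u‖) : K u = 0 := by
  by_contra h
  have := hK.supp (subset_tsupport K h)
  simp at this
  linarith

lemma IsKernel.le_sup (hK : IsKernel K LK) (u : Vec d) : K u ≤ ⨆ u, K u := le_ciSup hK.bdd u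

lemma IsKernel.continuous (hK : IsKernel K LK) : Continuous K := hK.lipschitz.continuous

lemma IsKernel.sup_nonneg (hK : IsKernel K LK) : 0 ≤ ⨆ u, K u :=
  (hK.nonneg 0).trans (hK.le_sup 0)

lemma abs_kerMon_le (hK : IsKernel K LK) (ℓ : ℕ) (m m' : MultiIdx d ℓ) (u : Vec d) :
    |kerMon ℓ K m m' u| ≤ K u := by
  unfold kerMon
  by_cases hu : ‖u‖ ≤ 1
  · rw [abs_mul, abs_mul, abs_of_nonneg (hK.nonneg u)]
    have h1 := abs_U_le_one ℓ hu m
    have h2 := abs_U_le_one ℓ hu m'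
    have h3 : |U ℓ u m| * |U ℓ u m'| ≤ 1 := mul_le_one₀ h1 (abs_nonneg _) h2
    exact mul_le_of_le_one_left (hK.nonneg u) h3
  · simp [hK.eq_zero (not_le.1 hu)]

lemma kerMon_eq_zero (hK : IsKernel K LK) (ℓ : ℕ) (m m' : MultiIdx d ℓ) {u : Vec d}
    (hu : 1 < ‖u‖) : kerMon ℓ K m m' u = 0 := by
  simp [kerMon, hK.eq_zero hu]

lemma continuous_kerMon (hK : IsKernel K LK) (ℓ : ℕ) (m m' : MultiIdx d ℓ) :
    Continuous (kerMon ℓ K m m') := by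
  have := hK.continuous
  unfold kerMon
  fun_prop

lemma abs_kerMon_sub_le (hK : IsKernel K LK) (ℓ : ℕ) (m m' : MultiIdx d ℓ) (u v : Vec d) :
    |kerMon ℓ K m m' u - kerMon ℓ K m m' v| ≤ (LK + 2 * (⨆ u, K u) * ℓ * d) * ‖u - v‖ := by
  have hS := hK.sup_nonneg
  have hKL : |K u - K v| ≤ LK * ‖u - v‖ := by
    have := hK.lipschitz.dist_le_mul u v
    rwa [Real.dist_eq, dist_eq_norm] at this
  have hle : (LK : ℝ) * ‖u - v‖ ≤ (LK + 2 * (⨆ u, K u) * ℓ * d) * ‖u - v‖ := by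
    gcongr
    have : 0 ≤ 2 * (⨆ u, K u) * ℓ * d := by positivity
    linarith
  by_cases hu : ‖u‖ ≤ 1
  · by_cases hv : ‖v‖ ≤ 1
    · have e : kerMon ℓ K m m' u - kerMon ℓ K m m' v =
          (U ℓ u m - U ℓ v m) * U ℓ u m' * K u + U ℓ v m * (U ℓ u m' - U ℓ v m') * K u
            + U ℓ v m * U ℓ v m' * (K u - K v) := by
        unfold kerMon; ring
      have a1 := abs_U_le_one ℓ hu m'
      have a2 := abs_U_le_one ℓ hv m
      have a3 := abs_U_le_one ℓ hv m'
      have b1 := abs_U_sub_U_le ℓ hu hv m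
      have b2 := abs_U_sub_U_le ℓ hu hv m'
      have hKu : |K u| ≤ ⨆ u, K u := by rw [abs_of_nonneg (hK.nonneg u)]; exact hK.le_sup u
      rw [e]
      calc _ ≤ |(U ℓ u m - U ℓ v m) * U ℓ u m' * K u| + |U ℓ v m * (U ℓ u m' - U ℓ v m') * K u|
            + |U ℓ v m * U ℓ v m' * (K u - K v)| := abs_add_three _ _ _
        _ ≤ (ℓ * d * ‖u - v‖) * 1 * (⨆ u, K u) + 1 * (ℓ * d * ‖u - v‖) * (⨆ u, K u)
            + 1 * 1 * (LK * ‖u - v‖) := by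
            simp only [abs_mul]
            gcongr
        _ = _ := by ring
    · rw [kerMon_eq_zero hK ℓ m m' (not_le.1 hv), sub_zero]
      rw [hK.eq_zero (not_le.1 hv), sub_zero] at hKL
      exact ((abs_kerMon_le hK ℓ m m' u).trans ((le_abs_self _).trans hKL)).trans hle
  · rw [kerMon_eq_zero hK ℓ m m' (not_le.1 hu), zero_sub, abs_neg]
    rw [hK.eq_zero (not_le.1 hu), zero_sub, abs_neg] at hKL
    exact ((abs_kerMon_le hK ℓ m m' v).trans ((le_abs_self _).trans hKL)).trans hle

lemma IsKernel.hasCompactSupport (hK : IsKernel K LK) : HasCompactSupport K :=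
  IsCompact.of_isClosed_subset (isCompact_closedBall 0 1) (isClosed_tsupport K) hK.supp

lemma IsKernel.integrable (hK : IsKernel K LK) : Integrable K :=
  hK.continuous.integrable_of_hasCompactSupport hK.hasCompactSupport

lemma integrable_kerMon (hK : IsKernel K LK) (ℓ : ℕ) (m m' : MultiIdx d ℓ) :
    Integrable (kerMon ℓ K m m') := by
  refine hK.integrable.mono' (continuous_kerMon hK ℓ m m').aestronglyMeasurable ?_
  exact Filter.Eventually.of_forall fun u => by simpa using abs_kerMon_le hK ℓ m m' u

lemma integral_kerMon_sq_le (hK : IsKernel K LK) (ℓ : ℕ) (m m' : MultiIdx d ℓ) :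
    Integrable (fun u => kerMon ℓ K m m' u ^ 2) ∧
      ∫ u, kerMon ℓ K m m' u ^ 2 ≤ ⨆ u, K u := by
  have hle : ∀ u, kerMon ℓ K m m' u ^ 2 ≤ (⨆ u, K u) * K u := fun u => by
    rw [← sq_abs, sq]
    have h := abs_kerMon_le hK ℓ m m' u
    exact mul_le_mul (h.trans (hK.le_sup u)) h (abs_nonneg _) hK.sup_nonneg
  have hint : Integrable (fun u => kerMon ℓ K m m' u ^ 2) := by
    refine (hK.integrable.const_mul (⨆ u, K u)).mono'
      ((continuous_kerMon hK ℓ m m').pow 2).aestronglyMeasurable ?_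
    exact Filter.Eventually.of_forall fun u => by
      rw [Real.norm_eq_abs, abs_of_nonneg (sq_nonneg _)]; exact hle u
  refine ⟨hint, ?_⟩
  calc _ ≤ ∫ u, (⨆ u, K u) * K u :=
        integral_mono hint (hK.integrable.const_mul _) hle
    _ = ⨆ u, K u := by rw [integral_const_mul, hK.integral_eq_one, mul_one]

end Monomials

section KernelMatrix

/-! ### The smallest eigenvalue of the kernel matrix -/

variable {d : ℕ} {K : Vec d → ℝ} {LK : NNReal}

/-- The polynomial `∑ v_m U_m` as a formal polynomial. -/
noncomputable def uPoly {d ℓ : ℕ} (v : MultiIdx d ℓ → ℝ) : MvPolynomial (Fin d) ℝ :=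
  ∑ m, MvPolynomial.monomial (Finsupp.equivFunOnFinite.symm fun i => (m.1 i : ℕ))
    (v m / ∏ i, ((m.1 i : ℕ).factorial : ℝ))

lemma eval_uPoly {ℓ : ℕ} (v : MultiIdx d ℓ → ℝ) (u : Vec d) :
    MvPolynomial.eval (fun i => u i) (uPoly v) = ∑ m, v m * U ℓ u m := by
  unfold uPoly U
  rw [map_sum]
  refine Finset.sum_congr rfl fun m _ => ?_
  rw [MvPolynomial.eval_monomial, Finsupp.prod_fintype _ _ (by simp)]
  simp only [Finsupp.equivFunOnFinite_symm_apply_apply]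
  ring

lemma eq_zero_of_uPoly_eq_zero {ℓ : ℕ} {v : MultiIdx d ℓ → ℝ} (h : uPoly v = 0) : v = 0 := by
  funext m
  have h1 := congrArg
    (MvPolynomial.coeff (Finsupp.equivFunOnFinite.symm fun i => (m.1 i : ℕ))) h
  unfold uPoly at h1
  rw [MvPolynomial.coeff_sum, Finset.sum_eq_single m] at h1
  · rw [MvPolynomial.coeff_monomial, if_pos rfl, MvPolynomial.coeff_zero, div_eq_zero_iff] at h1
    rcases h1 with h1 | h1
    · exact h1
    · linarith [one_le_prod_factorial m]
  · intro m' _ hm'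
    rw [MvPolynomial.coeff_monomial, if_neg]
    intro he
    apply hm'
    have h2 := Finsupp.equivFunOnFinite.symm.injective he
    ext i
    exact congrFun h2 i
  · simp

/-- A polynomial `∑ v_m U_m` which vanishes on a nonempty open set has zero coefficients. -/
lemma exists_sum_mul_U_ne_zero {ℓ : ℕ} {v : MultiIdx d ℓ → ℝ} (hv : v ≠ 0) {s : Set (Vec d)}
    (hs : IsOpen s) (hne : s.Nonempty) : ∃ u ∈ s, ∑ m, v m * U ℓ u m ≠ 0 := by
  by_contra! hcon
  obtain ⟨u₀, hu₀⟩ := hne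
  have hopen : IsOpen ((WithLp.toLp 2 : (Fin d → ℝ) → Vec d) ⁻¹' s) :=
    hs.preimage (PiLp.continuous_toLp 2 _)
  obtain ⟨δ, hδ, hball⟩ := Metric.isOpen_iff.1 hopen (fun i => u₀ i) hu₀
  have hp : uPoly v = 0 := by
    refine MvPolynomial.funext_set (fun i => Metric.ball (u₀ i) δ) (fun i => ?_) fun x hx => ?_
    · rw [Real.ball_eq_Ioo]
      exact Set.Ioo_infinite (by linarith)
    · rw [map_zero]
      rw [← ball_pi _ hδ] at hx
      have := hcon _ (hball hx)
      rw [← eval_uPoly] at this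
      exact this
  exact hv (eq_zero_of_uPoly_eq_zero hp)

/-- The matrix `∫ U Uᵀ K`. -/
noncomputable def kernelMatrix (ℓ : ℕ) (K : Vec d → ℝ) :
    Matrix (MultiIdx d ℓ) (MultiIdx d ℓ) ℝ :=
  Matrix.of fun m m' => ∫ u, U ℓ u m * U ℓ u m' * K u

lemma sq_sum_mul_U_mul (ℓ : ℕ) (v : MultiIdx d ℓ → ℝ) (u : Vec d) :
    (∑ m, v m * U ℓ u m) ^ 2 * K u = ∑ m, ∑ m', v m * v m' * kerMon ℓ K m m' u := by
  rw [sq, Finset.sum_mul_sum, Finset.sum_mul]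
  refine Finset.sum_congr rfl fun m _ => ?_
  rw [Finset.sum_mul]
  refine Finset.sum_congr rfl fun m' _ => ?_
  unfold kerMon; ring

lemma continuous_sq_sum_mul_U_mul (hK : IsKernel K LK) (ℓ : ℕ) (v : MultiIdx d ℓ → ℝ) :
    Continuous fun u => (∑ m, v m * U ℓ u m) ^ 2 * K u := by
  have := hK.continuous
  fun_prop

lemma integral_sq_sum_mul_U_mul (hK : IsKernel K LK) (ℓ : ℕ) (v : MultiIdx d ℓ → ℝ) :
    Integrable (fun u => (∑ m, v m * U ℓ u m) ^ 2 * K u) ∧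
    ∫ u, (∑ m, v m * U ℓ u m) ^ 2 * K u = v ⬝ᵥ (kernelMatrix ℓ K).mulVec v := by
  have hi : ∀ m m', Integrable fun u => v m * v m' * kerMon ℓ K m m' u :=
    fun m m' => (integrable_kerMon hK ℓ m m').const_mul _
  simp only [sq_sum_mul_U_mul]
  refine ⟨integrable_finsetSum _ fun m _ => integrable_finsetSum _ fun m' _ => hi m m', ?_⟩
  rw [integral_finsetSum _ fun m _ => integrable_finsetSum _ fun m' _ => hi m m']
  unfold dotProduct Matrix.mulVec dotProduct
  refine Finset.sum_congr rfl fun m _ => ?_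
  rw [integral_finsetSum _ fun m' _ => hi m m', Finset.mul_sum]
  refine Finset.sum_congr rfl fun m' _ => ?_
  rw [integral_const_mul]
  simp only [kernelMatrix, Matrix.of_apply, kerMon]
  ring

lemma isHermitian_kernelMatrix (ℓ : ℕ) (K : Vec d → ℝ) : (kernelMatrix ℓ K).IsHermitian := by
  ext m m'
  simp [kernelMatrix, mul_comm (U ℓ _ m)]

lemma posDef_kernelMatrix (hK : IsKernel K LK) (ℓ : ℕ) : (kernelMatrix ℓ K).PosDef := by
  refine Matrix.PosDef.of_dotProduct_mulVec_pos (isHermitian_kernelMatrix ℓ K) fun v hv => ?_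
  rw [star_trivial, ← (integral_sq_sum_mul_U_mul hK ℓ v).2]
  obtain ⟨u₀, hu₀⟩ : ∃ u, 0 < K u := by
    by_contra! h
    have : K = 0 := funext fun u => le_antisymm (h u) (hK.nonneg u)
    have h1 := hK.integral_eq_one
    simp [this] at h1
  obtain ⟨u, hu, hne⟩ := exists_sum_mul_U_ne_zero (ℓ := ℓ) hv
    (isOpen_lt continuous_const hK.continuous) ⟨u₀, hu₀⟩
  refine (continuous_sq_sum_mul_U_mul hK ℓ v).integral_pos_of_hasCompactSupport_nonneg_nonzero
    (hK.hasCompactSupport.mul_left) (fun w => mul_nonneg (sq_nonneg _) (hK.nonneg w)) (x := u) ?_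
  have : 0 < K u := hu
  positivity

lemma kernelMinEig_pos (hK : IsKernel K LK) (ℓ : ℕ) : 0 < kernelMinEig ℓ K := by
  have h := posDef_kernelMatrix hK ℓ
  have hs : spectrum ℝ (kernelMatrix ℓ K) = Set.range h.1.eigenvalues :=
    h.1.spectrum_real_eq_range_eigenvalues
  have : Nonempty (MultiIdx d ℓ) := ⟨zeroIdx d ℓ⟩
  have hmem : kernelMinEig ℓ K ∈ Set.range h.1.eigenvalues := by
    change sInf (spectrum ℝ (kernelMatrix ℓ K)) ∈ _
    rw [hs]
    exact (Set.range_nonempty _).csInf_mem (Set.finite_range _)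
  obtain ⟨i, hi⟩ := hmem
  rw [← hi]
  exact h.eigenvalues_pos i

/-- The quadratic form of `∫ U Uᵀ K` is at least its smallest eigenvalue. -/
lemma kernelMinEig_mul_le (hK : IsKernel K LK) (ℓ : ℕ) (v : MultiIdx d ℓ → ℝ) :
    kernelMinEig ℓ K * (v ⬝ᵥ v) ≤ ∫ u, (∑ m, v m * U ℓ u m) ^ 2 * K u := by
  rw [(integral_sq_sum_mul_U_mul hK ℓ v).2]
  have h := isHermitian_kernelMatrix ℓ K
  set c := kernelMinEig ℓ K with hc
  have hsub : (kernelMatrix ℓ K - algebraMap ℝ _ c).PosSemidef := by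
    rw [Matrix.posSemidef_iff_isHermitian_and_spectrum_nonneg]
    have hH : (kernelMatrix ℓ K - algebraMap ℝ _ c).IsHermitian := by
      refine h.sub ?_
      rw [Matrix.IsHermitian, Matrix.algebraMap_eq_diagonal, Matrix.diagonal_conjTranspose]
      simp
    refine ⟨hH, fun x hx => ?_⟩
    have hx' : x + c ∈ spectrum ℝ (kernelMatrix ℓ K) := by
      rw [← spectrum.sub_singleton_eq] at hx
      obtain ⟨y, hy, w, hw, rfl⟩ := hx
      rw [Set.mem_singleton_iff.1 hw]
      simpa using hy
    have hbdd : BddBelow (spectrum ℝ (kernelMatrix ℓ K)) := by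
      rw [h.spectrum_real_eq_range_eigenvalues]
      exact (Set.finite_range _).bddBelow
    have : c ≤ x + c := csInf_le hbdd hx'
    show (0:ℝ) ≤ x
    linarith
  have h2 := hsub.dotProduct_mulVec_nonneg v
  rw [star_trivial, Matrix.sub_mulVec, dotProduct_sub] at h2
  have h3 : (algebraMap ℝ (Matrix (MultiIdx d ℓ) (MultiIdx d ℓ) ℝ) c).mulVec v = c • v := by
    rw [Algebra.algebraMap_eq_smul_one, Matrix.smul_mulVec, Matrix.one_mulVec]
  rw [h3, dotProduct_smul, smul_eq_mul] at h2
  linarith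

end KernelMatrix

section FixedData

/-! ### The error of the gradient estimator for fixed data -/

variable {d : ℕ} {K : Vec d → ℝ} {LK : NNReal}

section Euclidean

variable {ι : Type*} [Fintype ι]

lemma norm_toLp_sq (v : ι → ℝ) : ‖WithLp.toLp 2 v‖ ^ 2 = v ⬝ᵥ v := by
  rw [EuclideanSpace.norm_sq_eq, dotProduct]
  refine Finset.sum_congr rfl fun i _ => ?_
  simp [sq]

lemma dotProduct_le_norm_mul_norm (v w : ι → ℝ) :
    v ⬝ᵥ w ≤ ‖WithLp.toLp 2 v‖ * ‖WithLp.toLp 2 w‖ := by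
  have h := real_inner_le_norm (WithLp.toLp 2 w) (WithLp.toLp 2 v)
  rw [EuclideanSpace.inner_toLp_toLp, star_trivial] at h
  linarith [mul_comm ‖WithLp.toLp 2 v‖ ‖WithLp.toLp 2 w‖]

lemma sum_abs_sq_le (v : ι → ℝ) : (∑ i, |v i|) ^ 2 ≤ Fintype.card ι * (v ⬝ᵥ v) := by
  have := sq_sum_le_card_mul_sum_sq (s := Finset.univ) (f := fun i => |v i|)
  simpa [dotProduct, sq] using this

lemma norm_toLp_le_card_mul {v : ι → ℝ} {c : ℝ} (hv : ∀ i, |v i| ≤ c) (hc : 0 ≤ c) :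
    ‖WithLp.toLp 2 v‖ ≤ Fintype.card ι * c := by
  refine le_of_sq_le_sq ?_ (by positivity)
  rw [norm_toLp_sq, dotProduct]
  calc ∑ i, v i * v i ≤ ∑ _i : ι, c * c := by
        refine Finset.sum_le_sum fun i _ => ?_
        rw [← abs_mul_abs_self (v i)]
        exact mul_le_mul (hv i) (hv i) (abs_nonneg _) hc
    _ = Fintype.card ι * c ^ 2 := by simp [sq]
    _ ≤ (Fintype.card ι * c) ^ 2 := by
        rw [mul_pow]
        gcongr
        have : (Fintype.card ι) ≤ (Fintype.card ι) ^ 2 := Nat.le_self_pow (by norm_num) _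
        exact_mod_cast this

/-- A perturbation bound for the regularized inverse: if `B ≥ 0` is entrywise `T`-close to a form
bounded below by `μ₀`, then `‖(B + λ)⁻¹ r‖ ≤ (1 + S T / λ) ‖r‖ / μ₀`, with `S`
the dimension. No smallness of `T` is required. -/
lemma norm_le_of_regularized_eq {B Bbar : Matrix ι ι ℝ} {lam μ₀ T : ℝ} (hlam : 0 < lam)
    (hB : ∀ v, 0 ≤ v ⬝ᵥ B.mulVec v) (hBbar : ∀ v, μ₀ * (v ⬝ᵥ v) ≤ v ⬝ᵥ Bbar.mulVec v)
    (hT0 : 0 ≤ T) (hT : ∀ i j, |B i j - Bbar i j| ≤ T) {w r : ι → ℝ}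
    (hw : B.mulVec w + lam • w = r) :
    μ₀ * ‖WithLp.toLp 2 w‖ ≤ (1 + Fintype.card ι * T / lam) * ‖WithLp.toLp 2 r‖ := by
  set N := ‖WithLp.toLp 2 w‖ with hN
  have hN0 : 0 ≤ N := norm_nonneg _
  have hN2 : w ⬝ᵥ w = N ^ 2 := (norm_toLp_sq w).symm
  have hwr : w ⬝ᵥ B.mulVec w + lam * N ^ 2 ≤ N * ‖WithLp.toLp 2 r‖ := by
    have := dotProduct_le_norm_mul_norm w r
    rwa [← hw, dotProduct_add, dotProduct_smul, smul_eq_mul, hN2, hw] at this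
  have hdiff : w ⬝ᵥ Bbar.mulVec w - w ⬝ᵥ B.mulVec w ≤ Fintype.card ι * T * N ^ 2 := by
    have e : w ⬝ᵥ Bbar.mulVec w - w ⬝ᵥ B.mulVec w
        = ∑ i, ∑ j, w i * (Bbar i j - B i j) * w j := by
      simp only [dotProduct, Matrix.mulVec, Finset.mul_sum, ← Finset.sum_sub_distrib]
      refine Finset.sum_congr rfl fun i _ => Finset.sum_congr rfl fun j _ => by ring
    rw [e]
    calc _ ≤ ∑ i, ∑ j, |w i| * T * |w j| := by
          refine Finset.sum_le_sum fun i _ => Finset.sum_le_sum fun j _ => ?_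
          refine (le_abs_self _).trans ?_
          rw [abs_mul, abs_mul, abs_sub_comm]
          gcongr
          exact hT i j
      _ = T * (∑ i, |w i|) ^ 2 := by
          rw [sq, Finset.sum_mul_sum, Finset.mul_sum]
          refine Finset.sum_congr rfl fun i _ => ?_
          rw [Finset.mul_sum]
          exact Finset.sum_congr rfl fun j _ => by ring
      _ ≤ T * (Fintype.card ι * N ^ 2) := by
          rw [← hN2]
          exact mul_le_mul_of_nonneg_left (sum_abs_sq_le w) hT0
      _ = _ := by ring
  rcases hN0.eq_or_lt with h0 | hpos
  · rw [← h0, mul_zero]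
    positivity
  · have h1 : lam * N ≤ ‖WithLp.toLp 2 r‖ := by
      have : N * (lam * N) ≤ N * ‖WithLp.toLp 2 r‖ := by nlinarith [hB w]
      exact le_of_mul_le_mul_left this hpos
    have h2 : μ₀ * N ≤ ‖WithLp.toLp 2 r‖ + Fintype.card ι * T * N := by
      have h3 := hBbar w
      rw [hN2] at h3
      have : N * (μ₀ * N) ≤ N * (‖WithLp.toLp 2 r‖ + Fintype.card ι * T * N) := by
        nlinarith [mul_nonneg hlam.le (sq_nonneg N)]
      exact le_of_mul_le_mul_left this hpos
    have h4 : N ≤ ‖WithLp.toLp 2 r‖ / lam := by rw [le_div_iff₀ hlam]; linarith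
    calc μ₀ * N ≤ ‖WithLp.toLp 2 r‖ + Fintype.card ι * T * (‖WithLp.toLp 2 r‖ / lam) := by
          refine h2.trans ?_
          gcongr
      _ = _ := by ring

end Euclidean

/-- The multi-index `e_i`. -/
def unitIdx {d ℓ : ℕ} (hℓ : 1 ≤ ℓ) (i : Fin d) : MultiIdx d ℓ :=
  ⟨Pi.single i ⟨1, by omega⟩, by
    rw [Finset.sum_eq_single i] <;> simp +contextual [hℓ]⟩

lemma unitIdx_coe {d ℓ : ℕ} (hℓ : 1 ≤ ℓ) (i : Fin d) :
    (fun j => ((unitIdx hℓ i).1 j : ℕ)) = Pi.single i 1 := by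
  funext j
  by_cases h : j = i
  · subst h; simp [unitIdx]
  · simp [unitIdx, h]

lemma unitIdx_injective {d ℓ : ℕ} (hℓ : 1 ≤ ℓ) :
    Function.Injective (unitIdx hℓ : Fin d → MultiIdx d ℓ) := by
  intro i j hij
  have h : (Pi.single i 1 : Fin d → ℕ) = Pi.single j 1 := by
    rw [← unitIdx_coe hℓ, ← unitIdx_coe hℓ, hij]
  have := congrFun h i
  by_contra hne
  simp [hne] at this

lemma matA_mulVec {ℓ : ℕ} (hℓ : 1 ≤ ℓ) (w : MultiIdx d ℓ → ℝ) :
    (matA d ℓ).mulVec w = fun i => w (unitIdx hℓ i) := by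
  funext i
  rw [Matrix.mulVec, dotProduct, Finset.sum_eq_single (unitIdx hℓ i)]
  · simp [matA, unitIdx_coe]
  · intro m _ hm
    rw [matA, if_neg, zero_mul]
    intro h
    apply hm
    rw [← unitIdx_coe hℓ] at h
    ext j
    exact congrFun h j
  · simp

lemma norm_matA_mulVec_le {ℓ : ℕ} (hℓ : 1 ≤ ℓ) (w : MultiIdx d ℓ → ℝ) :
    ‖WithLp.toLp 2 ((matA d ℓ).mulVec w)‖ ≤ ‖WithLp.toLp 2 w‖ := by
  refine le_of_sq_le_sq ?_ (norm_nonneg _)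
  rw [norm_toLp_sq, norm_toLp_sq, matA_mulVec hℓ, dotProduct, dotProduct]
  rw [← Finset.sum_image (s := Finset.univ) (g := unitIdx hℓ) (f := fun m => w m * w m)
    (fun _ _ _ _ h => unitIdx_injective hℓ h)]
  exact Finset.sum_le_univ_sum_of_nonneg fun m => mul_self_nonneg _

lemma multiD_single (i : Fin d) (f : Vec d → ℝ) : multiD (Pi.single i 1) f = partialD i f := by
  have key : ∀ l : List (Fin d), l.Nodup →
      l.foldr (fun j g => (partialD j)^[(Pi.single i 1 : Fin d → ℕ) j] g) f
        = if i ∈ l then partialD i f else f := by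
    intro l
    induction l with
    | nil => simp
    | cons a l ih =>
      intro hl
      rw [List.nodup_cons] at hl
      rw [List.foldr_cons, ih hl.2]
      by_cases h : a = i
      · subst h
        simp [hl.1]
      · simp [h, Ne.symm h]
  unfold multiD
  rw [key _ (List.nodup_finRange d), if_pos (List.mem_finRange i)]

lemma gradient_apply (f : Vec d → ℝ) (z : Vec d) (i : Fin d) :
    gradient f z i = partialD i f z := by
  have h : inner ℝ (gradient f z) (EuclideanSpace.single i (1 : ℝ))
      = fderiv ℝ f z (EuclideanSpace.single i 1) := by
    rw [gradient, InnerProductSpace.toDual_symm_apply]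
  rw [EuclideanSpace.inner_single_right] at h
  simpa [partialD] using h

/-- The coefficients, in the basis `U_m`, of the Taylor polynomial of `f` at `z` seen at scale `h`,
that is, of `u ↦ ∑ D^m f(z) (h u)^m / m!`. -/
noncomputable def taylorCoeff (ℓ : ℕ) (f : Vec d → ℝ) (z : Vec d) (h : ℝ) : MultiIdx d ℓ → ℝ :=
  fun m => multiD (fun i => (m.1 i : ℕ)) f z * h ^ (∑ i, (m.1 i : ℕ))

lemma matA_mulVec_taylorCoeff {ℓ : ℕ} (hℓ : 1 ≤ ℓ) (f : Vec d → ℝ) (z : Vec d) (h : ℝ) :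
    WithLp.toLp 2 ((matA d ℓ).mulVec (taylorCoeff ℓ f z h)) = h • gradient f z := by
  ext i
  have h1 : ∑ j, ((unitIdx hℓ i).1 j : ℕ) = 1 := by
    have := unitIdx_coe hℓ i
    calc _ = ∑ j, (Pi.single i 1 : Fin d → ℕ) j := by rw [← this]
      _ = 1 := by simp
  simp only [PiLp.smul_apply, smul_eq_mul]
  rw [matA_mulVec hℓ, gradient_apply]
  simp only [taylorCoeff]
  rw [h1, unitIdx_coe, multiD_single, pow_one, mul_comm]

lemma HolderClass.abs_sub_taylor_le {β L : ℝ} {f : Vec d → ℝ} (hf : HolderClass β L f)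
    (hL : 0 < L) (hβ : 2 ≤ β) (z : Vec d) {h : ℝ} (hh : 0 ≤ h) {u : Vec d} (hu : ‖u‖ ≤ 1) :
    |f (z + h • u) - ∑ m, taylorCoeff (order β) f z h m * U (order β) u m| ≤ L * h ^ β := by
  have h1 := hf.taylor z (z + h • u)
  have e : ∑ m : MultiIdx d (order β), multiD (fun i => (m.1 i : ℕ)) f z *
      U (order β) (z + h • u - z) m = ∑ m, taylorCoeff (order β) f z h m * U (order β) u m := by
    refine Finset.sum_congr rfl fun m _ => ?_
    rw [add_sub_cancel_left, U_smul, taylorCoeff]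
    ring
  rw [e] at h1
  refine h1.trans ?_
  rw [add_sub_cancel_left, norm_smul, Real.norm_eq_abs, abs_of_nonneg hh]
  gcongr
  exact mul_le_of_le_one_right hh hu

/-- The Taylor coefficients are bounded independently of the dimension: their Taylor polynomial is
bounded by `M + L` on the unit ball, while its square integrates against `K` to at least
`kernelMinEig` times the squared norm of the coefficients. -/
lemma RegressionClass.kernelMinEig_mul_taylorCoeff_le (hK : IsKernel K LK) {Θ : Set (Vec d)}
    {β L α M : ℝ} {f : Vec d → ℝ} {xstar : Vec d} (hf : RegressionClass Θ β L α M f xstar)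
    (hL : 0 < L) (hβ : 2 ≤ β) {z : Vec d} (hz : z ∈ Θ) {h : ℝ} (hh : 0 ≤ h) (hh1 : h ≤ 1) :
    kernelMinEig (order β) K * ‖WithLp.toLp 2 (taylorCoeff (order β) f z h)‖ ^ 2
      ≤ (M + L) ^ 2 := by
  rw [norm_toLp_sq]
  refine (kernelMinEig_mul_le hK (order β) _).trans ?_
  have hle : ∀ u, (∑ m, taylorCoeff (order β) f z h m * U (order β) u m) ^ 2 * K u
      ≤ (M + L) ^ 2 * K u := by
    intro u
    by_cases hu : ‖u‖ ≤ 1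
    · refine mul_le_mul_of_nonneg_right ?_ (hK.nonneg u)
      rw [← sq_abs]
      have h1 := hf.holder.abs_sub_taylor_le hL hβ z hh hu
      have h2 : |f (z + h • u)| ≤ M := by
        refine hf.bounded _ ⟨z, hz, h • u, ?_, rfl⟩
        rw [norm_smul, Real.norm_eq_abs, abs_of_nonneg hh]
        exact mul_le_one₀ hh1 (norm_nonneg _) hu
      have h3 : L * h ^ β ≤ L :=
        mul_le_of_le_one_right hL.le (Real.rpow_le_one hh hh1 (by linarith))
      have h4 : |∑ m, taylorCoeff (order β) f z h m * U (order β) u m| ≤ M + L := by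
        rw [abs_le] at *
        constructor <;> linarith [h1.1, h1.2, h2.1, h2.2]
      gcongr
    · simp [hK.eq_zero (not_le.1 hu)]
  calc _ ≤ ∫ u, (M + L) ^ 2 * K u :=
        integral_mono (integral_sq_sum_mul_U_mul hK _ _).1 (hK.integrable.const_mul _) hle
    _ = (M + L) ^ 2 := by rw [integral_const_mul, hK.integral_eq_one, mul_one]

lemma RegressionClass.kernelMinEig_mul_gradient_le (hK : IsKernel K LK) {Θ : Set (Vec d)}
    {β L α M : ℝ} {f : Vec d → ℝ} {xstar : Vec d} (hf : RegressionClass Θ β L α M f xstar)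
    (hL : 0 < L) (hβ : 2 ≤ β) {z : Vec d} (hz : z ∈ Θ) :
    kernelMinEig (order β) K * ‖gradient f z‖ ^ 2 ≤ (M + L) ^ 2 := by
  refine le_trans ?_ (hf.kernelMinEig_mul_taylorCoeff_le hK hL hβ hz zero_le_one le_rfl)
  have h1 := norm_matA_mulVec_le (one_le_order hβ) (taylorCoeff (order β) f z 1)
  rw [matA_mulVec_taylorCoeff (one_le_order hβ), one_smul] at h1
  have := (kernelMinEig_pos hK (order β)).le
  gcongr

lemma matB_apply (ℓ : ℕ) (K : Vec d → ℝ) (h : ℝ) (k : ℕ) (x : ℕ → Vec d) (z : Vec d)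
    (m m' : MultiIdx d ℓ) : matB ℓ K h k x z m m' =
      (1 / (k * h ^ d)) * ∑ i ∈ Finset.Icc 1 k, kerMon ℓ K m m' (h⁻¹ • (x i - z)) := by
  simp only [matB, Matrix.smul_apply, Matrix.sum_apply, Matrix.vecMulVec_apply, smul_eq_mul,
    kerMon]
  congr 1
  exact Finset.sum_congr rfl fun i _ => by ring

lemma matB_mulVec (ℓ : ℕ) (K : Vec d → ℝ) (h : ℝ) (k : ℕ) (x : ℕ → Vec d) (z : Vec d)
    (v : MultiIdx d ℓ → ℝ) (m : MultiIdx d ℓ) : (matB ℓ K h k x z).mulVec v m =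
      (1 / (k * h ^ d)) * ∑ i ∈ Finset.Icc 1 k, K (h⁻¹ • (x i - z)) *
        U ℓ (h⁻¹ • (x i - z)) m * ∑ m', v m' * U ℓ (h⁻¹ • (x i - z)) m' := by
  simp only [Matrix.mulVec, dotProduct, matB_apply, mul_assoc, Finset.mul_sum, Finset.sum_mul,
    kerMon]
  rw [Finset.sum_comm]
  refine Finset.sum_congr rfl fun i _ => Finset.sum_congr rfl fun m' _ => by ring

lemma dotProduct_matB_mulVec_nonneg (hK : IsKernel K LK) (ℓ : ℕ) {h : ℝ} (hh : 0 ≤ h) (k : ℕ)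
    (x : ℕ → Vec d) (z : Vec d) (v : MultiIdx d ℓ → ℝ) :
    0 ≤ v ⬝ᵥ (matB ℓ K h k x z).mulVec v := by
  have e : v ⬝ᵥ (matB ℓ K h k x z).mulVec v = (1 / (k * h ^ d)) * ∑ i ∈ Finset.Icc 1 k,
      K (h⁻¹ • (x i - z)) * (∑ m', v m' * U ℓ (h⁻¹ • (x i - z)) m') ^ 2 := by
    rw [dotProduct]
    simp only [matB_mulVec]
    simp only [Finset.mul_sum]
    rw [Finset.sum_comm]
    refine Finset.sum_congr rfl fun i _ => ?_
    rw [sq, Finset.sum_mul_sum, Finset.mul_sum, Finset.mul_sum]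
    refine Finset.sum_congr rfl fun m _ => ?_
    rw [Finset.mul_sum, Finset.mul_sum]
    exact Finset.sum_congr rfl fun m' _ => by ring
  rw [e]
  have := fun i => hK.nonneg (h⁻¹ • (x i - z))
  exact mul_nonneg (by positivity) (Finset.sum_nonneg fun i _ => mul_nonneg (this i) (sq_nonneg _))

/-- The noise part of the vector `D_k(z)`. -/
noncomputable def noiseVec (ℓ : ℕ) (K : Vec d → ℝ) (h : ℝ) (k : ℕ) (x : ℕ → Vec d) (ξ : ℕ → ℝ)
    (z : Vec d) (m : MultiIdx d ℓ) : ℝ :=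
  (1 / (k * h ^ d)) * ∑ i ∈ Finset.Icc 1 k, ξ i * kerMon ℓ K m (zeroIdx d ℓ) (h⁻¹ • (x i - z))

/-- The decomposition `D_k(z) = B_k(z) θ + bias + noise`, with `θ` the Taylor coefficients of `f` at
`z`; the bias is controlled entrywise by `L h^β` times the density estimate `B_k(z)_{00}`. -/
lemma exists_vecD_eq (hK : IsKernel K LK) {β L : ℝ} {f : Vec d → ℝ} (hf : HolderClass β L f)
    (hL : 0 < L) (hβ : 2 ≤ β) {h : ℝ} (hh : 0 < h) (k : ℕ) (x : ℕ → Vec d) (ξ : ℕ → ℝ)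
    (z : Vec d) : ∃ b : MultiIdx d (order β) → ℝ,
      vecD (order β) K h k x (fun i => f (x i) + ξ i) z =
        (matB (order β) K h k x z).mulVec (taylorCoeff (order β) f z h) + b
          + noiseVec (order β) K h k x ξ z ∧
      ∀ m, |b m| ≤ L * h ^ β * matB (order β) K h k x z (zeroIdx d _) (zeroIdx d _) := by
  set ℓ := order β with hℓ
  set θ := taylorCoeff ℓ f z h with hθ
  refine ⟨fun m => (1 / (k * h ^ d)) * ∑ i ∈ Finset.Icc 1 k, (f (x i) -
    ∑ m', θ m' * U ℓ (h⁻¹ • (x i - z)) m') * (K (h⁻¹ • (x i - z)) * U ℓ (h⁻¹ • (x i - z)) m),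
    ?_, ?_⟩
  · funext m
    simp only [vecD, Pi.add_apply, Pi.smul_apply, smul_eq_mul, Finset.sum_apply, matB_mulVec,
      noiseVec, kerMon, U_zeroIdx]
    rw [← mul_add, ← mul_add, ← Finset.sum_add_distrib, ← Finset.sum_add_distrib]
    congr 1
    exact Finset.sum_congr rfl fun i _ => by ring
  · intro m
    have hc : (0 : ℝ) ≤ 1 / (k * h ^ d) := by positivity
    rw [abs_mul, abs_of_nonneg hc, matB_apply, mul_left_comm]
    refine mul_le_mul_of_nonneg_left ?_ hc
    rw [Finset.mul_sum]
    refine (Finset.abs_sum_le_sum_abs _ _).trans (Finset.sum_le_sum fun i _ => ?_)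
    have hk0 : kerMon ℓ K (zeroIdx d ℓ) (zeroIdx d ℓ) (h⁻¹ • (x i - z)) = K (h⁻¹ • (x i - z)) := by
      simp [kerMon]
    rw [hk0]
    by_cases hu : ‖h⁻¹ • (x i - z)‖ ≤ 1
    · have h1 := hf.abs_sub_taylor_le hL hβ z hh.le hu
      rw [smul_inv_smul₀ hh.ne', add_sub_cancel] at h1
      rw [abs_mul, abs_mul, abs_of_nonneg (hK.nonneg _)]
      have h2 := abs_U_le_one ℓ hu m
      have h3 := hK.nonneg (h⁻¹ • (x i - z))
      calc _ ≤ (L * h ^ β) * (K (h⁻¹ • (x i - z)) * 1) := by gcongr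
        _ = _ := by ring
    · simp [hK.eq_zero (not_le.1 hu)]

/-- Deterministic error bound: the gradient estimation error is controlled by the entrywise
deviation `T₁` of `B_k(z)` from a form bounded below by `μ₀` and by the size `T₂` of the noise. -/
lemma norm_gradEst_sub_gradient_le (hK : IsKernel K LK) {β L : ℝ} {f : Vec d → ℝ}
    (hf : HolderClass β L f) (hL : 0 < L) (hβ : 2 ≤ β) {h : ℝ} (hh : 0 < h) (k : ℕ)
    (x : ℕ → Vec d) (ξ : ℕ → ℝ) (z : Vec d)
    {Bbar : Matrix (MultiIdx d (order β)) (MultiIdx d (order β)) ℝ} {μ₀ pmax T₁ T₂ tbar : ℝ}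
    (hμ₀ : 0 < μ₀) (hBbar : ∀ v, μ₀ * (v ⬝ᵥ v) ≤ v ⬝ᵥ Bbar.mulVec v)
    (hB0 : Bbar (zeroIdx d _) (zeroIdx d _) ≤ pmax) (hpmax : 0 ≤ pmax) (hT₁0 : 0 ≤ T₁)
    (hT₁ : ∀ m m', |matB (order β) K h k x z m m' - Bbar m m'| ≤ T₁) (hT₂0 : 0 ≤ T₂)
    (hT₂ : ∀ m, |noiseVec (order β) K h k x ξ z m| ≤ T₂)
    (htbar : ‖WithLp.toLp 2 (taylorCoeff (order β) f z h)‖ ≤ tbar) :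
    ‖gradEst (order β) K h (h ^ β) k x (fun i => f (x i) + ξ i) z - gradient f z‖ ≤
      h⁻¹ * μ₀⁻¹ * (1 + Fintype.card (MultiIdx d (order β)) * T₁ / h ^ β) *
        (h ^ β * tbar + Fintype.card (MultiIdx d (order β)) * (L * h ^ β * (pmax + T₁))
          + Fintype.card (MultiIdx d (order β)) * T₂) := by
  have hℓ1 : 1 ≤ (order β) := one_le_order hβ
  obtain ⟨b, hD, hb⟩ := exists_vecD_eq hK hf hL hβ hh k x ξ z
  set θ := taylorCoeff (order β) f z h with hθ
  set B := matB (order β) K h k x z with hBdef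
  set lam := h ^ β with hlamdef
  have hlam : 0 < lam := Real.rpow_pos_of_pos hh β
  set D := vecD (order β) K h k x (fun i => f (x i) + ξ i) z with hDdef
  set s := noiseVec (order β) K h k x ξ z with hs
  have hBnn := dotProduct_matB_mulVec_nonneg hK (order β) hh.le k x z
  rw [← hBdef] at hBnn
  set G := B + lam • (1 : Matrix (MultiIdx d (order β)) (MultiIdx d (order β)) ℝ) with hG
  have hGv : ∀ v, G.mulVec v = B.mulVec v + lam • v := fun v => by
    rw [hG, Matrix.add_mulVec, Matrix.smul_mulVec, Matrix.one_mulVec]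
  -- `B` is nonnegative and `λ > 0`, so the inverse in the estimator is a true inverse.
  have hGu : IsUnit G.det := by
    rw [← Matrix.isUnit_iff_isUnit_det, ← Matrix.mulVec_injective_iff_isUnit]
    rw [← Matrix.coe_mulVecLin, ← LinearMap.ker_eq_bot, LinearMap.ker_eq_bot']
    intro v hv
    rw [Matrix.mulVecLin_apply, hGv] at hv
    have h1 : v ⬝ᵥ B.mulVec v + lam * (v ⬝ᵥ v) = 0 := by
      rw [← smul_eq_mul, ← dotProduct_smul, ← dotProduct_add, hv, dotProduct_zero]
    have h2 : v ⬝ᵥ v = 0 := by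
      have h3 : 0 ≤ v ⬝ᵥ v := by rw [← norm_toLp_sq]; positivity
      have h4 := hBnn v
      nlinarith
    exact dotProduct_self_eq_zero.1 h2
  set w := G⁻¹.mulVec D - θ with hw
  have hweq : B.mulVec w + lam • w = b + s - lam • θ := by
    rw [← hGv, hw, Matrix.mulVec_sub, Matrix.mulVec_mulVec, Matrix.mul_nonsing_inv _ hGu,
      Matrix.one_mulVec, hGv, hD]
    abel
  have hmain := norm_le_of_regularized_eq hlam hBnn hBbar hT₁0 hT₁ hweq
  have hB00 : B (zeroIdx d (order β)) (zeroIdx d (order β)) ≤ pmax + T₁ := by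
    have := (abs_le.1 (hT₁ (zeroIdx d (order β)) (zeroIdx d (order β)))).2
    linarith
  have hr : ‖WithLp.toLp 2 (b + s - lam • θ)‖ ≤ lam * tbar +
      Fintype.card (MultiIdx d (order β)) * (L * lam * (pmax + T₁)) + Fintype.card (MultiIdx d (order β)) * T₂ := by
    have h1 : ‖WithLp.toLp 2 b‖ ≤ Fintype.card (MultiIdx d (order β)) * (L * lam * (pmax + T₁)) := by
      refine norm_toLp_le_card_mul (fun m => (hb m).trans ?_) (by positivity)
      gcongr
    have h2 : ‖WithLp.toLp 2 s‖ ≤ Fintype.card (MultiIdx d (order β)) * T₂ :=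
      norm_toLp_le_card_mul hT₂ hT₂0
    have h3 : ‖WithLp.toLp 2 (lam • θ)‖ ≤ lam * tbar := by
      rw [WithLp.toLp_smul, norm_smul, Real.norm_eq_abs, abs_of_pos hlam]
      gcongr
    rw [WithLp.toLp_sub, WithLp.toLp_add]
    calc _ ≤ ‖WithLp.toLp 2 b + WithLp.toLp 2 s‖ + ‖WithLp.toLp 2 (lam • θ)‖ := norm_sub_le _ _
      _ ≤ ‖WithLp.toLp 2 b‖ + ‖WithLp.toLp 2 s‖ + ‖WithLp.toLp 2 (lam • θ)‖ := by
          gcongr; exact norm_add_le _ _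
      _ ≤ _ := by linarith
  have herr : gradEst (order β) K h lam k x (fun i => f (x i) + ξ i) z - gradient f z
      = h⁻¹ • WithLp.toLp 2 ((matA d (order β)).mulVec w) := by
    have h1 := matA_mulVec_taylorCoeff hℓ1 f z h
    rw [hw, Matrix.mulVec_sub, WithLp.toLp_sub, smul_sub, h1, inv_smul_smul₀ hh.ne']
    rfl
  rw [herr, norm_smul, Real.norm_eq_abs, abs_of_pos (inv_pos.2 hh)]
  have h5 : ‖WithLp.toLp 2 w‖ ≤ μ₀⁻¹ * ((1 + Fintype.card (MultiIdx d (order β)) * T₁ / lam) *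
      ‖WithLp.toLp 2 (b + s - lam • θ)‖) := by
    rw [le_inv_mul_iff₀ hμ₀]; exact hmain
  calc _ ≤ h⁻¹ * (μ₀⁻¹ * ((1 + Fintype.card (MultiIdx d (order β)) * T₁ / lam) *
      (lam * tbar + Fintype.card (MultiIdx d (order β)) * (L * lam * (pmax + T₁)) +
        Fintype.card (MultiIdx d (order β)) * T₂))) := by
        gcongr
        refine (norm_matA_mulVec_le hℓ1 w).trans (h5.trans ?_)
        gcongr
    _ = _ := by ring

end FixedData

section ExponentialMoments

/-! ### Fourth moments of maxima from exponential moments -/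

/-- The exponential absorbs the part of `y` above the level `a`. In the next lemma `a` is chosen such
that the exponential term has mean at most one. -/
lemma pow_four_le_add_exp {a y : ℝ} (ha : 0 ≤ a) (hy : 0 ≤ y) :
    y ^ 4 ≤ 8 * a ^ 4 + 192 * Real.exp (y - a) := by
  rcases le_total y a with h | h
  · have h1 : y ^ 4 ≤ a ^ 4 := by gcongr
    have h2 := Real.exp_pos (y - a)
    have h3 : 0 ≤ a ^ 4 := by positivity
    linarith
  · obtain ⟨v, hv⟩ : ∃ v, y = a + v := ⟨y - a, by ring⟩
    have hv0 : 0 ≤ v := by linarith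
    have h1 := Real.pow_div_factorial_le_exp v hv0 4
    have h2 : y - a = v := by linarith
    rw [h2, hv]
    have h3 : (a + v) ^ 4 ≤ 8 * (a ^ 4 + v ^ 4) := by
      have := add_pow_le ha hv0 4
      norm_num at this
      linarith
    have h4 : (Nat.factorial 4 : ℝ) = 24 := by norm_num [Nat.factorial]
    rw [h4, div_le_iff₀ (by norm_num)] at h1
    linarith

variable {Ω : Type*} [MeasurableSpace Ω] {μ : Measure Ω}

/-- The fourth powers of finitely many random variables with exponential moments of order `t` at
most `e^b` have a common integrable majorant, whose mean is of order `((log J + b) / t)^4`, where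
`J` is the number of variables. -/
lemma exists_majorant_pow_four [IsProbabilityMeasure μ] {ι : Type*} [Fintype ι] [Nonempty ι]
    {Z : ι → Ω → ℝ} {t b : ℝ} (ht : 0 < t) (hb : 0 ≤ b)
    (hpos : ∀ j, Integrable (fun ω => Real.exp (t * Z j ω)) μ ∧
      ∫ ω, Real.exp (t * Z j ω) ∂μ ≤ Real.exp b)
    (hneg : ∀ j, Integrable (fun ω => Real.exp (-t * Z j ω)) μ ∧
      ∫ ω, Real.exp (-t * Z j ω) ∂μ ≤ Real.exp b) :
    ∃ Q : Ω → ℝ, Integrable Q μ ∧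
      ∫ ω, Q ω ∂μ ≤ (8 * (Real.log (2 * Fintype.card ι) + b) ^ 4 + 192) / t ^ 4 ∧
      ∀ ω j, Z j ω ^ 4 ≤ Q ω := by
  set J : ℝ := ((Fintype.card ι : ℕ) : ℝ) with hJ
  have hJ1 : 1 ≤ J := by
    have : 1 ≤ Fintype.card ι := Fintype.card_pos
    rw [hJ]
    exact_mod_cast this
  set a := Real.log (2 * J) + b with ha
  have ha0 : 0 ≤ a := add_nonneg (Real.log_nonneg (by linarith)) hb
  have hexpa : Real.exp (-a) * (2 * J * Real.exp b) = 1 := by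
    rw [ha, neg_add, Real.exp_add, Real.exp_neg, Real.exp_neg, Real.exp_log (by positivity)]
    have := (Real.exp_pos b).ne'
    field_simp
  have hadd : ∀ j, Integrable (fun ω => Real.exp (t * Z j ω) + Real.exp (-t * Z j ω)) μ :=
    fun j => (hpos j).1.add (hneg j).1
  have hint : Integrable (fun ω => ∑ j, (Real.exp (t * Z j ω) + Real.exp (-t * Z j ω))) μ :=
    integrable_finsetSum _ fun j _ => hadd j
  refine ⟨fun ω => (8 * a ^ 4 + 192 * (Real.exp (-a) *
    ∑ j, (Real.exp (t * Z j ω) + Real.exp (-t * Z j ω)))) / t ^ 4, ?_, ?_, ?_⟩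
  · exact ((integrable_const _).add ((hint.const_mul _).const_mul _)).div_const _
  · rw [integral_div, integral_add (integrable_const _) ((hint.const_mul _).const_mul _),
      integral_const, integral_const_mul, integral_const_mul,
      integral_finsetSum _ fun j _ => hadd j]
    simp only [probReal_univ, one_smul]
    have h1 : ∑ j, ∫ ω, (Real.exp (t * Z j ω) + Real.exp (-t * Z j ω)) ∂μ
        ≤ 2 * J * Real.exp b := by
      calc _ ≤ ∑ _j : ι, 2 * Real.exp b := by
            refine Finset.sum_le_sum fun j _ => ?_
            rw [integral_add (hpos j).1 (hneg j).1]
            linarith [(hpos j).2, (hneg j).2]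
        _ = _ := by simp [hJ]; ring
    gcongr ?_ / _
    have h2 := mul_le_mul_of_nonneg_left h1 (Real.exp_pos (-a)).le
    rw [hexpa] at h2
    linarith
  · intro ω j
    rw [le_div_iff₀ (by positivity)]
    have h1 := pow_four_le_add_exp ha0 (mul_nonneg ht.le (abs_nonneg (Z j ω)))
    have h2 : Real.exp (t * |Z j ω|) ≤ Real.exp (t * Z j ω) + Real.exp (-t * Z j ω) := by
      rcases abs_cases (Z j ω) with ⟨h, _⟩ | ⟨h, _⟩
      · rw [h]; linarith [Real.exp_pos (-t * Z j ω)]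
      · rw [h, mul_neg, ← neg_mul]; linarith [Real.exp_pos (t * Z j ω)]
    have h3 : Real.exp (t * Z j ω) + Real.exp (-t * Z j ω) ≤
        ∑ j, (Real.exp (t * Z j ω) + Real.exp (-t * Z j ω)) :=
      Finset.single_le_sum (f := fun j => Real.exp (t * Z j ω) + Real.exp (-t * Z j ω))
        (fun j _ => by positivity) (Finset.mem_univ j)
    have h4 : (t * |Z j ω|) ^ 4 = Z j ω ^ 4 * t ^ 4 := by
      rw [mul_pow, show |Z j ω| ^ 4 = (|Z j ω| ^ 2) ^ 2 by ring, sq_abs]; ring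
    rw [← h4]
    refine h1.trans ?_
    rw [sub_eq_add_neg, Real.exp_add, mul_comm (Real.exp (t * _))]
    gcongr
    exact h2.trans h3

/-! ### Exponential moments of the summands and of their sums -/

lemma exp_le_one_add_add_sq {y : ℝ} (hy : |y| ≤ 1) : Real.exp y ≤ 1 + y + y ^ 2 := by
  have := (abs_le.1 (Real.abs_exp_sub_one_sub_id_le hy)).2
  linarith

lemma exp_le_one_add_add_sq_mul_exp (y : ℝ) :
    Real.exp y ≤ 1 + y + y ^ 2 * Real.exp |y| := by
  have h1 : 1 ≤ Real.exp |y| := Real.one_le_exp (abs_nonneg y)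
  by_cases hy : |y| ≤ 1
  · have := exp_le_one_add_add_sq hy
    nlinarith [sq_nonneg y]
  · rw [not_le] at hy
    rcases lt_abs.1 hy with h | h
    · rw [abs_of_pos (by linarith)] at h1 ⊢
      have h2 : 0 ≤ (y ^ 2 - 1) * Real.exp y :=
        mul_nonneg (by nlinarith) (Real.exp_pos y).le
      nlinarith
    · have h2 : Real.exp y ≤ 1 := Real.exp_le_one_iff.2 (by linarith)
      nlinarith [sq_nonneg y]

/-- Exponential moment of a bounded variable after centering, in the range `|s| κ ≤ 1`. -/
lemma integral_exp_sub_mean_le [IsProbabilityMeasure μ] {W : Ω → ℝ} (hW : Measurable W)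
    {κ s : ℝ} (hWκ : ∀ ω, |W ω| ≤ κ) (hs : |s| * κ ≤ 1) :
    Integrable (fun ω => Real.exp (s * (W ω - ∫ ω, W ω ∂μ))) μ ∧
      ∫ ω, Real.exp (s * (W ω - ∫ ω, W ω ∂μ)) ∂μ ≤ Real.exp (s ^ 2 * ∫ ω, W ω ^ 2 ∂μ) := by
  set m := ∫ ω, W ω ∂μ with hm
  have hWi : Integrable W μ := Integrable.of_bound hW.aestronglyMeasurable κ
    (Filter.Eventually.of_forall hWκ)
  have hκ : 0 ≤ κ := by
    have : Nonempty Ω := nonempty_of_isProbabilityMeasure μ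
    exact (abs_nonneg _).trans (hWκ this.some)
  have hW2 : Integrable (fun ω => W ω ^ 2) μ :=
    Integrable.of_bound (hW.pow_const 2).aestronglyMeasurable (κ ^ 2)
      (Filter.Eventually.of_forall fun ω => by
        rw [norm_pow]; exact pow_le_pow_left₀ (norm_nonneg _) (hWκ ω) 2)
  have hsW : ∀ ω, |s * W ω| ≤ 1 := fun ω => by
    rw [abs_mul]
    exact (mul_le_mul_of_nonneg_left (hWκ ω) (abs_nonneg s)).trans hs
  have hE : Integrable (fun ω => Real.exp (s * W ω)) μ :=
    Integrable.of_bound (by fun_prop) (Real.exp 1) (Filter.Eventually.of_forall fun ω => by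
      rw [Real.norm_eq_abs, Real.abs_exp]
      exact Real.exp_le_exp.2 ((le_abs_self _).trans (hsW ω)))
  have e : ∀ ω, Real.exp (s * (W ω - m)) = Real.exp (-(s * m)) * Real.exp (s * W ω) := fun ω => by
    rw [← Real.exp_add]; ring_nf
  simp only [e]
  refine ⟨hE.const_mul _, ?_⟩
  rw [integral_const_mul]
  have hlin : Integrable (fun ω => 1 + s * W ω) μ := (integrable_const 1).add (hWi.const_mul s)
  have h1 : ∫ ω, Real.exp (s * W ω) ∂μ ≤ 1 + s * m + s ^ 2 * ∫ ω, W ω ^ 2 ∂μ := by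
    calc _ ≤ ∫ ω, (1 + s * W ω + s ^ 2 * W ω ^ 2) ∂μ := by
          refine integral_mono hE (hlin.add (hW2.const_mul _)) fun ω => ?_
          have := exp_le_one_add_add_sq (hsW ω)
          rwa [mul_pow] at this
      _ = _ := by
          rw [integral_add hlin (hW2.const_mul _),
            integral_add (integrable_const 1) (hWi.const_mul s), integral_const_mul,
            integral_const_mul]
          simp [hm]
  calc _ ≤ Real.exp (-(s * m)) * Real.exp (s * m + s ^ 2 * ∫ ω, W ω ^ 2 ∂μ) := by
        gcongr
        have := Real.add_one_le_exp (s * m + s ^ 2 * ∫ ω, W ω ^ 2 ∂μ)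
        linarith
    _ = _ := by rw [← Real.exp_add]; ring_nf

lemma sq_le_mul_exp {σ : ℝ} (hσ : 0 < σ) (x : ℝ) :
    x ^ 2 ≤ 8 * σ ^ 2 * Real.exp (|x| / (2 * σ)) := by
  have h0 : 0 ≤ |x| / (2 * σ) := by positivity
  have h := Real.quadratic_le_exp_of_nonneg h0
  have h2 : x ^ 2 = 8 * σ ^ 2 * ((|x| / (2 * σ)) ^ 2 / 2) := by
    rw [div_pow, sq_abs]; field_simp; ring
  rw [h2]
  gcongr
  linarith

lemma pow_four_le_mul_exp {σ : ℝ} (hσ : 0 < σ) (x : ℝ) :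
    |x| ^ 4 ≤ 24 * σ ^ 4 * Real.exp (|x| / σ) := by
  have h := Real.pow_div_factorial_le_exp (|x| / σ) (by positivity) 4
  have h4 : (Nat.factorial 4 : ℝ) = 24 := by norm_num [Nat.factorial]
  rw [h4] at h
  have h2 : |x| ^ 4 = 24 * σ ^ 4 * ((|x| / σ) ^ 4 / 24) := by
    field_simp
  rw [h2]
  gcongr

/-- Exponential moment of a centered sub-exponential variable multiplied by an independent bounded
one. -/
lemma integral_exp_mul_noise_le [IsProbabilityMeasure μ] {W ζ : Ω → ℝ} (hW : Measurable W)
    (hζ : Measurable ζ) (hind : IndepFun ζ W μ) {κ s σ : ℝ} (hσ : 0 < σ)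
    (hWκ : ∀ ω, |W ω| ≤ κ) (hs : |s| * κ ≤ 1 / (2 * σ)) (hcent : ∫ ω, ζ ω ∂μ = 0)
    (hexp : Integrable (fun ω => Real.exp (|ζ ω| / σ)) μ)
    (hexp2 : ∫ ω, Real.exp (|ζ ω| / σ) ∂μ ≤ 2) :
    Integrable (fun ω => Real.exp (s * (ζ ω * W ω))) μ ∧
      ∫ ω, Real.exp (s * (ζ ω * W ω)) ∂μ ≤
        Real.exp (16 * σ ^ 2 * s ^ 2 * ∫ ω, W ω ^ 2 ∂μ) := by
  have hκ : 0 ≤ κ := by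
    have : Nonempty Ω := nonempty_of_isProbabilityMeasure μ
    exact (abs_nonneg _).trans (hWκ this.some)
  have hWi : Integrable W μ := Integrable.of_bound hW.aestronglyMeasurable κ
    (Filter.Eventually.of_forall hWκ)
  have hW2 : Integrable (fun ω => W ω ^ 2) μ :=
    Integrable.of_bound (hW.pow_const 2).aestronglyMeasurable (κ ^ 2)
      (Filter.Eventually.of_forall fun ω => by
        rw [norm_pow]; exact pow_le_pow_left₀ (norm_nonneg _) (hWκ ω) 2)
  have hζi : Integrable ζ μ := by
    refine (hexp.const_mul σ).mono' hζ.aestronglyMeasurable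
      (Filter.Eventually.of_forall fun ω => ?_)
    have h1 := Real.add_one_le_exp (|ζ ω| / σ)
    rw [Real.norm_eq_abs]
    calc |ζ ω| = σ * (|ζ ω| / σ) := by field_simp
      _ ≤ _ := by gcongr; linarith
  have hprod1 : Integrable (fun ω => ζ ω * W ω) μ := hind.integrable_mul hζi hWi
  have hind2 : IndepFun (fun ω => Real.exp (|ζ ω| / σ)) (fun ω => W ω ^ 2) μ :=
    hind.comp (φ := fun x => Real.exp (|x| / σ)) (ψ := fun x => x ^ 2)
      (by fun_prop) (by fun_prop)
  have hprod2 : Integrable (fun ω => Real.exp (|ζ ω| / σ) * W ω ^ 2) μ :=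
    hind2.integrable_mul hexp hW2
  have habs : ∀ ω, |s * (ζ ω * W ω)| ≤ |ζ ω| / (2 * σ) := fun ω => by
    calc |s * (ζ ω * W ω)| = |ζ ω| * (|s| * |W ω|) := by rw [abs_mul, abs_mul]; ring
      _ ≤ |ζ ω| * (1 / (2 * σ)) := by
          gcongr
          exact (mul_le_mul_of_nonneg_left (hWκ ω) (abs_nonneg s)).trans hs
      _ = _ := by ring
  have hpt : ∀ ω, Real.exp (s * (ζ ω * W ω)) ≤ 1 + s * (ζ ω * W ω) +
      8 * σ ^ 2 * s ^ 2 * (Real.exp (|ζ ω| / σ) * W ω ^ 2) := fun ω => by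
    refine (exp_le_one_add_add_sq_mul_exp _).trans ?_
    gcongr 1 + _ + ?_
    calc (s * (ζ ω * W ω)) ^ 2 * Real.exp |s * (ζ ω * W ω)|
        ≤ (s ^ 2 * W ω ^ 2 * (8 * σ ^ 2 * Real.exp (|ζ ω| / (2 * σ)))) *
            Real.exp (|ζ ω| / (2 * σ)) := by
          have h1 : (s * (ζ ω * W ω)) ^ 2 = s ^ 2 * W ω ^ 2 * ζ ω ^ 2 := by ring
          rw [h1]
          gcongr
          · exact sq_le_mul_exp hσ _
          · exact habs ω
      _ = 8 * σ ^ 2 * s ^ 2 * ((Real.exp (|ζ ω| / (2 * σ)) * Real.exp (|ζ ω| / (2 * σ)))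
            * W ω ^ 2) := by ring
      _ = _ := by
          rw [← Real.exp_add]
          congr 4
          field_simp
          ring
  have hlin : Integrable (fun ω => 1 + s * (ζ ω * W ω)) μ :=
    (integrable_const 1).add (hprod1.const_mul s)
  have hmaj : Integrable (fun ω => 1 + s * (ζ ω * W ω) +
      8 * σ ^ 2 * s ^ 2 * (Real.exp (|ζ ω| / σ) * W ω ^ 2)) μ :=
    hlin.add (hprod2.const_mul _)
  have hE : Integrable (fun ω => Real.exp (s * (ζ ω * W ω))) μ := by
    refine hmaj.mono' (by fun_prop) (Filter.Eventually.of_forall fun ω => ?_)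
    rw [Real.norm_eq_abs, Real.abs_exp]
    exact hpt ω
  refine ⟨hE, ?_⟩
  have hm1 : ∫ ω, ζ ω * W ω ∂μ = 0 := by
    rw [hind.integral_fun_mul_eq_mul_integral hζ.aestronglyMeasurable hW.aestronglyMeasurable,
      hcent, zero_mul]
  have hm2 : ∫ ω, Real.exp (|ζ ω| / σ) * W ω ^ 2 ∂μ ≤ 2 * ∫ ω, W ω ^ 2 ∂μ := by
    rw [hind2.integral_fun_mul_eq_mul_integral (by fun_prop) (by fun_prop)]
    exact mul_le_mul_of_nonneg_right hexp2 (integral_nonneg fun ω => sq_nonneg _)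
  calc _ ≤ ∫ ω, (1 + s * (ζ ω * W ω) +
        8 * σ ^ 2 * s ^ 2 * (Real.exp (|ζ ω| / σ) * W ω ^ 2)) ∂μ := integral_mono hE hmaj hpt
    _ = 1 + 8 * σ ^ 2 * s ^ 2 * ∫ ω, Real.exp (|ζ ω| / σ) * W ω ^ 2 ∂μ := by
        rw [integral_add hlin (hprod2.const_mul _),
          integral_add (integrable_const 1) (hprod1.const_mul s), integral_const_mul,
          integral_const_mul, hm1]
        simp
    _ ≤ 1 + 8 * σ ^ 2 * s ^ 2 * (2 * ∫ ω, W ω ^ 2 ∂μ) := by gcongr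
    _ ≤ _ := by
        have := Real.add_one_le_exp (16 * σ ^ 2 * s ^ 2 * ∫ ω, W ω ^ 2 ∂μ)
        linarith

/-- Exponential moments multiply over independent summands. -/
lemma integral_exp_sum_le {n k : ℕ} (hkn : k ≤ n) {V : ℕ → Ω → ℝ}
    (hV : ∀ i ∈ Finset.Icc 1 n, Measurable (V i))
    (hind : iIndepFun (fun i : Finset.Icc 1 n => V i) μ) {s w : ℝ}
    (hs : ∀ i ∈ Finset.Icc 1 k, Integrable (fun ω => Real.exp (s * V i ω)) μ ∧
      ∫ ω, Real.exp (s * V i ω) ∂μ ≤ Real.exp w) :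
    Integrable (fun ω => Real.exp (s * ∑ i ∈ Finset.Icc 1 k, V i ω)) μ ∧
      ∫ ω, Real.exp (s * ∑ i ∈ Finset.Icc 1 k, V i ω) ∂μ ≤ Real.exp (k * w) := by
  have := hind.isProbabilityMeasure
  have hsub : Finset.Icc 1 k ⊆ Finset.Icc 1 n := Finset.Icc_subset_Icc_right hkn
  have hind' : iIndepFun (fun i : Finset.Icc 1 k => V i) μ :=
    hind.precomp (g := fun i : Finset.Icc 1 k => (⟨i.1, hsub i.2⟩ : Finset.Icc 1 n))
      (fun i j hij => Subtype.ext (congrArg (fun x : Finset.Icc 1 n => (x : ℕ)) hij))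
  have hmeas : ∀ i : Finset.Icc 1 k, Measurable (V i) := fun i => hV i (hsub i.2)
  have e : ∀ ω, ∑ i ∈ Finset.Icc 1 k, V i ω =
      (∑ i ∈ (Finset.univ : Finset (Finset.Icc 1 k)), (fun i : Finset.Icc 1 k => V i) i) ω :=
    fun ω => by
      rw [Finset.sum_apply]
      exact (Finset.sum_coe_sort (Finset.Icc 1 k) (fun i => V i ω)).symm
  simp only [e]
  refine ⟨hind'.integrable_exp_mul_sum hmeas fun i _ => (hs i i.2).1, ?_⟩
  have h1 := hind'.mgf_sum (t := s) hmeas Finset.univ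
  rw [mgf] at h1
  rw [h1]
  calc _ ≤ ∏ _i : Finset.Icc 1 k, Real.exp w :=
        Finset.prod_le_prod (fun i _ => mgf_nonneg) fun i _ => (hs i i.2).2
    _ = Real.exp (k * w) := by
        simp [Finset.prod_const, Real.exp_nat_mul]

/-! ### Consequences of the design and noise assumptions -/

/-- If two independent vectors have independent coordinates, then the pairs of corresponding
coordinates are independent. -/
lemma iIndepFun_pair [IsProbabilityMeasure μ] {ι E F : Type*} [Fintype ι] [MeasurableSpace E]
    [MeasurableSpace F] {ζ : ι → Ω → E} {Y : ι → Ω → F} (hζ : ∀ i, Measurable (ζ i))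
    (hY : ∀ i, Measurable (Y i)) (h1 : iIndepFun ζ μ) (h2 : iIndepFun Y μ)
    (h3 : IndepFun (fun ω i => ζ i ω) (fun ω i => Y i ω) μ) :
    iIndepFun (fun i ω => (ζ i ω, Y i ω)) μ := by
  have hp : ∀ i, IndepFun (ζ i) (Y i) μ := fun i =>
    h3.comp (measurable_pi_apply i) (measurable_pi_apply i)
  have hζp : ∀ i, IsProbabilityMeasure (μ.map (ζ i)) :=
    fun i => Measure.isProbabilityMeasure_map (hζ i).aemeasurable
  have hYp : ∀ i, IsProbabilityMeasure (μ.map (Y i)) :=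
    fun i => Measure.isProbabilityMeasure_map (hY i).aemeasurable
  have hζm : Measurable fun ω i => ζ i ω := measurable_pi_lambda _ hζ
  have hYm : Measurable fun ω i => Y i ω := measurable_pi_lambda _ hY
  rw [iIndepFun_iff_map_fun_eq_pi_map fun i => ((hζ i).prodMk (hY i)).aemeasurable]
  have hmarg : ∀ i, μ.map (fun ω => (ζ i ω, Y i ω)) = (μ.map (ζ i)).prod (μ.map (Y i)) := fun i =>
    (indepFun_iff_map_prod_eq_prod_map_map (hζ i).aemeasurable (hY i).aemeasurable).1 (hp i)
  simp only [hmarg]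
  have hmp := measurePreserving_arrowProdEquivProdArrow E F ι (fun i => μ.map (ζ i))
    (fun i => μ.map (Y i))
  have hjoint := (indepFun_iff_map_prod_eq_prod_map_map hζm.aemeasurable hYm.aemeasurable).1 h3
  rw [h1.map_fun_eq_pi_map fun i => (hζ i).aemeasurable,
    h2.map_fun_eq_pi_map fun i => (hY i).aemeasurable, ← hmp.map_eq] at hjoint
  have h4 := congrArg
    (Measure.map (MeasurableEquiv.arrowProdEquivProdArrow E F ι).symm) hjoint
  rw [Measure.map_map (MeasurableEquiv.measurable _) (hζm.prodMk hYm),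
    Measure.map_map (MeasurableEquiv.measurable _) (MeasurableEquiv.measurable _)] at h4
  rw [MeasurableEquiv.symm_comp_self, Measure.map_id] at h4
  exact h4

lemma integral_comp_rescale {d : ℕ} (F : Vec d → ℝ) {h : ℝ} (hh : 0 < h) (z : Vec d) :
    ∫ x, F (h⁻¹ • (x - z)) = h ^ d * ∫ u, F u := by
  rw [integral_sub_right_eq_self (fun x => F (h⁻¹ • x)) z,
    Measure.integral_comp_inv_smul_of_nonneg volume F hh.le]
  simp

/-- Localized averages against a density that lies between `pmin` and `pmax` on `Θ'`. -/
lemma integral_rescale_bounds {d : ℕ} {p : Vec d → ℝ} (hp : Measurable p) (hp0 : ∀ x, 0 ≤ p x)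
    [IsProbabilityMeasure (volume.withDensity fun x => ENNReal.ofReal (p x))] {Θ : Set (Vec d)}
    {pmin pmax : ℝ} (hpΘ : ∀ x ∈ enlarge Θ, pmin ≤ p x ∧ p x ≤ pmax) {F : Vec d → ℝ}
    (hF : Continuous F) (hF0 : ∀ u, 0 ≤ F u) (hF1 : ∀ u, 1 < ‖u‖ → F u = 0) {h : ℝ}
    (hh : 0 < h) (hh1 : h ≤ 1) {z : Vec d} (hz : z ∈ Θ) :
    pmin * (h ^ d * ∫ u, F u) ≤
        ∫ x, F (h⁻¹ • (x - z)) ∂(volume.withDensity fun x => ENNReal.ofReal (p x)) ∧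
      ∫ x, F (h⁻¹ • (x - z)) ∂(volume.withDensity fun x => ENNReal.ofReal (p x)) ≤
        pmax * (h ^ d * ∫ u, F u) := by
  have hcomp : HasCompactSupport F := HasCompactSupport.intro (isCompact_closedBall 0 1)
    fun u hu => hF1 u (by simpa using hu)
  have hFg : Continuous fun x => F (h⁻¹ • (x - z)) := by fun_prop
  have hcompg : HasCompactSupport fun x => F (h⁻¹ • (x - z)) := by
    refine HasCompactSupport.intro (isCompact_closedBall z h) fun x hx => hF1 _ ?_
    rw [Metric.mem_closedBall, dist_eq_norm, not_le] at hx
    rw [norm_smul, Real.norm_eq_abs, abs_of_pos (inv_pos.2 hh), ← div_eq_inv_mul, one_lt_div hh]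
    exact hx
  have hvol : Integrable fun x => F (h⁻¹ • (x - z)) :=
    hFg.integrable_of_hasCompactSupport hcompg
  obtain ⟨C, hC⟩ := hcompg.exists_bound_of_continuous hFg
  have hν : Integrable (fun x => F (h⁻¹ • (x - z)))
      (volume.withDensity fun x => ENNReal.ofReal (p x)) :=
    Integrable.of_bound hFg.aestronglyMeasurable C (Filter.Eventually.of_forall hC)
  have hmeas : Measurable fun x => ENNReal.ofReal (p x) := by fun_prop
  have hlt : ∀ᵐ x, ENNReal.ofReal (p x) < ⊤ := by simp
  rw [integrable_withDensity_iff_integrable_smul' hmeas hlt] at hν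
  rw [integral_withDensity_eq_integral_toReal_smul hmeas hlt]
  simp only [ENNReal.toReal_ofReal (hp0 _), smul_eq_mul] at hν ⊢
  rw [← integral_comp_rescale F hh z, ← integral_const_mul, ← integral_const_mul]
  have hpt : ∀ x, pmin * F (h⁻¹ • (x - z)) ≤ p x * F (h⁻¹ • (x - z)) ∧
      p x * F (h⁻¹ • (x - z)) ≤ pmax * F (h⁻¹ • (x - z)) := by
    intro x
    by_cases hx : ‖h⁻¹ • (x - z)‖ ≤ 1
    · have hmem : x ∈ enlarge Θ := by
        refine ⟨z, hz, x - z, ?_, by abel⟩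
        rw [norm_smul, Real.norm_eq_abs, abs_of_pos (inv_pos.2 hh), ← div_eq_inv_mul,
          div_le_one hh] at hx
        exact hx.trans hh1
      have h0 := hF0 (h⁻¹ • (x - z))
      exact ⟨mul_le_mul_of_nonneg_right (hpΘ x hmem).1 h0,
        mul_le_mul_of_nonneg_right (hpΘ x hmem).2 h0⟩
    · simp [hF1 _ (not_le.1 hx)]
  exact ⟨integral_mono (hvol.const_mul _) hν fun x => (hpt x).1,
    integral_mono hν (hvol.const_mul _) fun x => (hpt x).2⟩

end ExponentialMoments

section UniformDeviations

/-! ### Finite nets -/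

/-- A net of `Θ` inside `Θ`, with one point for each nonempty cell of a cubic grid of side `ε / d`. -/
lemma exists_finite_net {d : ℕ} {Θ : Set (Vec d)} (hb : Bornology.IsBounded Θ)
    (hne : Θ.Nonempty) (hd : 1 ≤ d) {ε : ℝ} (hε : 0 < ε) :
    ∃ N : Finset (Vec d), N.Nonempty ∧ (∀ p ∈ N, p ∈ Θ) ∧
      (N.card : ℝ) ≤ (2 * Metric.diam Θ * d / ε + 3) ^ d ∧ ∀ z ∈ Θ, ∃ p ∈ N, ‖z - p‖ ≤ ε := by
  classical
  obtain ⟨x₀, hx₀⟩ := hne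
  have hd0 : (0 : ℝ) < d := by exact_mod_cast hd
  set D := Metric.diam Θ with hD
  have hD0 : 0 ≤ D := Metric.diam_nonneg
  set δ := ε / d with hδ
  have hδ0 : 0 < δ := by positivity
  let cell : Vec d → Fin d → ℤ := fun z i => ⌊(z i - x₀ i) / δ⌋
  let g : (Fin d → ℤ) → Vec d := fun c => if h : ∃ z ∈ Θ, cell z = c then h.choose else x₀
  let cells : Finset (Fin d → ℤ) :=
    Fintype.piFinset fun _ => Finset.Icc ⌊-(D / δ)⌋ ⌊D / δ⌋
  have hmem : ∀ z ∈ Θ, cell z ∈ cells := by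
    intro z hz
    rw [Fintype.mem_piFinset]
    intro i
    have h1 : |z i - x₀ i| ≤ D := by
      have := (abs_apply_le_norm (z - x₀) i).trans
        ((dist_eq_norm z x₀).symm.le.trans (Metric.dist_le_diam_of_mem hb hz hx₀))
      simpa using this
    rw [abs_le] at h1
    rw [Finset.mem_Icc]
    refine ⟨Int.floor_le_floor ?_, Int.floor_le_floor ?_⟩
    · rw [← neg_div]
      exact div_le_div_of_nonneg_right h1.1 hδ0.le
    · exact div_le_div_of_nonneg_right h1.2 hδ0.le
  refine ⟨cells.image g, ⟨g (cell x₀), Finset.mem_image_of_mem _ (hmem x₀ hx₀)⟩, ?_, ?_, ?_⟩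
  · intro p hp
    obtain ⟨c, -, rfl⟩ := Finset.mem_image.1 hp
    by_cases h : ∃ z ∈ Θ, cell z = c
    · simp only [g, dif_pos h]
      exact h.choose_spec.1
    · simp only [g, dif_neg h]
      exact hx₀
  · have h1 : ((cells.image g).card : ℝ) ≤ cells.card := by exact_mod_cast Finset.card_image_le
    refine h1.trans ?_
    simp only [cells, Fintype.card_piFinset, Int.card_Icc, Finset.prod_const, Finset.card_univ,
      Fintype.card_fin, Nat.cast_pow]
    have hle : ⌊-(D / δ)⌋ ≤ ⌊D / δ⌋ := Int.floor_le_floor (by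
      have : 0 ≤ D / δ := by positivity
      linarith)
    have h2 : (((⌊D / δ⌋ + 1 - ⌊-(D / δ)⌋).toNat : ℕ) : ℝ)
        = (⌊D / δ⌋ : ℝ) + 1 - ⌊-(D / δ)⌋ := by
      have : (((⌊D / δ⌋ + 1 - ⌊-(D / δ)⌋).toNat : ℕ) : ℤ) = ⌊D / δ⌋ + 1 - ⌊-(D / δ)⌋ :=
        Int.toNat_of_nonneg (by omega)
      exact_mod_cast this
    rw [h2]
    have h3 : (⌊-(D / δ)⌋ : ℝ) ≤ ⌊D / δ⌋ := by exact_mod_cast hle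
    refine pow_le_pow_left₀ (by linarith) ?_ d
    have h4 := Int.floor_le (D / δ)
    have h5 := Int.lt_floor_add_one (-(D / δ))
    have h6 : D / δ = D * d / ε := by rw [hδ]; field_simp
    have h7 : 2 * D * d / ε = 2 * (D / δ) := by rw [h6]; ring
    rw [h7]
    linarith
  · intro z hz
    refine ⟨g (cell z), Finset.mem_image_of_mem _ (hmem z hz), ?_⟩
    have h : ∃ w ∈ Θ, cell w = cell z := ⟨z, hz, rfl⟩
    have hg : cell (g (cell z)) = cell z := by
      simp only [g, dif_pos h]
      exact h.choose_spec.2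
    set p := g (cell z) with hp
    have hi : ∀ i, |(z - p) i| ≤ δ := by
      intro i
      have h1 := Int.abs_sub_lt_one_of_floor_eq_floor (congrFun hg i).symm
      rw [← sub_div, abs_div, abs_of_pos hδ0, div_lt_one hδ0] at h1
      have h2 : z i - x₀ i - (p i - x₀ i) = (z - p) i := by simp
      rw [h2] at h1
      exact h1.le
    have h1 := norm_toLp_le_card_mul hi hδ0.le
    simp only [Fintype.card_fin] at h1
    calc ‖z - p‖ ≤ d * δ := h1
      _ = ε := by rw [hδ]; field_simp

/-! ### Uniform deviations -/

variable {Ω : Type*} [MeasurableSpace Ω] {μ : Measure Ω}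

/-- From a net to all of `Θ`: exponential moments at each point and a bound on the oscillation at
scale `ε` give an integrable majorant of the fourth power of the whole process. -/
lemma exists_uniform_majorant [IsProbabilityMeasure μ] {d : ℕ} {A : Type*} [Fintype A]
    [Nonempty A] {Θ : Set (Vec d)} (hb : Bornology.IsBounded Θ) (hne : Θ.Nonempty) (hd : 1 ≤ d)
    {Z : A → Vec d → Ω → ℝ} {t b ε : ℝ} (ht : 0 < t) (hb0 : 0 ≤ b) (hε : 0 < ε)
    (hexp : ∀ a, ∀ z ∈ Θ, ∀ s, |s| = t → Integrable (fun ω => Real.exp (s * Z a z ω)) μ ∧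
      ∫ ω, Real.exp (s * Z a z ω) ∂μ ≤ Real.exp b)
    {R : Ω → ℝ} (hR : Integrable R μ)
    (hosc : ∀ a z z' ω, ‖z - z'‖ ≤ ε → (Z a z ω - Z a z' ω) ^ 4 ≤ R ω) :
    ∃ Q : Ω → ℝ, Integrable Q μ ∧
      ∫ ω, Q ω ∂μ ≤ 8 * ((8 * (Real.log (2 * (Fintype.card A *
        (2 * Metric.diam Θ * d / ε + 3) ^ d)) + b) ^ 4 + 192) / t ^ 4) + 8 * ∫ ω, R ω ∂μ ∧
      ∀ ω a, ∀ z ∈ Θ, Z a z ω ^ 4 ≤ Q ω := by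
  obtain ⟨N, hN, hNΘ, hcard, hcov⟩ := exists_finite_net hb hne hd hε
  have : Nonempty N := hN.to_subtype
  obtain ⟨Q, hQi, hQ, hZQ⟩ := exists_majorant_pow_four (μ := μ) (ι := A × N)
    (Z := fun j => Z j.1 j.2) ht hb0
    (fun j => hexp j.1 j.2 (hNΘ _ j.2.2) t (abs_of_pos ht))
    (fun j => hexp j.1 j.2 (hNΘ _ j.2.2) (-t) (by rw [abs_neg, abs_of_pos ht]))
  refine ⟨fun ω => 8 * Q ω + 8 * R ω, (hQi.const_mul 8).add (hR.const_mul 8), ?_, ?_⟩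
  · rw [integral_add (hQi.const_mul 8) (hR.const_mul 8), integral_const_mul, integral_const_mul]
    have hA : (1 : ℝ) ≤ Fintype.card A := by exact_mod_cast Fintype.card_pos
    have hN1 : (1 : ℝ) ≤ N.card := by exact_mod_cast hN.card_pos
    have hAN : (1 : ℝ) ≤ Fintype.card A * N.card := one_le_mul_of_one_le_of_one_le hA hN1
    have hc : ((Fintype.card (A × N) : ℕ) : ℝ) = Fintype.card A * N.card := by
      simp [Fintype.card_prod]
    rw [hc] at hQ
    have hlog0 : 0 ≤ Real.log (2 * (Fintype.card A * N.card : ℝ)) :=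
      Real.log_nonneg (by linarith)
    have hlog : Real.log (2 * (Fintype.card A * N.card : ℝ)) ≤
        Real.log (2 * (Fintype.card A * (2 * Metric.diam Θ * d / ε + 3) ^ d)) := by
      refine Real.log_le_log (by linarith) ?_
      gcongr
    have h1 := hQ.trans (b := _) (c := (8 * (Real.log (2 * (Fintype.card A *
        (2 * Metric.diam Θ * d / ε + 3) ^ d)) + b) ^ 4 + 192) / t ^ 4) (by gcongr)
    linarith
  · intro ω a z hz
    obtain ⟨p, hp, hzp⟩ := hcov z hz
    have h1 := hZQ ω (a, ⟨p, hp⟩)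
    have h2 := hosc a z p ω hzp
    have h3 : Z a z ω ^ 4 ≤ 8 * (Z a p ω ^ 4 + (Z a z ω - Z a p ω) ^ 4) := by
      have e : Z a z ω = Z a p ω + (Z a z ω - Z a p ω) := by ring
      have := (Even.add_pow_le (n := 4) (by decide) : (Z a p ω + (Z a z ω - Z a p ω)) ^ 4 ≤ _)
      norm_num at this
      linarith
    simp only at h1
    linarith

/-! ### The bandwidth -/

section Bandwidth

variable {d k : ℕ} {β : ℝ}

lemma half_le_log (hk : 1 ≤ k) : 1 / 2 ≤ Real.log (k + 1) := by
  have h1 : (1 : ℝ) ≤ k := by exact_mod_cast hk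
  have h2 : Real.log 2 ≤ Real.log (k + 1) := Real.log_le_log (by norm_num) (by linarith)
  linarith [Real.log_two_gt_d9]

lemma log_div_pos (hk : 1 ≤ k) : 0 < Real.log (k + 1) / k := by
  have := half_le_log hk
  have h1 : (1 : ℝ) ≤ k := by exact_mod_cast hk
  have : 0 < Real.log (k + 1) := by linarith
  positivity

lemma log_div_le_one (hk : 1 ≤ k) : Real.log (k + 1) / k ≤ 1 := by
  have h1 : (1 : ℝ) ≤ k := by exact_mod_cast hk
  rw [div_le_one (by linarith)]
  have := Real.log_le_sub_one_of_pos (x := (k : ℝ) + 1) (by linarith)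
  linarith

lemma bandwidth_pos (hk : 1 ≤ k) : 0 < bandwidth d β k := Real.rpow_pos_of_pos (log_div_pos hk) _

lemma bandwidth_le_one (hk : 1 ≤ k) (hβ : 2 ≤ β) : bandwidth d β k ≤ 1 :=
  Real.rpow_le_one (log_div_pos hk).le (log_div_le_one hk) (by positivity)

lemma bandwidth_rpow (hk : 1 ≤ k) (γ : ℝ) :
    bandwidth d β k ^ γ = (Real.log (k + 1) / k) ^ (γ / (2 * β + d)) := by
  unfold bandwidth
  rw [← Real.rpow_mul (log_div_pos hk).le]
  congr 1
  ring

lemma regParam_eq (hk : 1 ≤ k) : regParam d β k = bandwidth d β k ^ β := by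
  rw [bandwidth_rpow hk, regParam]

lemma mul_bandwidth_pow (hk : 1 ≤ k) (hβ : 2 ≤ β) :
    k * bandwidth d β k ^ d * bandwidth d β k ^ (2 * β) = Real.log (k + 1) := by
  have hk0 : (0 : ℝ) < k := by exact_mod_cast hk
  rw [mul_assoc, ← Real.rpow_natCast, ← Real.rpow_add (bandwidth_pos hk), bandwidth_rpow hk,
    add_comm (d : ℝ), div_self (by positivity), Real.rpow_one]
  field_simp

lemma inv_bandwidth_pow_succ_le (hk : 1 ≤ k) (hβ : 2 ≤ β) :
    (bandwidth d β k ^ (d + 1))⁻¹ ≤ 2 * k := by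
  have hk0 : (0 : ℝ) < k := by exact_mod_cast hk
  have h1 : Real.log (k + 1) / k ≤ bandwidth d β k ^ (d + 1) := by
    rw [← Real.rpow_natCast, bandwidth_rpow hk]
    refine Real.self_le_rpow_of_le_one (log_div_pos hk).le (log_div_le_one hk) ?_
    rw [div_le_one (by positivity)]
    push_cast
    linarith
  calc _ ≤ (Real.log (k + 1) / k)⁻¹ := inv_anti₀ (log_div_pos hk) h1
    _ = k / Real.log (k + 1) := inv_div _ _
    _ ≤ k / (1 / 2) := by gcongr; exact half_le_log hk
    _ = 2 * k := by ring

lemma inv_sq_le_bandwidth_rpow (hk : 1 ≤ k) (hβ : 2 ≤ β) :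
    1 / (k : ℝ) ^ 2 ≤ 4 * bandwidth d β k ^ (4 * β) := by
  have hk0 : (0 : ℝ) < k := by exact_mod_cast hk
  have h1 : (Real.log (k + 1) / k) ^ 2 ≤ bandwidth d β k ^ (4 * β) := by
    rw [bandwidth_rpow hk, ← Real.rpow_natCast]
    refine Real.rpow_le_rpow_of_exponent_ge (log_div_pos hk) (log_div_le_one hk) ?_
    rw [div_le_iff₀ (by positivity)]
    push_cast
    have : (0 : ℝ) ≤ d := by positivity
    linarith
  calc 1 / (k : ℝ) ^ 2 = 4 * ((1 / 2) / k) ^ 2 := by ring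
    _ ≤ 4 * (Real.log (k + 1) / k) ^ 2 := by gcongr; exact half_le_log hk
    _ ≤ _ := by linarith

end Bandwidth

lemma log_net_le {d k A : ℕ} (hd : 1 ≤ d) (hk : 1 ≤ k) (hA : 1 ≤ A) {D : ℝ} (hD : 0 ≤ D) :
    0 ≤ Real.log (2 * (A * (2 * D * d / (1 / (k : ℝ) ^ 2) + 3) ^ d)) ∧
    Real.log (2 * (A * (2 * D * d / (1 / (k : ℝ) ^ 2) + 3) ^ d)) ≤
      (4 * A + (4 * D + 8) * (d : ℝ) ^ 2) * Real.log (k + 1) := by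
  have hd1 : (1 : ℝ) ≤ d := by exact_mod_cast hd
  have hk1 : (1 : ℝ) ≤ k := by exact_mod_cast hk
  have hA1 : (1 : ℝ) ≤ A := by exact_mod_cast hA
  have hl := half_le_log hk
  set l := Real.log (k + 1) with hldef
  have e : 2 * D * d / (1 / (k : ℝ) ^ 2) + 3 = 2 * D * d * (k : ℝ) ^ 2 + 3 := by
    rw [div_div_eq_mul_div, div_one]
  rw [e]
  have hy1 : 1 ≤ 2 * D * d * (k : ℝ) ^ 2 + 3 := by
    have : 0 ≤ 2 * D * d * (k : ℝ) ^ 2 := by positivity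
    linarith
  have hp1 : 1 ≤ (2 * D * d * (k : ℝ) ^ 2 + 3) ^ d := one_le_pow₀ hy1
  constructor
  · refine Real.log_nonneg ?_
    have := one_le_mul_of_one_le_of_one_le hA1 hp1
    linarith
  rw [← mul_assoc, Real.log_mul (by positivity) (by positivity), Real.log_pow]
  have h1 : Real.log (2 * A) ≤ 4 * A * l := by
    have := Real.log_le_self (x := 2 * (A : ℝ)) (by positivity)
    nlinarith
  have h2 : Real.log (2 * D * d * (k : ℝ) ^ 2 + 3) ≤ (4 * D * d + 8) * l := by
    have h3 : 2 * D * d * (k : ℝ) ^ 2 + 3 ≤ (2 * D * d + 3) * (k : ℝ) ^ 2 := by nlinarith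
    have h4 : Real.log (2 * D * d + 3) ≤ 2 * D * d + 3 := Real.log_le_self (by positivity)
    have h5 : Real.log k ≤ l := Real.log_le_log (by linarith) (by linarith)
    have h6 : 0 ≤ D * d := by positivity
    calc _ ≤ Real.log ((2 * D * d + 3) * (k : ℝ) ^ 2) := Real.log_le_log (by linarith) h3
      _ = Real.log (2 * D * d + 3) + 2 * Real.log k := by
          rw [Real.log_mul (by positivity) (by positivity), Real.log_pow]; norm_num
      _ ≤ (2 * D * d + 3) + 2 * l := by linarith
      _ ≤ _ := by nlinarith
  have h7 : (d : ℝ) * Real.log (2 * D * d * (k : ℝ) ^ 2 + 3) ≤ d * ((4 * D * d + 8) * l) := by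
    gcongr
  have h8 : (d : ℝ) * ((4 * D * d + 8) * l) ≤ (4 * D + 8) * (d : ℝ) ^ 2 * l := by
    have : (8 : ℝ) * d ≤ 8 * (d : ℝ) ^ 2 := by nlinarith
    nlinarith
  linarith

/-- The constant in the bound for the fourth moment of a uniform deviation: `A` is the number of
processes, `D` the diameter of the index set, `1 / κ` the range of the exponential moments, `v` the variance proxy, `Λ` and `r` control the oscillations. -/
noncomputable def devConst (d A : ℕ) (D κ v Λ r : ℝ) : ℝ :=
  8 * κ ^ 4 * (8 * (4 * A + (4 * D + 8) * (d : ℝ) ^ 2 + v) ^ 4 + 3072) + 512 * Λ ^ 4 * r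

/-- Uniform deviations of rescaled sums are, in fourth moment, of the order `h_k^β` of the
regularization parameter, up to a factor polynomial in the dimension. The exponential moment is used
at `t = log (k + 1) / (h_k^β κ)`, for which the logarithm of the size of the net and the variance term
are both of order `log (k + 1)`. -/
lemma exists_majorant_rescaled_sum [IsProbabilityMeasure μ] {d : ℕ} {A : Type*} [Fintype A]
    [Nonempty A] {Θ : Set (Vec d)} (hb : Bornology.IsBounded Θ) (hne : Θ.Nonempty) (hd : 1 ≤ d)
    {β : ℝ} (hβ : 2 ≤ β) {k : ℕ} (hk : 1 ≤ k) {W : A → Vec d → Ω → ℝ} {κ v Λ r : ℝ}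
    (hκ : 1 ≤ κ) (hv : 0 ≤ v) (hΛ : 0 ≤ Λ)
    (hexp : ∀ a, ∀ z ∈ Θ, ∀ s, |s| * κ ≤ 1 → Integrable (fun ω => Real.exp (s * W a z ω)) μ ∧
      ∫ ω, Real.exp (s * W a z ω) ∂μ ≤
        Real.exp (k * (s ^ 2 * (v * bandwidth d β k ^ d))))
    {ρ R : Ω → ℝ} (hρ : ∀ ω, 0 ≤ ρ ω) (hρR : ∀ ω, ρ ω ^ 4 ≤ R ω) (hR : Integrable R μ)
    (hRr : ∫ ω, R ω ∂μ ≤ r)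
    (hosc : ∀ a z z' ω, |W a z ω - W a z' ω| ≤
      k * (Λ * ((bandwidth d β k)⁻¹ * ‖z - z'‖)) * ρ ω) :
    ∃ Q : Ω → ℝ, Integrable Q μ ∧
      ∫ ω, Q ω ∂μ ≤ devConst d (Fintype.card A) (Metric.diam Θ) κ v Λ r *
        bandwidth d β k ^ (4 * β) ∧
      ∀ ω a, ∀ z ∈ Θ, ((1 / (k * bandwidth d β k ^ d)) * W a z ω) ^ 4 ≤ Q ω := by
  set h := bandwidth d β k with hh
  have hh0 : 0 < h := bandwidth_pos hk
  have hh1 : h ≤ 1 := bandwidth_le_one hk hβ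
  have hk1 : (1 : ℝ) ≤ k := by exact_mod_cast hk
  have hk0 : (0 : ℝ) < k := by linarith
  have hl := half_le_log hk
  have hmul := mul_bandwidth_pow (d := d) hk hβ
  set l := Real.log (k + 1) with hldef
  have hl0 : 0 < l := by linarith
  rw [← hh] at hmul
  have hβ0 : 0 < h ^ β := Real.rpow_pos_of_pos hh0 β
  have hβ2 : h ^ (2 * β) = (h ^ β) ^ 2 := by
    rw [mul_comm, Real.rpow_mul hh0.le]; norm_num
  have hβ4 : h ^ (4 * β) = (h ^ β) ^ 4 := by
    rw [mul_comm, Real.rpow_mul hh0.le]; norm_num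
  have hβ1 : h ^ β ≤ 1 := Real.rpow_le_one hh0.le hh1 (by linarith)
  rw [hβ2] at hmul
  rw [hβ4]
  have hinv4 := inv_sq_le_bandwidth_rpow (d := d) hk hβ
  rw [← hh, hβ4] at hinv4
  have hinvd := inv_bandwidth_pow_succ_le (d := d) hk hβ
  rw [← hh] at hinvd
  set lam := h ^ β with hlam
  set N := (k : ℝ) * h ^ d with hN
  have hN0 : 0 < N := by positivity
  -- Multiplied by the normalization `1 / N`, this choice of `t` becomes `lam / κ ≤ 1 / κ`, at the edge of
  -- the admissible range of `hexp`.
  set t := l / (lam * κ) with ht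
  have ht0 : 0 < t := by positivity
  have hts : t * (1 / N) = lam / κ := by
    rw [ht, ← hmul]; field_simp
  obtain ⟨Q, hQi, hQ, hZQ⟩ := exists_uniform_majorant (μ := μ) hb hne hd
    (Z := fun a z ω => (1 / N) * W a z ω) (t := t) (b := v * l) (ε := 1 / (k : ℝ) ^ 2)
    (R := fun ω => (2 * Λ / k) ^ 4 * R ω)
    ht0 (by positivity) (by positivity) (fun a z hz s hs => by
      have hs1 : |s * (1 / N)| = lam / κ := by
        rw [abs_mul, abs_of_pos (by positivity : 0 < 1 / N), hs, hts]
      have hs2 : |s * (1 / N)| * κ ≤ 1 := by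
        rw [hs1]; field_simp; exact hβ1
      have h1 := hexp a z hz (s * (1 / N)) hs2
      simp only [mul_assoc] at h1 ⊢
      refine ⟨h1.1, h1.2.trans (Real.exp_le_exp.2 ?_)⟩
      have h2 : (s * (1 / N)) ^ 2 = lam ^ 2 / κ ^ 2 := by rw [← sq_abs, hs1, div_pow]
      rw [h2]
      calc k * (lam ^ 2 / κ ^ 2 * (v * h ^ d)) = v * (N * lam ^ 2) / κ ^ 2 := by rw [hN]; ring
        _ = v * l / κ ^ 2 := by rw [hmul]
        _ ≤ v * l := div_le_self (by positivity) (one_le_pow₀ hκ))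
    (hR.const_mul _) (fun a z z' ω hzz => by
      rw [← mul_sub]
      have h1 := hosc a z z' ω
      have h2 : |1 / N * (W a z ω - W a z' ω)| ≤ 2 * Λ / k * ρ ω := by
        rw [abs_mul, abs_of_pos (by positivity : 0 < 1 / N)]
        calc 1 / N * |W a z ω - W a z' ω|
            ≤ 1 / N * (k * (Λ * (h⁻¹ * (1 / (k : ℝ) ^ 2))) * ρ ω) := by
              have := hρ ω
              gcongr
              exact h1.trans (by gcongr)
          _ = (h ^ (d + 1))⁻¹ * (Λ * (1 / (k : ℝ) ^ 2) * ρ ω) := by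
              rw [hN]; field_simp; ring
          _ ≤ 2 * k * (Λ * (1 / (k : ℝ) ^ 2) * ρ ω) := by
              have := hρ ω
              gcongr
          _ = _ := by field_simp
      calc (1 / N * (W a z ω - W a z' ω)) ^ 4 = |1 / N * (W a z ω - W a z' ω)| ^ 4 := by
            rw [(by decide : Even 4).pow_abs]
        _ ≤ (2 * Λ / k * ρ ω) ^ 4 := by gcongr
        _ = (2 * Λ / k) ^ 4 * ρ ω ^ 4 := by ring
        _ ≤ _ := by gcongr; exact hρR ω)
  refine ⟨Q, hQi, hQ.trans ?_, hZQ⟩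
  rw [integral_const_mul]
  obtain ⟨hlog0, hlog⟩ := log_net_le (A := Fintype.card A) hd hk Fintype.card_pos
    (Metric.diam_nonneg (s := Θ))
  set a₀ := 4 * (Fintype.card A : ℝ) + (4 * Metric.diam Θ + 8) * (d : ℝ) ^ 2 + v with ha₀
  have hD0 := Metric.diam_nonneg (s := Θ)
  have ha0 : 0 ≤ a₀ := by positivity
  have hsum : Real.log (2 * ((Fintype.card A : ℝ) *
      (2 * Metric.diam Θ * d / (1 / (k : ℝ) ^ 2) + 3) ^ d)) + v * l ≤ a₀ * l := by
    rw [ha₀, add_mul]; linarith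
  have hr0 : 0 ≤ ∫ ω, R ω ∂μ :=
    integral_nonneg fun ω => le_trans (pow_nonneg (hρ ω) 4) (hρR ω)
  have p1 : (8 * (Real.log (2 * ((Fintype.card A : ℝ) *
      (2 * Metric.diam Θ * d / (1 / (k : ℝ) ^ 2) + 3) ^ d)) + v * l) ^ 4 + 192) / t ^ 4 ≤
      κ ^ 4 * (8 * a₀ ^ 4 + 3072) * lam ^ 4 := by
    rw [div_le_iff₀ (by positivity)]
    have ht4 : κ ^ 4 * (8 * a₀ ^ 4 + 3072) * lam ^ 4 * t ^ 4 = (8 * a₀ ^ 4 + 3072) * l ^ 4 := by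
      rw [ht]; field_simp
    rw [ht4]
    have q1 : (Real.log (2 * ((Fintype.card A : ℝ) *
      (2 * Metric.diam Θ * d / (1 / (k : ℝ) ^ 2) + 3) ^ d)) + v * l) ^ 4 ≤ (a₀ * l) ^ 4 := by
      gcongr
    have q2 : (1 / 2 : ℝ) ^ 4 ≤ l ^ 4 := by gcongr
    rw [mul_pow] at q1
    linarith
  have p2 : (2 * Λ / k) ^ 4 * ∫ ω, R ω ∂μ ≤ 64 * Λ ^ 4 * r * lam ^ 4 := by
    have q1 : (2 * Λ / k) ^ 4 ≤ 64 * Λ ^ 4 * lam ^ 4 := by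
      have q2 : 1 / (k : ℝ) ^ 4 ≤ 1 / (k : ℝ) ^ 2 := by
        gcongr 1 / ?_
        exact pow_le_pow_right₀ hk1 (by norm_num)
      calc (2 * Λ / k) ^ 4 = 16 * Λ ^ 4 * (1 / (k : ℝ) ^ 4) := by ring
        _ ≤ 16 * Λ ^ 4 * (4 * lam ^ 4) := by
            gcongr
            exact q2.trans hinv4
        _ = _ := by ring
    calc _ ≤ 64 * Λ ^ 4 * lam ^ 4 * r := by gcongr
      _ = _ := by ring
  unfold devConst
  rw [← ha₀]
  linarith

end UniformDeviations

section Processes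

/-! ### Uniform deviations of `B_k` and of the noise -/

variable {Ω : Type*} [MeasurableSpace Ω] {μ : Measure Ω}

section Design

variable {d n : ℕ} {Θ : Set (Vec d)} {pmin pmax : ℝ} {X : ℕ → Ω → Vec d}

lemma IsDesign.integral_eq (hX : IsDesign μ n Θ pmin pmax X) {i j : ℕ}
    (hi : i ∈ Finset.Icc 1 n) (hj : j ∈ Finset.Icc 1 n) {F : Vec d → ℝ} (hF : Measurable F) :
    ∫ ω, F (X i ω) ∂μ = ∫ ω, F (X j ω) ∂μ := by
  obtain ⟨p, -, -, hlaw, -⟩ := hX.density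
  rw [← integral_map (hX.measurable i hi).aemeasurable hF.aestronglyMeasurable,
    ← integral_map (hX.measurable j hj).aemeasurable hF.aestronglyMeasurable, hlaw i hi, hlaw j hj]

lemma IsDesign.integral_rescale_bounds [IsProbabilityMeasure μ]
    (hX : IsDesign μ n Θ pmin pmax X) {i : ℕ}
    (hi : i ∈ Finset.Icc 1 n) {F : Vec d → ℝ} (hF : Continuous F) (hF0 : ∀ u, 0 ≤ F u)
    (hF1 : ∀ u, 1 < ‖u‖ → F u = 0) {h : ℝ} (hh : 0 < h) (hh1 : h ≤ 1) {z : Vec d} (hz : z ∈ Θ) :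
    pmin * (h ^ d * ∫ u, F u) ≤ ∫ ω, F (h⁻¹ • (X i ω - z)) ∂μ ∧
      ∫ ω, F (h⁻¹ • (X i ω - z)) ∂μ ≤ pmax * (h ^ d * ∫ u, F u) := by
  obtain ⟨p, hp, hp0, hlaw, hpΘ⟩ := hX.density
  have hm := (hX.measurable i hi).aemeasurable (μ := μ)
  have e : ∫ ω, F (h⁻¹ • (X i ω - z)) ∂μ = ∫ x, F (h⁻¹ • (x - z)) ∂(μ.map (X i)) := by
    rw [integral_map hm]
    exact Continuous.aestronglyMeasurable (by fun_prop)
  have hpr : IsProbabilityMeasure (volume.withDensity fun x => ENNReal.ofReal (p x)) := by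
    rw [← hlaw i hi]
    exact Measure.isProbabilityMeasure_map hm
  rw [e, hlaw i hi]
  exact PassiveDesign.integral_rescale_bounds hp hp0 hpΘ hF hF0 hF1 hh hh1 hz

end Design

variable {d n : ℕ} {Θ : Set (Vec d)} {pmin pmax : ℝ} {X : ℕ → Ω → Vec d} {K : Vec d → ℝ}
  {LK : NNReal}

/-- The expectation of the matrix `B_k(z)` with bandwidth `h`. It does not depend on `k`, the design
being identically distributed, and is expressed through the first design point. -/
noncomputable def meanB (ℓ : ℕ) (K : Vec d → ℝ) (h : ℝ) (μ : Measure Ω) (X : ℕ → Ω → Vec d)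
    (z : Vec d) : Matrix (MultiIdx d ℓ) (MultiIdx d ℓ) ℝ :=
  fun m m' => (1 / h ^ d) * ∫ ω, kerMon ℓ K m m' (h⁻¹ • (X 1 ω - z)) ∂μ

lemma integrable_kerMon_comp [IsProbabilityMeasure μ] (hK : IsKernel K LK) (ℓ : ℕ)
    (m m' : MultiIdx d ℓ) (h : ℝ) {Y : Ω → Vec d} (hY : Measurable Y) (z : Vec d) :
    Integrable (fun ω => kerMon ℓ K m m' (h⁻¹ • (Y ω - z))) μ :=
  Integrable.of_bound (((continuous_kerMon hK ℓ m m').measurable.comp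
    (by fun_prop : Measurable fun ω => h⁻¹ • (Y ω - z))).aestronglyMeasurable) (⨆ u, K u)
    (Filter.Eventually.of_forall fun _ => (abs_kerMon_le hK ℓ m m' _).trans (hK.le_sup _))

lemma IsDesign.integral_kerMon_sq_le [IsProbabilityMeasure μ] (hX : IsDesign μ n Θ pmin pmax X)
    (hK : IsKernel K LK) (ℓ : ℕ) (m m' : MultiIdx d ℓ) {i : ℕ} (hi : i ∈ Finset.Icc 1 n)
    (hpmax : 0 ≤ pmax) {h : ℝ} (hh : 0 < h) (hh1 : h ≤ 1) {z : Vec d} (hz : z ∈ Θ) :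
    ∫ ω, kerMon ℓ K m m' (h⁻¹ • (X i ω - z)) ^ 2 ∂μ ≤ pmax * (⨆ u, K u) * h ^ d := by
  refine (hX.integral_rescale_bounds hi (F := fun u => kerMon ℓ K m m' u ^ 2)
    ((continuous_kerMon hK ℓ m m').pow 2) (fun u => sq_nonneg _)
    (fun u hu => by simp [kerMon_eq_zero hK ℓ m m' hu]) hh hh1 hz).2.trans ?_
  have := (PassiveDesign.integral_kerMon_sq_le hK ℓ m m').2
  calc _ ≤ pmax * (h ^ d * ⨆ u, K u) := by gcongr
    _ = _ := by ring

/-- The density bound `pmin` transfers the lower bound on the kernel matrix to the mean of `B_k`. -/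
lemma meanB_form_ge [IsProbabilityMeasure μ] (hX : IsDesign μ n Θ pmin pmax X) (hn : 1 ≤ n)
    (hK : IsKernel K LK) (ℓ : ℕ) (hpmin : 0 ≤ pmin) {h : ℝ} (hh : 0 < h) (hh1 : h ≤ 1)
    {z : Vec d} (hz : z ∈ Θ) (v : MultiIdx d ℓ → ℝ) :
    pmin * kernelMinEig ℓ K * (v ⬝ᵥ v) ≤ v ⬝ᵥ (meanB ℓ K h μ X z).mulVec v := by
  have h1 : 1 ∈ Finset.Icc 1 n := by simp [hn]
  have hi : ∀ m m', Integrable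
      (fun ω => v m * v m' * kerMon ℓ K m m' (h⁻¹ • (X 1 ω - z))) μ := fun m m' =>
    (integrable_kerMon_comp hK ℓ m m' h (hX.measurable 1 h1) z).const_mul _
  have e : v ⬝ᵥ (meanB ℓ K h μ X z).mulVec v = (1 / h ^ d) *
      ∫ ω, (∑ m, v m * U ℓ (h⁻¹ • (X 1 ω - z)) m) ^ 2 * K (h⁻¹ • (X 1 ω - z)) ∂μ := by
    simp only [sq_sum_mul_U_mul]
    rw [integral_finsetSum _ fun m _ => integrable_finsetSum _ fun m' _ => hi m m',
      dotProduct, Finset.mul_sum]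
    refine Finset.sum_congr rfl fun m _ => ?_
    rw [integral_finsetSum _ fun m' _ => hi m m', Matrix.mulVec, dotProduct, Finset.mul_sum,
      Finset.mul_sum]
    refine Finset.sum_congr rfl fun m' _ => ?_
    rw [integral_const_mul, meanB]
    ring
  rw [e]
  have h2 := (hX.integral_rescale_bounds h1
    (F := fun u => (∑ m, v m * U ℓ u m) ^ 2 * K u) (continuous_sq_sum_mul_U_mul hK ℓ v)
    (fun u => mul_nonneg (sq_nonneg _) (hK.nonneg u))
    (fun u hu => by simp [hK.eq_zero hu]) hh hh1 hz).1
  have h3 := kernelMinEig_mul_le hK ℓ v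
  calc pmin * kernelMinEig ℓ K * (v ⬝ᵥ v) = pmin * (kernelMinEig ℓ K * (v ⬝ᵥ v)) := by ring
    _ ≤ pmin * ∫ u, (∑ m, v m * U ℓ u m) ^ 2 * K u := by gcongr
    _ = (1 / h ^ d) * (pmin * (h ^ d * ∫ u, (∑ m, v m * U ℓ u m) ^ 2 * K u)) := by field_simp
    _ ≤ _ := by gcongr

lemma meanB_zero_le [IsProbabilityMeasure μ] (hX : IsDesign μ n Θ pmin pmax X) (hn : 1 ≤ n)
    (hK : IsKernel K LK) (ℓ : ℕ) {h : ℝ} (hh : 0 < h) (hh1 : h ≤ 1)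
    {z : Vec d} (hz : z ∈ Θ) :
    meanB ℓ K h μ X z (zeroIdx d ℓ) (zeroIdx d ℓ) ≤ pmax := by
  have h1 : 1 ∈ Finset.Icc 1 n := by simp [hn]
  have h2 := (hX.integral_rescale_bounds h1 hK.continuous hK.nonneg
    (fun u hu => hK.eq_zero hu) hh hh1 hz).2
  rw [hK.integral_eq_one, mul_one] at h2
  simp only [meanB, kerMon, U_zeroIdx, one_mul]
  calc _ ≤ (1 / h ^ d) * (pmax * h ^ d) := by gcongr
    _ = pmax := by field_simp

/-- Uniform deviations of `B_k` from its mean. -/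
lemma exists_majorant_matB [IsProbabilityMeasure μ] (hX : IsDesign μ n Θ pmin pmax X)
    (hK : IsKernel K LK) (ℓ : ℕ) (hb : Bornology.IsBounded Θ) (hne : Θ.Nonempty) (hd : 1 ≤ d)
    (hpmax : 0 ≤ pmax) {β : ℝ} (hβ : 2 ≤ β) {k : ℕ} (hk : 1 ≤ k) (hkn : k ≤ n) :
    ∃ Q : Ω → ℝ, Integrable Q μ ∧
      ∫ ω, Q ω ∂μ ≤ devConst d (Fintype.card (MultiIdx d ℓ × MultiIdx d ℓ)) (Metric.diam Θ)
        (1 + ⨆ u, K u) (pmax * ⨆ u, K u) (2 * (LK + 2 * (⨆ u, K u) * ℓ * d)) 1 *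
        bandwidth d β k ^ (4 * β) ∧
      ∀ ω m m', ∀ z ∈ Θ, (matB ℓ K (bandwidth d β k) k (fun i => X i ω) z m m' -
        meanB ℓ K (bandwidth d β k) μ X z m m') ^ 4 ≤ Q ω := by
  have : Nonempty (MultiIdx d ℓ) := ⟨zeroIdx d ℓ⟩
  have hh0 := bandwidth_pos (d := d) (β := β) hk
  have hh1 := bandwidth_le_one (d := d) hk hβ
  have hκ := hK.sup_nonneg
  set h := bandwidth d β k with hh
  set κ := ⨆ u, K u with hκdef
  have h1n : 1 ∈ Finset.Icc 1 n := by simp; omega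
  have hsub : Finset.Icc 1 k ⊆ Finset.Icc 1 n := Finset.Icc_subset_Icc_right hkn
  have hG : ∀ (a : MultiIdx d ℓ × MultiIdx d ℓ) (z : Vec d),
      Continuous fun x => kerMon ℓ K a.1 a.2 (h⁻¹ • (x - z)) := fun a z =>
    (continuous_kerMon hK ℓ a.1 a.2).comp (by fun_prop)
  have hlip : ∀ (a : MultiIdx d ℓ × MultiIdx d ℓ) (x z z' : Vec d),
      |kerMon ℓ K a.1 a.2 (h⁻¹ • (x - z)) - kerMon ℓ K a.1 a.2 (h⁻¹ • (x - z'))| ≤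
        (LK + 2 * κ * ℓ * d) * (h⁻¹ * ‖z - z'‖) := fun a x z z' => by
    refine (abs_kerMon_sub_le hK ℓ a.1 a.2 _ _).trans (le_of_eq ?_)
    rw [← smul_sub, sub_sub_sub_cancel_left, norm_smul, Real.norm_eq_abs,
      abs_of_pos (inv_pos.2 hh0), norm_sub_rev]
  obtain ⟨Q, hQi, hQ, hWQ⟩ := exists_majorant_rescaled_sum (μ := μ) hb hne hd hβ hk
    (W := fun (a : MultiIdx d ℓ × MultiIdx d ℓ) z ω => ∑ i ∈ Finset.Icc 1 k,
      (kerMon ℓ K a.1 a.2 (h⁻¹ • (X i ω - z)) -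
        ∫ ω, kerMon ℓ K a.1 a.2 (h⁻¹ • (X 1 ω - z)) ∂μ))
    (κ := 1 + κ) (v := pmax * κ) (Λ := 2 * (LK + 2 * κ * ℓ * d)) (r := 1)
    (ρ := fun _ => 1) (R := fun _ => 1)
    (by linarith) (by positivity) (by positivity)
    (fun a z hz s hs => by
      refine integral_exp_sum_le hkn (V := fun i ω => kerMon ℓ K a.1 a.2 (h⁻¹ • (X i ω - z)) -
        ∫ ω, kerMon ℓ K a.1 a.2 (h⁻¹ • (X 1 ω - z)) ∂μ) (fun i hi => ?_) ?_ (fun i hi => ?_)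
      · exact ((hG a z).measurable.comp (hX.measurable i hi)).sub_const _
      · exact hX.indep.comp (fun _ x => kerMon ℓ K a.1 a.2 (h⁻¹ • (x - z)) -
          ∫ ω, kerMon ℓ K a.1 a.2 (h⁻¹ • (X 1 ω - z)) ∂μ)
          fun _ => (hG a z).measurable.sub_const _
      · have hi' := hsub hi
        rw [hX.integral_eq h1n hi' (hG a z).measurable]
        have h1 := integral_exp_sub_mean_le (μ := μ)
          ((hG a z).measurable.comp (hX.measurable i hi')) (κ := κ) (s := s)
          (fun ω => (abs_kerMon_le hK ℓ a.1 a.2 _).trans (hK.le_sup _))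
          (by nlinarith [abs_nonneg s])
        refine ⟨h1.1, h1.2.trans (Real.exp_le_exp.2 ?_)⟩
        gcongr
        exact hX.integral_kerMon_sq_le hK ℓ a.1 a.2 hi' hpmax hh0 hh1 hz)
    (fun _ => zero_le_one) (fun _ => by norm_num) (integrable_const 1) (by simp)
    (fun a z z' ω => by
      rw [← Finset.sum_sub_distrib]
      refine (Finset.abs_sum_le_sum_abs _ _).trans ?_
      have hmean : |∫ ω, kerMon ℓ K a.1 a.2 (h⁻¹ • (X 1 ω - z)) ∂μ -
          ∫ ω, kerMon ℓ K a.1 a.2 (h⁻¹ • (X 1 ω - z')) ∂μ| ≤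
          (LK + 2 * κ * ℓ * d) * (h⁻¹ * ‖z - z'‖) := by
        rw [← integral_sub (integrable_kerMon_comp hK ℓ _ _ h (hX.measurable 1 h1n) z)
          (integrable_kerMon_comp hK ℓ _ _ h (hX.measurable 1 h1n) z')]
        have := norm_integral_le_of_norm_le_const (μ := μ)
          (f := fun ω => kerMon ℓ K a.1 a.2 (h⁻¹ • (X 1 ω - z)) -
            kerMon ℓ K a.1 a.2 (h⁻¹ • (X 1 ω - z')))
          (Filter.Eventually.of_forall fun ω => hlip a (X 1 ω) z z')
        simpa using this
      calc _ ≤ ∑ _i ∈ Finset.Icc 1 k, 2 * ((LK + 2 * κ * ℓ * d) * (h⁻¹ * ‖z - z'‖)) := by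
            refine Finset.sum_le_sum fun i _ => ?_
            have h1 := hlip a (X i ω) z z'
            rw [sub_sub_sub_comm]
            refine (abs_sub _ _).trans ?_
            linarith
        _ = _ := by
            rw [Finset.sum_const, Nat.card_Icc, nsmul_eq_mul]
            simp only [Nat.add_sub_cancel]
            ring)
  refine ⟨Q, hQi, hQ, fun ω m m' z hz => ?_⟩
  have h1 := hWQ ω (m, m') z hz
  rw [← hh] at h1
  convert h1 using 2
  rw [matB_apply, meanB, Finset.sum_sub_distrib, Finset.sum_const, Nat.card_Icc, nsmul_eq_mul,
    mul_sub]
  have hk0 : (k : ℝ) ≠ 0 := by positivity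
  simp only [Nat.add_sub_cancel]
  congr 1
  field_simp

/-- Uniform control of the noise part of `D_k`. -/
lemma exists_majorant_noiseVec [IsProbabilityMeasure μ] (hX : IsDesign μ n Θ pmin pmax X)
    {σ : ℝ} (hσ : 0 < σ) {ξ : ℕ → Ω → ℝ} (hξ : IsNoise μ n X σ ξ)
    (hK : IsKernel K LK) (ℓ : ℕ) (hb : Bornology.IsBounded Θ) (hne : Θ.Nonempty) (hd : 1 ≤ d)
    (hpmax : 0 ≤ pmax) {β : ℝ} (hβ : 2 ≤ β) {k : ℕ} (hk : 1 ≤ k) (hkn : k ≤ n) :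
    ∃ Q : Ω → ℝ, Integrable Q μ ∧
      ∫ ω, Q ω ∂μ ≤ devConst d (Fintype.card (MultiIdx d ℓ)) (Metric.diam Θ)
        (1 + 2 * σ * ⨆ u, K u) (16 * σ ^ 2 * (pmax * ⨆ u, K u))
        (LK + 2 * (⨆ u, K u) * ℓ * d) (48 * σ ^ 4) * bandwidth d β k ^ (4 * β) ∧
      ∀ ω m, ∀ z ∈ Θ, noiseVec ℓ K (bandwidth d β k) k (fun i => X i ω) (fun i => ξ i ω) z m ^ 4
        ≤ Q ω := by
  have : Nonempty (MultiIdx d ℓ) := ⟨zeroIdx d ℓ⟩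
  have hh0 := bandwidth_pos (d := d) (β := β) hk
  have hh1 := bandwidth_le_one (d := d) hk hβ
  have hκ := hK.sup_nonneg
  set h := bandwidth d β k with hh
  set κ := ⨆ u, K u with hκdef
  have hk0 : (0 : ℝ) < k := by exact_mod_cast hk
  have hsub : Finset.Icc 1 k ⊆ Finset.Icc 1 n := Finset.Icc_subset_Icc_right hkn
  have hG : ∀ (a : MultiIdx d ℓ) (z : Vec d),
      Continuous fun x => kerMon ℓ K a (zeroIdx d ℓ) (h⁻¹ • (x - z)) := fun a z =>
    (continuous_kerMon hK ℓ a _).comp (by fun_prop)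
  have hpair := iIndepFun_pair (μ := μ) (ζ := fun i : Finset.Icc 1 n => ξ i)
    (Y := fun i : Finset.Icc 1 n => X i) (fun i => hξ.measurable i i.2)
    (fun i => hX.measurable i i.2) hξ.indep hX.indep hξ.indep_design
  have hind : ∀ i ∈ Finset.Icc 1 n, IndepFun (ξ i) (X i) μ := fun i hi =>
    hξ.indep_design.comp (measurable_pi_apply (⟨i, hi⟩ : Finset.Icc 1 n))
      (measurable_pi_apply (⟨i, hi⟩ : Finset.Icc 1 n))
  refine exists_majorant_rescaled_sum (μ := μ) hb hne hd hβ hk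
    (W := fun (a : MultiIdx d ℓ) z ω => ∑ i ∈ Finset.Icc 1 k,
      ξ i ω * kerMon ℓ K a (zeroIdx d ℓ) (h⁻¹ • (X i ω - z)))
    (κ := 1 + 2 * σ * κ) (v := 16 * σ ^ 2 * (pmax * κ)) (Λ := LK + 2 * κ * ℓ * d)
    (r := 48 * σ ^ 4)
    (ρ := fun ω => (∑ i ∈ Finset.Icc 1 k, |ξ i ω|) / k)
    (R := fun ω => (24 * σ ^ 4 / k) * ∑ i ∈ Finset.Icc 1 k, Real.exp (|ξ i ω| / σ))
    (by have : 0 ≤ 2 * σ * κ := by positivity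
        linarith) (by positivity) (by positivity)
    (fun a z hz s hs => ?_)
    (fun ω => div_nonneg (Finset.sum_nonneg fun i _ => abs_nonneg _) hk0.le) (fun ω => ?_) ?_ ?_
    (fun a z z' ω => ?_)
  · refine integral_exp_sum_le hkn
      (V := fun i ω => ξ i ω * kerMon ℓ K a (zeroIdx d ℓ) (h⁻¹ • (X i ω - z)))
      (fun i hi => ?_) ?_ (fun i hi => ?_)
    · exact (hξ.measurable i hi).mul ((hG a z).measurable.comp (hX.measurable i hi))
    · exact hpair.comp (fun _ x => x.1 * kerMon ℓ K a (zeroIdx d ℓ) (h⁻¹ • (x.2 - z)))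
        fun _ => measurable_fst.mul ((hG a z).measurable.comp measurable_snd)
    · have hi' := hsub hi
      have h1 := integral_exp_mul_noise_le (μ := μ)
        ((hG a z).measurable.comp (hX.measurable i hi')) (hξ.measurable i hi')
        ((hind i hi').comp measurable_id (hG a z).measurable) (κ := κ) (s := s) hσ
        (fun ω => (abs_kerMon_le hK ℓ a _ _).trans (hK.le_sup _))
        (by
          rw [le_div_iff₀ (by positivity)]
          nlinarith [abs_nonneg s])
        (hξ.centered i hi') (hξ.subexp i hi').1 (hξ.subexp i hi').2
      refine ⟨h1.1, h1.2.trans (Real.exp_le_exp.2 ?_)⟩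
      have h2 := hX.integral_kerMon_sq_le hK ℓ a (zeroIdx d ℓ) hi' hpmax hh0 hh1 hz
      calc _ ≤ 16 * σ ^ 2 * s ^ 2 * (pmax * κ * h ^ d) := by
            gcongr
            exact h2
        _ = _ := by ring
  · have h2 := pow_sum_div_card_le_sum_pow (s := Finset.Icc 1 k) (f := fun i => |ξ i ω|)
      (fun i _ => abs_nonneg _) 3
    rw [Nat.card_Icc, Nat.add_sub_cancel, div_le_iff₀ (by positivity)] at h2
    norm_num at h2
    have h3 : ∑ i ∈ Finset.Icc 1 k, |ξ i ω| ^ 4 ≤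
        24 * σ ^ 4 * ∑ i ∈ Finset.Icc 1 k, Real.exp (|ξ i ω| / σ) := by
      rw [Finset.mul_sum]
      exact Finset.sum_le_sum fun i _ => pow_four_le_mul_exp hσ _
    rw [div_pow, div_le_iff₀ (by positivity)]
    calc _ ≤ (24 * σ ^ 4 * ∑ i ∈ Finset.Icc 1 k, Real.exp (|ξ i ω| / σ)) * (k : ℝ) ^ 3 := by
          have := mul_le_mul_of_nonneg_right h3 (by positivity : (0 : ℝ) ≤ (k : ℝ) ^ 3)
          linarith
      _ = _ := by field_simp
  · refine (integrable_finsetSum _ fun i hi => ?_).const_mul _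
    exact (hξ.subexp i (hsub hi)).1
  · rw [integral_const_mul, integral_finsetSum _ fun i hi => (hξ.subexp i (hsub hi)).1]
    have h1 : ∑ i ∈ Finset.Icc 1 k, ∫ ω, Real.exp (|ξ i ω| / σ) ∂μ ≤ k * 2 := by
      calc _ ≤ ∑ _i ∈ Finset.Icc 1 k, (2 : ℝ) :=
            Finset.sum_le_sum fun i hi => (hξ.subexp i (hsub hi)).2
        _ = _ := by simp
    calc _ ≤ 24 * σ ^ 4 / k * (k * 2) := by gcongr
      _ = _ := by field_simp; norm_num
  · rw [← Finset.sum_sub_distrib]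
    refine (Finset.abs_sum_le_sum_abs _ _).trans ?_
    have e : k * ((LK + 2 * κ * ℓ * d) * (h⁻¹ * ‖z - z'‖)) *
        ((∑ i ∈ Finset.Icc 1 k, |ξ i ω|) / k) =
        ∑ i ∈ Finset.Icc 1 k, |ξ i ω| * ((LK + 2 * κ * ℓ * d) * (h⁻¹ * ‖z - z'‖)) := by
      rw [← Finset.sum_mul]; field_simp
    rw [e]
    refine Finset.sum_le_sum fun i _ => ?_
    rw [← mul_sub, abs_mul]
    gcongr
    refine (abs_kerMon_sub_le hK ℓ a _ _ _).trans (le_of_eq ?_)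
    rw [← smul_sub, sub_sub_sub_cancel_left, norm_smul, Real.norm_eq_abs,
      abs_of_pos (inv_pos.2 hh0), norm_sub_rev]

end Processes

section Iterates

/-! ### The projection -/

section Projection

variable {d : ℕ} {Θ : Set (Vec d)}

lemma proj_spec (hc : IsCompact Θ) (hne : Θ.Nonempty) (x : Vec d) :
    proj Θ x ∈ Θ ∧ ∀ q ∈ Θ, ‖x - proj Θ x‖ ≤ ‖x - q‖ := by
  have h : ∃ p ∈ Θ, ∀ q ∈ Θ, ‖x - p‖ ≤ ‖x - q‖ := by
    obtain ⟨p, hp, hmin⟩ := hc.exists_isMinOn hne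
      (f := fun q => ‖x - q‖) (by fun_prop)
    exact ⟨p, hp, fun q hq => hmin hq⟩
  rw [proj, dif_pos h]
  exact h.choose_spec

lemma inner_sub_proj_le (hc : IsCompact Θ) (hconv : Convex ℝ Θ) (hne : Θ.Nonempty) (x : Vec d)
    {q : Vec d} (hq : q ∈ Θ) : inner ℝ (x - proj Θ x) (q - proj Θ x) ≤ 0 := by
  obtain ⟨hp, hmin⟩ := proj_spec hc hne x
  refine (norm_eq_iInf_iff_real_inner_le_zero hconv hp).1 ?_ q hq
  have : Nonempty Θ := hne.to_subtype
  refine le_antisymm (le_ciInf fun w => hmin w w.2) ?_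
  exact ciInf_le (f := fun w : Θ => ‖x - w‖) ⟨0, by rintro _ ⟨w, rfl⟩; exact norm_nonneg _⟩
    ⟨proj Θ x, hp⟩

lemma norm_proj_sub_proj_le (hc : IsCompact Θ) (hconv : Convex ℝ Θ) (hne : Θ.Nonempty)
    (x y : Vec d) : ‖proj Θ x - proj Θ y‖ ≤ ‖x - y‖ := by
  have h1 := inner_sub_proj_le hc hconv hne x (proj_spec hc hne y).1
  have h2 := inner_sub_proj_le hc hconv hne y (proj_spec hc hne x).1
  set p := proj Θ x
  set q := proj Θ y
  have h3 : ‖p - q‖ ^ 2 ≤ inner ℝ (x - y) (p - q) := by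
    rw [← real_inner_self_eq_norm_sq]
    have e : inner ℝ (x - y) (p - q) - inner ℝ (p - q) (p - q)
        = -inner ℝ (x - p) (q - p) - inner ℝ (y - q) (p - q) := by
      simp only [inner_sub_left, inner_sub_right]
      ring
    linarith
  have h4 := real_inner_le_norm (x - y) (p - q)
  rcases (norm_nonneg (p - q)).eq_or_lt with h0 | h0
  · rw [← h0]; exact norm_nonneg _
  · have h5 : ‖p - q‖ * ‖p - q‖ ≤ ‖x - y‖ * ‖p - q‖ := by rw [← sq]; linarith
    exact le_of_mul_le_mul_right h5 h0

lemma continuous_proj (hc : IsCompact Θ) (hconv : Convex ℝ Θ) (hne : Θ.Nonempty) :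
    Continuous (proj Θ) :=
  (LipschitzWith.of_dist_le_mul (K := 1) fun x y => by
    simpa [dist_eq_norm] using norm_proj_sub_proj_le hc hconv hne x y).continuous

lemma proj_of_mem (hc : IsCompact Θ) {x : Vec d} (hx : x ∈ Θ) : proj Θ x = x := by
  have := (proj_spec hc ⟨x, hx⟩ x).2 x hx
  rw [sub_self, norm_zero, norm_le_zero_iff, sub_eq_zero] at this
  exact this.symm

lemma norm_proj_sub_le (hc : IsCompact Θ) (hconv : Convex ℝ Θ) (x : Vec d) {q : Vec d}
    (hq : q ∈ Θ) : ‖proj Θ x - q‖ ≤ ‖x - q‖ := by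
  have := norm_proj_sub_proj_le hc hconv ⟨q, hq⟩ x q
  rwa [proj_of_mem hc hq] at this

end Projection

/-! ### Measurability of the iterates -/

variable {Ω : Type*} [MeasurableSpace Ω] {μ : Measure Ω}

section Measurability

variable {ι : Type*} [Fintype ι] [DecidableEq ι]

lemma measurable_det {M : Ω → Matrix ι ι ℝ} (hM : ∀ i j, Measurable fun ω => M ω i j) :
    Measurable fun ω => (M ω).det := by
  simp only [Matrix.det_apply]
  exact Finset.measurable_fun_sum _ fun s _ =>
    (Finset.measurable_fun_prod _ fun i _ => hM _ _).const_smul _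

lemma measurable_inv_apply {M : Ω → Matrix ι ι ℝ} (hM : ∀ i j, Measurable fun ω => M ω i j)
    (i j : ι) : Measurable fun ω => (M ω)⁻¹ i j := by
  simp only [Matrix.inv_def, Matrix.smul_apply, smul_eq_mul, Ring.inverse_eq_inv',
    Matrix.adjugate_apply]
  refine (measurable_det hM).inv.mul (measurable_det fun a b => ?_)
  simp only [Matrix.updateRow_apply]
  split_ifs
  · exact measurable_const
  · exact hM a b

end Measurability

variable {d : ℕ} {K : Vec d → ℝ} {LK : NNReal}

lemma measurable_gradEst (hK : IsKernel K LK) (ℓ : ℕ) (h lam : ℝ) (k : ℕ) {x : Ω → ℕ → Vec d}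
    {y : Ω → ℕ → ℝ} {z : Ω → Vec d} (hx : ∀ i ∈ Finset.Icc 1 k, Measurable fun ω => x ω i)
    (hy : ∀ i ∈ Finset.Icc 1 k, Measurable fun ω => y ω i) (hz : Measurable z) :
    Measurable fun ω => gradEst ℓ K h lam k (x ω) (y ω) (z ω) := by
  have hu : ∀ i ∈ Finset.Icc 1 k, Measurable fun ω => h⁻¹ • (x ω i - z ω) := fun i hi => by
    have := hx i hi
    fun_prop
  have hB : ∀ m m', Measurable fun ω => matB ℓ K h k (x ω) (z ω) m m' := fun m m' => by
    simp only [matB_apply]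
    exact (Finset.measurable_fun_sum _ fun i hi =>
      (continuous_kerMon hK ℓ m m').measurable.comp (hu i hi)).const_mul _
  have hD : ∀ m, Measurable fun ω => vecD ℓ K h k (x ω) (y ω) (z ω) m := fun m => by
    simp only [vecD, Pi.smul_apply, smul_eq_mul, Finset.sum_apply]
    exact (Finset.measurable_fun_sum _ fun i hi =>
      ((hy i hi).mul (hK.continuous.measurable.comp (hu i hi))).mul
        ((continuous_U ℓ m).measurable.comp (hu i hi))).const_mul _
  have hinv : ∀ m m', Measurable fun ω => (matB ℓ K h k (x ω) (z ω) +
      lam • (1 : Matrix (MultiIdx d ℓ) (MultiIdx d ℓ) ℝ))⁻¹ m m' := fun m m' => by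
    refine measurable_inv_apply (fun a b => ?_) m m'
    simp only [Matrix.add_apply]
    exact (hB a b).add_const _
  unfold gradEst
  refine (measurable_const_smul h⁻¹).comp
    ((WithLp.measurable_toLp 2 _).comp (measurable_pi_lambda _ fun i => ?_))
  simp only [Matrix.mulVec, dotProduct]
  exact Finset.measurable_fun_sum _ fun m _ => (Finset.measurable_fun_sum _ fun m' _ =>
    (hinv m m').mul (hD m')).const_mul _

lemma HolderClass.continuous {β L : ℝ} {f : Vec d → ℝ} (hf : HolderClass β L f) (hβ : 2 ≤ β) :
    Continuous f := by
  have h := (hf.differentiable 0 (one_le_order hβ)).continuous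
  rw [iteratedFDeriv_zero_eq_comp] at h
  exact (LinearIsometryEquiv.comp_continuous_iff _).1 h

lemma iterate_mem {Θ : Set (Vec d)} (hc : IsCompact Θ) {z₁ : Vec d} (hz₁ : z₁ ∈ Θ) (β α : ℝ)
    (x : ℕ → Vec d) (y : ℕ → ℝ) : ∀ k, iterate Θ β α K z₁ x y k ∈ Θ
  | 0 => hz₁
  | 1 => hz₁
  | _ + 2 => (proj_spec hc ⟨z₁, hz₁⟩ _).1

lemma measurable_iterate (hK : IsKernel K LK) {Θ : Set (Vec d)} (hc : IsCompact Θ)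
    (hconv : Convex ℝ Θ) {z₁ : Vec d} (hz₁ : z₁ ∈ Θ) (β α : ℝ) {x : Ω → ℕ → Vec d}
    {y : Ω → ℕ → ℝ} {n : ℕ} (hx : ∀ i ∈ Finset.Icc 1 n, Measurable fun ω => x ω i)
    (hy : ∀ i ∈ Finset.Icc 1 n, Measurable fun ω => y ω i) :
    ∀ k ≤ n, Measurable fun ω => iterate Θ β α K z₁ (x ω) (y ω) k
  | 0, _ => measurable_const
  | 1, _ => measurable_const
  | k + 2, hk => by
    have ih := measurable_iterate hK hc hconv hz₁ β α hx hy (k + 1) (by omega)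
    have hsub : Finset.Icc 1 (k + 1) ⊆ Finset.Icc 1 n := Finset.Icc_subset_Icc_right (by omega)
    simp only [iterate]
    have hg := measurable_gradEst hK (order β) (bandwidth d β (k + 1)) (regParam d β (k + 1)) (k + 1)
      (fun i hi => hx i (hsub hi)) (fun i hi => hy i (hsub hi)) ih
    exact (continuous_proj hc hconv ⟨z₁, hz₁⟩).measurable.comp (by fun_prop)

/-! ### The uniform mean squared error of the gradient estimator -/

lemma exists_fourth_root {q : ℝ} (hq : 0 ≤ q) : ∃ T, 0 ≤ T ∧ T ^ 4 = q := by
  refine ⟨√√q, Real.sqrt_nonneg _, ?_⟩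
  rw [show (4 : ℕ) = 2 * 2 by norm_num, pow_mul, Real.sq_sqrt (Real.sqrt_nonneg q),
    Real.sq_sqrt hq]

lemma add_add_pow_four_le (a b : ℝ) (ha : 0 ≤ a) (hb : 0 ≤ b) :
    (1 + a + b) ^ 4 ≤ 27 * (1 + a ^ 4 + b ^ 4) := by
  have h := pow_sum_div_card_le_sum_pow (s := Finset.univ) (f := ![1, a, b])
    (fun i _ => by fin_cases i <;> simp [ha, hb]) 3
  simp only [Fin.sum_univ_three, Matrix.cons_val, Finset.card_univ, Fintype.card_fin] at h
  norm_num at h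
  linarith

/-- The uniform mean squared error of the gradient estimator is of order `h_k^{2(β - 1)}`. -/
lemma exists_majorant_gradEst [IsProbabilityMeasure μ] {n : ℕ} {Θ : Set (Vec d)}
    {pmin pmax : ℝ} {X : ℕ → Ω → Vec d}
    (hX : IsDesign μ n Θ pmin pmax X) {σ : ℝ} (hσ : 0 < σ) {ξ : ℕ → Ω → ℝ}
    (hξ : IsNoise μ n X σ ξ) (hK : IsKernel K LK) (hc : IsCompact Θ)
    (hd : 1 ≤ d) (hpmin : 0 < pmin) {β L α M : ℝ} (hβ : 2 ≤ β) (hL : 0 < L) {f : Vec d → ℝ}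
    {xstar : Vec d} (hf : RegressionClass Θ β L α M f xstar) {k : ℕ} (hk : 1 ≤ k) (hkn : k ≤ n) :
    ∃ Q : Ω → ℝ, Integrable Q μ ∧
      ∫ ω, Q ω ∂μ ≤ 27 * (pmin * kernelMinEig (order β) K)⁻¹ ^ 2 *
        (Fintype.card (MultiIdx d (order β)) : ℝ) ^ 4 *
        (√((M + L) ^ 2 / kernelMinEig (order β) K) + L * (pmax + 1) + 1) ^ 2 *
        (1 + devConst d (Fintype.card (MultiIdx d (order β) × MultiIdx d (order β)))
            (Metric.diam Θ) (1 + ⨆ u, K u) (pmax * ⨆ u, K u)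
            (2 * (LK + 2 * (⨆ u, K u) * order β * d)) 1
          + devConst d (Fintype.card (MultiIdx d (order β))) (Metric.diam Θ)
            (1 + 2 * σ * ⨆ u, K u) (16 * σ ^ 2 * (pmax * ⨆ u, K u))
            (LK + 2 * (⨆ u, K u) * order β * d) (48 * σ ^ 4)) *
        bandwidth d β k ^ (2 * (β - 1)) ∧
      ∀ ω, ∀ z ∈ Θ, ‖gradEst (order β) K (bandwidth d β k) (regParam d β k) k (fun i => X i ω)
        (fun i => f (X i ω) + ξ i ω) z - gradient f z‖ ^ 2 ≤ Q ω := by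
  have hne : Θ.Nonempty := ⟨xstar, hf.mem⟩
  have hn : 1 ≤ n := hk.trans hkn
  have hpmax : 0 ≤ pmax := by
    obtain ⟨p, -, -, -, hp⟩ := hX.density
    have := hp xstar ⟨xstar, hf.mem, 0, by simp, by simp⟩
    linarith
  have heig := kernelMinEig_pos hK (order β)
  have hh0 := bandwidth_pos (d := d) (β := β) hk
  have hh1 := bandwidth_le_one (d := d) hk hβ
  obtain ⟨Q₁, hQ₁i, hQ₁, hB⟩ := exists_majorant_matB (μ := μ) hX hK (order β) hc.isBounded hne hd
    hpmax hβ hk hkn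
  obtain ⟨Q₂, hQ₂i, hQ₂, hN⟩ := exists_majorant_noiseVec (μ := μ) hX hσ hξ hK (order β)
    hc.isBounded hne hd hpmax hβ hk hkn
  rw [regParam_eq hk]
  set dev₁ := devConst d (Fintype.card (MultiIdx d (order β) × MultiIdx d (order β)))
    (Metric.diam Θ) (1 + ⨆ u, K u) (pmax * ⨆ u, K u) (2 * (LK + 2 * (⨆ u, K u) * order β * d)) 1
  set dev₂ := devConst d (Fintype.card (MultiIdx d (order β))) (Metric.diam Θ)
    (1 + 2 * σ * ⨆ u, K u) (16 * σ ^ 2 * (pmax * ⨆ u, K u))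
    (LK + 2 * (⨆ u, K u) * order β * d) (48 * σ ^ 4)
  set h := bandwidth d β k with hh
  set eig := kernelMinEig (order β) K with heigdef
  set tbar := √((M + L) ^ 2 / eig) with htbar
  set S : ℝ := ((Fintype.card (MultiIdx d (order β)) : ℕ) : ℝ) with hS
  have hS1 : 1 ≤ S := by
    have : Nonempty (MultiIdx d (order β)) := ⟨zeroIdx d _⟩
    have : 1 ≤ Fintype.card (MultiIdx d (order β)) := Fintype.card_pos
    rw [hS]
    exact_mod_cast this
  have ht0 : 0 ≤ tbar := Real.sqrt_nonneg _
  set c₁ := tbar + L * (pmax + 1) + 1 with hc₁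
  have hc₁0 : 0 ≤ c₁ := by positivity
  have hlam0 : 0 < h ^ β := Real.rpow_pos_of_pos hh0 β
  have hlam1 : h ^ β ≤ 1 := Real.rpow_le_one hh0.le hh1 (by linarith)
  have hβ4 : h ^ (4 * β) = (h ^ β) ^ 4 := by
    rw [mul_comm, Real.rpow_mul hh0.le]; norm_num
  have hβ2 : h ^ (2 * (β - 1)) = (h⁻¹ * h ^ β) ^ 2 := by
    rw [mul_comm, Real.rpow_mul hh0.le, Real.rpow_sub hh0, Real.rpow_one, ← div_eq_inv_mul]
    norm_num
  rw [hβ4] at hQ₁ hQ₂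
  rw [hβ2]
  set lam := h ^ β with hlam
  set c₂ := 27 * (pmin * eig)⁻¹ ^ 2 * S ^ 4 * c₁ ^ 2 with hc₂
  have hc₂0 : 0 ≤ c₂ := by positivity
  have hsumi : Integrable (fun ω => 1 + (Q₁ ω + Q₂ ω) / lam ^ 4) μ :=
    (integrable_const 1).add ((hQ₁i.add hQ₂i).div_const _)
  refine ⟨fun ω => c₂ * (h⁻¹ * lam) ^ 2 * (1 + (Q₁ ω + Q₂ ω) / lam ^ 4), hsumi.const_mul _, ?_, ?_⟩
  · have h1 : ∫ ω, (1 + (Q₁ ω + Q₂ ω) / lam ^ 4) ∂μ ≤ 1 + dev₁ + dev₂ := by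
      have hi : Integrable (fun ω => (Q₁ ω + Q₂ ω) / lam ^ 4) μ := (hQ₁i.add hQ₂i).div_const _
      rw [integral_add (integrable_const 1) hi, integral_div, integral_add hQ₁i hQ₂i]
      simp only [integral_const, probReal_univ, one_smul]
      have : (∫ ω, Q₁ ω ∂μ + ∫ ω, Q₂ ω ∂μ) / lam ^ 4 ≤ dev₁ + dev₂ := by
        rw [div_le_iff₀ (by positivity)]; linarith
      linarith
    rw [integral_const_mul]
    calc _ ≤ c₂ * (h⁻¹ * lam) ^ 2 * (1 + dev₁ + dev₂) := by gcongr
      _ = _ := by ring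
  · intro ω z hz
    have hq1 : 0 ≤ Q₁ ω :=
      le_trans (by positivity) (hB ω (zeroIdx d _) (zeroIdx d _) z hz)
    have hq2 : 0 ≤ Q₂ ω := le_trans (by positivity) (hN ω (zeroIdx d _) z hz)
    obtain ⟨T₁, hT₁0, hT₁⟩ := exists_fourth_root hq1
    obtain ⟨T₂, hT₂0, hT₂⟩ := exists_fourth_root hq2
    have habs : ∀ {y T : ℝ}, 0 ≤ T → y ^ 4 ≤ T ^ 4 → |y| ≤ T := fun {y T} hT hy => by
      rw [← (by decide : Even 4).pow_abs y] at hy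
      exact le_of_pow_le_pow_left₀ (by norm_num) hT hy
    have hmain := norm_gradEst_sub_gradient_le hK hf.holder hL hβ hh0 k (fun i => X i ω)
      (fun i => ξ i ω) z (Bbar := meanB (order β) K h μ X z) (μ₀ := pmin * eig) (pmax := pmax)
      (T₁ := T₁) (T₂ := T₂) (tbar := tbar) (by positivity)
      (meanB_form_ge hX hn hK _ hpmin.le hh0 hh1 hz) (meanB_zero_le hX hn hK _ hh0 hh1 hz)
      hpmax hT₁0 (fun m m' => habs hT₁0 (by rw [hT₁]; exact hB ω m m' z hz)) hT₂0
      (fun m => habs hT₂0 (by rw [hT₂]; exact hN ω m z hz))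
      (by
        rw [htbar]
        refine Real.le_sqrt_of_sq_le ?_
        rw [le_div_iff₀ heig, mul_comm]
        exact hf.kernelMinEig_mul_taylorCoeff_le hK hL hβ hz hh0.le hh1)
    -- In units of `lam`, both deviations have fourth moments that do not depend on `k`.
    obtain ⟨τ₁, hτ₁⟩ : ∃ τ, T₁ = lam * τ := ⟨T₁ / lam, by field_simp⟩
    obtain ⟨τ₂, hτ₂⟩ : ∃ τ, T₂ = lam * τ := ⟨T₂ / lam, by field_simp⟩
    have hτ₁0 : 0 ≤ τ₁ := by
      rw [hτ₁] at hT₁0; exact nonneg_of_mul_nonneg_right hT₁0 hlam0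
    have hτ₂0 : 0 ≤ τ₂ := by
      rw [hτ₂] at hT₂0; exact nonneg_of_mul_nonneg_right hT₂0 hlam0
    rw [← hlam, ← hS] at hmain
    have hfac₁ : 1 + S * T₁ / lam ≤ S * (1 + τ₁ + τ₂) := by
      have : S * T₁ / lam = S * τ₁ := by rw [hτ₁]; field_simp
      rw [this]
      nlinarith [mul_nonneg (zero_le_one.trans hS1) hτ₂0]
    have hfac₂ : lam * tbar + S * (L * lam * (pmax + T₁)) + S * T₂ ≤
        lam * (S * (c₁ * (1 + τ₁ + τ₂))) := by
      have h1 : pmax + T₁ ≤ pmax + τ₁ := by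
        rw [hτ₁]; linarith [mul_le_of_le_one_left hτ₁0 hlam1]
      have h2 : tbar + S * (L * (pmax + τ₁)) + S * τ₂ ≤ S * (c₁ * (1 + τ₁ + τ₂)) := by
        have e : S * (c₁ * (1 + τ₁ + τ₂)) = S * tbar + S * (L * (pmax + τ₁)) + S * τ₂
            + S * (tbar * (τ₁ + τ₂) + L * pmax * (τ₁ + τ₂) + L * (1 + τ₂) + 1 + τ₁) := by
          rw [hc₁]; ring
        have : tbar ≤ S * tbar := le_mul_of_one_le_left ht0 hS1
        have : 0 ≤ S * (tbar * (τ₁ + τ₂) + L * pmax * (τ₁ + τ₂) + L * (1 + τ₂) + 1 + τ₁) := by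
          positivity
        linarith
      calc _ ≤ lam * tbar + S * (L * lam * (pmax + τ₁)) + S * (lam * τ₂) := by
            rw [hτ₂]; gcongr
        _ = lam * (tbar + S * (L * (pmax + τ₁)) + S * τ₂) := by ring
        _ ≤ _ := by gcongr
    have hfac₃ := hmain.trans (b := _) (c := h⁻¹ * (pmin * eig)⁻¹ * (S * (1 + τ₁ + τ₂)) *
      (lam * (S * (c₁ * (1 + τ₁ + τ₂))))) (by gcongr)
    have hτ4 : 1 + (Q₁ ω + Q₂ ω) / lam ^ 4 = 1 + τ₁ ^ 4 + τ₂ ^ 4 := by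
      rw [← hT₁, ← hT₂, hτ₁, hτ₂]; field_simp; ring
    beta_reduce
    rw [hτ4]
    calc _ ≤ (h⁻¹ * (pmin * eig)⁻¹ * (S * (1 + τ₁ + τ₂)) *
          (lam * (S * (c₁ * (1 + τ₁ + τ₂))))) ^ 2 := by gcongr
      _ = (pmin * eig)⁻¹ ^ 2 * S ^ 4 * c₁ ^ 2 * (h⁻¹ * lam) ^ 2 * (1 + τ₁ + τ₂) ^ 4 := by ring
      _ ≤ (pmin * eig)⁻¹ ^ 2 * S ^ 4 * c₁ ^ 2 * (h⁻¹ * lam) ^ 2 *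
          (27 * (1 + τ₁ ^ 4 + τ₂ ^ 4)) := by
          gcongr
          exact add_add_pow_four_le τ₁ τ₂ hτ₁0 hτ₂0
      _ = _ := by rw [hc₂]; ring

end Iterates

section Risk

/-! ### The recursion for the risk -/

/-- One step of projected gradient descent with step `2 / (α k)` and an inexact gradient `g`. -/
lemma RegressionClass.norm_step_sub_sq_le {d : ℕ} {Θ : Set (Vec d)} (hc : IsCompact Θ)
    (hconv : Convex ℝ Θ) {β L α M : ℝ} (hα : 0 < α) {f : Vec d → ℝ} {xstar : Vec d}
    (hf : RegressionClass Θ β L α M f xstar) (hgrad : gradient f xstar = 0) {k : ℝ} (hk : 1 ≤ k)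
    {z : Vec d} (hz : z ∈ Θ) (g : Vec d) :
    ‖proj Θ (z - (2 / (α * k)) • g) - xstar‖ ^ 2 ≤ (1 - 2 / k) * ‖z - xstar‖ ^ 2 +
      (10 * ‖g - gradient f z‖ ^ 2 + 8 * ‖gradient f z‖ ^ 2 / k) / (α ^ 2 * k) := by
  have hk0 : 0 < k := by linarith
  have hproj := norm_proj_sub_le hc hconv (z - (2 / (α * k)) • g) hf.mem
  set η := 2 / (α * k) with hη
  have hη0 : 0 < η := by positivity
  set e := g - gradient f z with he
  set r := ‖z - xstar‖ with hr
  have h1 : ‖z - η • g - xstar‖ ^ 2 = r ^ 2 - 2 * η * inner ℝ g (z - xstar) + η ^ 2 * ‖g‖ ^ 2 := by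
    rw [show z - η • g - xstar = (z - xstar) - η • g by abel, norm_sub_sq_real, inner_smul_right,
      norm_smul, Real.norm_eq_abs, abs_of_pos hη0, real_inner_comm]
    ring
  have h2 : inner ℝ g (z - xstar) = inner ℝ (gradient f z) (z - xstar) + inner ℝ e (z - xstar) := by
    rw [← inner_add_left, he, add_sub_cancel]
  -- Strong convexity is used at `z` and at the minimizer, where the gradient vanishes.
  have h3 : α * r ^ 2 ≤ inner ℝ (gradient f z) (z - xstar) := by
    have a1 := hf.strongConvex z hz xstar hf.mem
    have a2 := hf.strongConvex xstar hf.mem z hz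
    rw [hgrad, inner_zero_left, norm_sub_rev] at a2
    rw [← neg_sub z xstar, inner_neg_right] at a1
    linarith
  have h4 : -inner ℝ e (z - xstar) ≤ α / 2 * r ^ 2 + ‖e‖ ^ 2 / (2 * α) := by
    have a1 := (abs_le.1 (abs_real_inner_le_norm e (z - xstar))).1
    have a2 : ‖e‖ * r ≤ α / 2 * r ^ 2 + ‖e‖ ^ 2 / (2 * α) := by
      have a3 : α / 2 * r ^ 2 + ‖e‖ ^ 2 / (2 * α) - ‖e‖ * r = (α * r - ‖e‖) ^ 2 / (2 * α) := by
        field_simp; ring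
      have : 0 ≤ (α * r - ‖e‖) ^ 2 / (2 * α) := by positivity
      linarith
    linarith
  have h5 : ‖g‖ ^ 2 ≤ 2 * ‖e‖ ^ 2 + 2 * ‖gradient f z‖ ^ 2 := by
    have a1 : ‖g‖ ≤ ‖e‖ + ‖gradient f z‖ := by
      rw [he]; simpa using norm_add_le (g - gradient f z) (gradient f z)
    nlinarith [norm_nonneg g, sq_nonneg (‖e‖ - ‖gradient f z‖), norm_nonneg e,
      norm_nonneg (gradient f z)]
  have h6 : ‖proj Θ (z - η • g) - xstar‖ ^ 2 ≤ ‖z - η • g - xstar‖ ^ 2 := by gcongr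
  have hηα : η * α = 2 / k := by rw [hη]; field_simp
  calc _ ≤ r ^ 2 - 2 * η * inner ℝ g (z - xstar) + η ^ 2 * ‖g‖ ^ 2 := h6.trans h1.le
    _ ≤ r ^ 2 - η * α * r ^ 2 + η * (‖e‖ ^ 2 / α) +
          η ^ 2 * (2 * ‖e‖ ^ 2 + 2 * ‖gradient f z‖ ^ 2) := by
        have a1 : -inner ℝ g (z - xstar) ≤ -(α / 2 * r ^ 2) + ‖e‖ ^ 2 / (2 * α) := by
          rw [h2]; linarith
        have a2 := mul_le_mul_of_nonneg_left a1 (by positivity : 0 ≤ 2 * η)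
        have a3 := mul_le_mul_of_nonneg_left h5 (by positivity : 0 ≤ η ^ 2)
        have a4 : 2 * η * (-(α / 2 * r ^ 2) + ‖e‖ ^ 2 / (2 * α)) =
            -(η * α * r ^ 2) + η * (‖e‖ ^ 2 / α) := by field_simp
        linarith
    _ = (1 - 2 / k) * r ^ 2 + ((2 + 8 / k) * ‖e‖ ^ 2 + 8 * ‖gradient f z‖ ^ 2 / k) /
          (α ^ 2 * k) := by
        rw [hηα, hη]; field_simp; ring
    _ ≤ _ := by
        have : 8 / k ≤ 8 := div_le_self (by norm_num) hk
        have : 2 + 8 / k ≤ 10 := by linarith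
        gcongr

/-- The sequence `k (log (k + 1) / k)^γ` is nondecreasing for `γ ≤ 1`. -/
lemma log_div_rpow_le_succ {k : ℕ} (hk : 1 ≤ k) {γ : ℝ} (hγ0 : 0 ≤ γ) (hγ1 : γ ≤ 1) :
    (Real.log (k + 1) / k) ^ γ ≤
      ((k + 1) / k) * (Real.log ((k + 1 : ℕ) + 1) / (k + 1 : ℕ)) ^ γ := by
  have hk1 : (1 : ℝ) ≤ k := by exact_mod_cast hk
  have hk0 : (0 : ℝ) < k := by linarith
  have hq : 1 ≤ ((k : ℝ) + 1) / k := by rw [le_div_iff₀ hk0]; linarith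
  have h2 := (log_div_pos (k := k + 1) (by omega)).le
  calc (Real.log (k + 1) / k) ^ γ
      ≤ (((k + 1) / k) * (Real.log ((k + 1 : ℕ) + 1) / (k + 1 : ℕ))) ^ γ := by
        refine Real.rpow_le_rpow (log_div_pos hk).le ?_ hγ0
        push_cast
        have : ((k : ℝ) + 1) / k * (Real.log (k + 1 + 1) / (k + 1)) = Real.log (k + 1 + 1) / k := by
          field_simp
        rw [this]
        gcongr
        linarith
    _ = (((k : ℝ) + 1) / k) ^ γ * (Real.log ((k + 1 : ℕ) + 1) / (k + 1 : ℕ)) ^ γ :=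
        Real.mul_rpow (by linarith) h2
    _ ≤ _ := by
        gcongr
        exact Real.rpow_le_self_of_one_le hq hγ1

/-- The solution of the recursion: `r_{k+1} ≤ (1 - 2/k) r_k + F ρ_k / k` gives `r_{k+1} ≤ F ρ_k`
for `ρ_k = (log (k + 1) / k)^γ`, since `k ρ_k` is nondecreasing. For `k = 1` the coefficient of `r_1`
is negative, so that the bound holds from the first step on. -/
lemma le_of_recursion {r : ℕ → ℝ} {F γ : ℝ} (hF : 0 ≤ F) (hγ0 : 0 ≤ γ) (hγ1 : γ ≤ 1) {n : ℕ}
    (hr : 0 ≤ r 1) (hstep : ∀ k, 1 ≤ k → k + 1 ≤ n → r (k + 1) ≤ (1 - 2 / k) * r k +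
      F * (Real.log (k + 1) / k) ^ γ / k) {k : ℕ} (hk : 1 ≤ k) (hkn : k + 1 ≤ n) :
    r (k + 1) ≤ F * (Real.log (k + 1) / k) ^ γ := by
  induction k, hk using Nat.le_induction with
  | base =>
    have := hstep 1 le_rfl hkn
    norm_num at this ⊢
    linarith
  | succ k hk ih =>
    have ih := ih (by omega)
    have hs := hstep (k + 1) (by omega) hkn
    have hρ := log_div_rpow_le_succ hk hγ0 hγ1
    set ρ' := (Real.log ((k + 1 : ℕ) + 1) / (k + 1 : ℕ)) ^ γ
    set ρ := (Real.log (k + 1) / k) ^ γ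
    have hρ'0 : 0 ≤ ρ' := Real.rpow_nonneg (log_div_pos (k := k + 1) (by omega)).le _
    have hk1 : (1 : ℝ) ≤ k := by exact_mod_cast hk
    push_cast at hs
    have hc : 0 ≤ 1 - 2 / ((k : ℝ) + 1) := by
      rw [sub_nonneg, div_le_one (by linarith)]; linarith
    calc _ ≤ (1 - 2 / ((k : ℝ) + 1)) * (F * (((k + 1) / k) * ρ')) + F * ρ' / (k + 1) := by
          refine hs.trans ?_
          gcongr
          exact ih.trans (by gcongr)
      _ = F * ρ' * (1 - (1 / k - 1 / (k + 1))) := by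
          field_simp; ring
      _ ≤ F * ρ' * 1 := by
          gcongr
          have : 1 / ((k : ℝ) + 1) ≤ 1 / k := by gcongr; linarith
          linarith
      _ = F * ρ' := mul_one _

/-! ### Polynomial dependence of the constants on the dimension -/

lemma devConst_nonneg {d A : ℕ} {D κ v Λ r : ℝ} (hr : 0 ≤ r) : 0 ≤ devConst d A D κ v Λ r := by
  unfold devConst
  have : Even 4 := by decide
  have h1 := this.pow_nonneg κ
  have h2 := this.pow_nonneg Λ
  have h3 := this.pow_nonneg (4 * A + (4 * D + 8) * (d : ℝ) ^ 2 + v)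
  positivity

/-- The dimension-free factor in the polynomial bound for `devConst`. -/
noncomputable def devFactor (A D κ v Λ r : ℝ) : ℝ :=
  8 * κ ^ 4 * (8 * (4 * A + 4 * D + 8 + v) ^ 4 + 3072) + 512 * Λ ^ 4 * r

lemma devConst_le {d A ℓ : ℕ} (hd : 1 ≤ d) {A₀ D κ v Λ Λ₀ r : ℝ} (hA : A ≤ A₀ * (d : ℝ) ^ (2 * ℓ))
    (hD : 0 ≤ D) (hv : 0 ≤ v) (hΛ0 : 0 ≤ Λ) (hΛ : Λ ≤ Λ₀ * d) (hr : 0 ≤ r) :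
    devConst d A D κ v Λ r ≤ devFactor A₀ D κ v Λ₀ r * (d : ℝ) ^ (8 * ℓ + 8) := by
  have hd1 : (1 : ℝ) ≤ d := by exact_mod_cast hd
  have hd0 : (0 : ℝ) < d := by linarith
  have hκ : 0 ≤ κ ^ 4 := (by decide : Even 4).pow_nonneg κ
  have hA0 : 0 ≤ A₀ := by
    have : (0 : ℝ) ≤ A₀ * (d : ℝ) ^ (2 * ℓ) := le_trans (by positivity) hA
    exact nonneg_of_mul_nonneg_left this (by positivity)
  have hΛ₀ : 0 ≤ Λ₀ := nonneg_of_mul_nonneg_left (hΛ0.trans hΛ) hd0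
  have h1 : 4 * A + (4 * D + 8) * (d : ℝ) ^ 2 + v ≤
      (4 * A₀ + 4 * D + 8 + v) * (d : ℝ) ^ (2 * ℓ + 2) := by
    have a1 : (d : ℝ) ^ (2 * ℓ) ≤ (d : ℝ) ^ (2 * ℓ + 2) := pow_le_pow_right₀ hd1 (by omega)
    have a2 : (d : ℝ) ^ 2 ≤ (d : ℝ) ^ (2 * ℓ + 2) := pow_le_pow_right₀ hd1 (by omega)
    have a3 : 1 ≤ (d : ℝ) ^ (2 * ℓ + 2) := one_le_pow₀ hd1
    calc _ ≤ 4 * (A₀ * (d : ℝ) ^ (2 * ℓ + 2)) + (4 * D + 8) * (d : ℝ) ^ (2 * ℓ + 2) +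
          v * (d : ℝ) ^ (2 * ℓ + 2) := by
          gcongr
          · exact hA.trans (by gcongr)
          · exact le_mul_of_one_le_right hv a3
      _ = _ := by ring
  have h2 : (4 * A + (4 * D + 8) * (d : ℝ) ^ 2 + v) ^ 4 ≤
      (4 * A₀ + 4 * D + 8 + v) ^ 4 * (d : ℝ) ^ (8 * ℓ + 8) := by
    calc _ ≤ ((4 * A₀ + 4 * D + 8 + v) * (d : ℝ) ^ (2 * ℓ + 2)) ^ 4 := by gcongr
      _ = _ := by rw [mul_pow, ← pow_mul]; ring_nf
  have h3 : Λ ^ 4 ≤ Λ₀ ^ 4 * (d : ℝ) ^ (8 * ℓ + 8) := by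
    calc Λ ^ 4 ≤ (Λ₀ * d) ^ 4 := by gcongr
      _ = Λ₀ ^ 4 * (d : ℝ) ^ 4 := by ring
      _ ≤ _ := by
          gcongr
          omega
  have h4 : 1 ≤ (d : ℝ) ^ (8 * ℓ + 8) := one_le_pow₀ hd1
  unfold devConst devFactor
  calc _ ≤ 8 * κ ^ 4 * (8 * ((4 * A₀ + 4 * D + 8 + v) ^ 4 * (d : ℝ) ^ (8 * ℓ + 8)) +
        3072 * (d : ℝ) ^ (8 * ℓ + 8)) + 512 * (Λ₀ ^ 4 * (d : ℝ) ^ (8 * ℓ + 8)) * r := by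
        gcongr
        linarith
    _ = _ := by ring

namespace ConstParams

variable (P : ConstParams)

/-- The dimension-free factor in the bound on the number of multi-indices. -/
noncomputable def idxFactor : ℝ := 3 * (order P.β).factorial

/-- The squared bound on the gradient over `Θ`. -/
noncomputable def gradSq : ℝ := (P.M + P.L) ^ 2 / P.eigK

/-- The dimension-free factor in the mean squared error of the gradient estimator. -/
noncomputable def errFactor : ℝ :=
  27 * (P.pmin * P.eigK)⁻¹ ^ 2 * P.idxFactor ^ 4 * (√P.gradSq + P.L * (P.pmax + 1) + 1) ^ 2 *
    (1 + devFactor (P.idxFactor ^ 2) P.diam (1 + P.supK) (P.pmax * P.supK)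
        (2 * (P.lipK + 2 * P.supK * order P.β)) 1
      + devFactor (P.idxFactor ^ 2) P.diam (1 + 2 * P.σ * P.supK)
        (16 * P.σ ^ 2 * (P.pmax * P.supK)) (P.lipK + 2 * P.supK * order P.β) (48 * P.σ ^ 4))

/-- The dimension-free factor in the risk bound: a common bound for the factors of `diam² Θ` and of
the rate. The absolute value makes it positive for arbitrary values of the parameters. -/
noncomputable def riskFactor : ℝ := 1 + P.diam ^ 2 + |2 * (10 * P.errFactor + 16 * P.gradSq)|

lemma riskFactor_pos : 0 < P.riskFactor := by unfold riskFactor; positivity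

end ConstParams

/-- The parameters on which the constant depends, for a given problem. -/
noncomputable def problemParams {d : ℕ} (Θ : Set (Vec d)) (K : Vec d → ℝ) (LK : NNReal)
    (β L M pmin pmax σ : ℝ) : ConstParams :=
  { β := β, L := L, M := M, pmin := pmin, pmax := pmax, σ := σ, diam := Metric.diam Θ,
    supK := ⨆ u, K u, lipK := LK, eigK := kernelMinEig (order β) K }

variable {Ω : Type*} [MeasurableSpace Ω] {μ : Measure Ω}

/-- The uniform mean squared error of the gradient estimator, with the dependence on the dimension
made explicit. -/
lemma exists_majorant_gradEst_poly [IsProbabilityMeasure μ] {d n : ℕ} {Θ : Set (Vec d)}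
    {K : Vec d → ℝ} {LK : NNReal} {pmin pmax : ℝ} {X : ℕ → Ω → Vec d}
    (hX : IsDesign μ n Θ pmin pmax X) {σ : ℝ} (hσ : 0 < σ) {ξ : ℕ → Ω → ℝ}
    (hξ : IsNoise μ n X σ ξ) (hK : IsKernel K LK) (hc : IsCompact Θ)
    (hd : 1 ≤ d) (hpmin : 0 < pmin) {β L α M : ℝ} (hβ : 2 ≤ β) (hL : 0 < L) {f : Vec d → ℝ}
    {xstar : Vec d} (hf : RegressionClass Θ β L α M f xstar) {k : ℕ} (hk : 1 ≤ k) (hkn : k ≤ n) :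
    ∃ Q : Ω → ℝ, Integrable Q μ ∧
      ∫ ω, Q ω ∂μ ≤ (problemParams Θ K LK β L M pmin pmax σ).errFactor *
        (d : ℝ) ^ (12 * order β + 8) * bandwidth d β k ^ (2 * (β - 1)) ∧
      ∀ ω, ∀ z ∈ Θ, ‖gradEst (order β) K (bandwidth d β k) (regParam d β k) k (fun i => X i ω)
        (fun i => f (X i ω) + ξ i ω) z - gradient f z‖ ^ 2 ≤ Q ω := by
  obtain ⟨Q, hQi, hQ, hbound⟩ := exists_majorant_gradEst hX hσ hξ hK hc hd hpmin hβ hL hf hk hkn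
  refine ⟨Q, hQi, hQ.trans ?_, hbound⟩
  have hh0 := bandwidth_pos (d := d) (β := β) hk
  have hpw : 0 ≤ bandwidth d β k ^ (2 * (β - 1)) := Real.rpow_nonneg hh0.le _
  refine mul_le_mul_of_nonneg_right ?_ hpw
  have hd1 : (1 : ℝ) ≤ d := by exact_mod_cast hd
  have hpmax : 0 ≤ pmax := by
    obtain ⟨p, -, -, -, hp⟩ := hX.density
    have := hp xstar ⟨xstar, hf.mem, 0, by simp, by simp⟩
    linarith
  have hκ := hK.sup_nonneg
  have hD := Metric.diam_nonneg (s := Θ)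
  have heig := kernelMinEig_pos hK (order β)
  have hcard := card_multiIdx_le hd (order β)
  simp only [ConstParams.errFactor, ConstParams.idxFactor, ConstParams.gradSq, problemParams]
  set ℓ := order β with hℓ
  set κ := ⨆ u, K u
  set c₀ : ℝ := 3 * (ℓ.factorial : ℝ) with hc₀
  have hc₀1 : 1 ≤ c₀ := by
    have : (1 : ℝ) ≤ ℓ.factorial := by exact_mod_cast Nat.one_le_of_lt (Nat.factorial_pos ℓ)
    linarith
  have hS : (0 : ℝ) ≤ Fintype.card (MultiIdx d ℓ) := Nat.cast_nonneg _
  have hdpow : (1 : ℝ) ≤ (d : ℝ) ^ ℓ := one_le_pow₀ hd1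
  have hcard2 : ((Fintype.card (MultiIdx d ℓ × MultiIdx d ℓ) : ℕ) : ℝ) ≤
      c₀ ^ 2 * (d : ℝ) ^ (2 * ℓ) := by
    rw [Fintype.card_prod]
    push_cast
    calc _ ≤ (c₀ * (d : ℝ) ^ ℓ) * (c₀ * (d : ℝ) ^ ℓ) := by gcongr
      _ = _ := by ring
  have hcard1 : ((Fintype.card (MultiIdx d ℓ) : ℕ) : ℝ) ≤ c₀ ^ 2 * (d : ℝ) ^ (2 * ℓ) := by
    refine hcard.trans ?_
    rw [mul_comm 2 ℓ, pow_mul, ← mul_pow]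
    refine le_self_pow₀ ?_ (by norm_num)
    exact one_le_mul_of_one_le_of_one_le hc₀1 hdpow
  have hΛ0 : 0 ≤ LK + 2 * κ * ℓ * d := by positivity
  have hΛ : LK + 2 * κ * ℓ * d ≤ (LK + 2 * κ * ℓ) * d := by
    rw [add_mul]
    gcongr
    exact le_mul_of_one_le_right LK.2 hd1
  have hdev₁ := devConst_le (κ := 1 + κ) (v := pmax * κ) (r := 1) hd hcard2 hD (by positivity)
    (by positivity : 0 ≤ 2 * ((LK : ℝ) + 2 * κ * ℓ * d))
    (by linarith : 2 * ((LK : ℝ) + 2 * κ * ℓ * d) ≤ (2 * (LK + 2 * κ * ℓ)) * d) zero_le_one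
  have hdev₂ := devConst_le (κ := 1 + 2 * σ * κ) (v := 16 * σ ^ 2 * (pmax * κ))
    (r := 48 * σ ^ 4) hd hcard1 hD (by positivity) hΛ0 hΛ (by positivity)
  have hdev₁0 := devConst_nonneg (d := d) (A := Fintype.card (MultiIdx d ℓ × MultiIdx d ℓ))
    (D := Metric.diam Θ) (κ := 1 + κ) (v := pmax * κ) (Λ := 2 * ((LK : ℝ) + 2 * κ * ℓ * d)) zero_le_one
  have hdev₂0 := devConst_nonneg (d := d) (A := Fintype.card (MultiIdx d ℓ))
    (D := Metric.diam Θ) (κ := 1 + 2 * σ * κ) (v := 16 * σ ^ 2 * (pmax * κ))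
    (Λ := LK + 2 * κ * ℓ * d) (r := 48 * σ ^ 4) (by positivity)
  have hone : 1 ≤ (d : ℝ) ^ (8 * ℓ + 8) := one_le_pow₀ hd1
  set dev₁ := devConst d (Fintype.card (MultiIdx d ℓ × MultiIdx d ℓ)) (Metric.diam Θ) (1 + κ)
    (pmax * κ) (2 * (LK + 2 * κ * ℓ * d)) 1
  set dev₂ := devConst d (Fintype.card (MultiIdx d ℓ)) (Metric.diam Θ) (1 + 2 * σ * κ)
    (16 * σ ^ 2 * (pmax * κ)) (LK + 2 * κ * ℓ * d) (48 * σ ^ 4)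
  set F₁ := devFactor (c₀ ^ 2) (Metric.diam Θ) (1 + κ) (pmax * κ) (2 * (LK + 2 * κ * ℓ)) 1
  set F₂ := devFactor (c₀ ^ 2) (Metric.diam Θ) (1 + 2 * σ * κ) (16 * σ ^ 2 * (pmax * κ))
    (LK + 2 * κ * ℓ) (48 * σ ^ 4)
  have hsum : 1 + dev₁ + dev₂ ≤ (1 + F₁ + F₂) * (d : ℝ) ^ (8 * ℓ + 8) := by linarith
  calc _ ≤ 27 * (pmin * kernelMinEig ℓ K)⁻¹ ^ 2 * (c₀ * (d : ℝ) ^ ℓ) ^ 4 *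
        (√((M + L) ^ 2 / kernelMinEig ℓ K) + L * (pmax + 1) + 1) ^ 2 *
        ((1 + F₁ + F₂) * (d : ℝ) ^ (8 * ℓ + 8)) := by gcongr
    _ = _ := by ring

/-- The risk bound of order `(log n / n)^{2(β-1)/(2β+d)} / α²`. -/
lemma integral_norm_iterate_sub_sq_le [IsProbabilityMeasure μ] {d n : ℕ} {Θ : Set (Vec d)}
    {K : Vec d → ℝ} {LK : NNReal} {pmin pmax : ℝ} {X : ℕ → Ω → Vec d}
    (hX : IsDesign μ n Θ pmin pmax X) {σ : ℝ} (hσ : 0 < σ) {ξ : ℕ → Ω → ℝ}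
    (hξ : IsNoise μ n X σ ξ) (hK : IsKernel K LK) (hc : IsCompact Θ) (hconv : Convex ℝ Θ)
    (hd : 1 ≤ d) (hpmin : 0 < pmin) {β L α M : ℝ} (hβ : 2 ≤ β) (hL : 0 < L) (hα : 0 < α)
    {f : Vec d → ℝ} {xstar : Vec d} (hf : RegressionClass Θ β L α M f xstar)
    (hgrad : gradient f xstar = 0) (hn : 2 ≤ n) {z₁ : Vec d} (hz₁ : z₁ ∈ Θ) {z : ℕ → Ω → Vec d}
    (hz : ∀ k ω, z k ω =
      iterate Θ β α K z₁ (fun i => X i ω) (fun i => f (X i ω) + ξ i ω) k)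
    (hint : ∀ k ≤ n, Integrable (fun ω => ‖z k ω - xstar‖ ^ 2) μ) :
    ∫ ω, ‖z n ω - xstar‖ ^ 2 ∂μ ≤
      2 * (10 * (problemParams Θ K LK β L M pmin pmax σ).errFactor +
        16 * (problemParams Θ K LK β L M pmin pmax σ).gradSq) * (d : ℝ) ^ (12 * order β + 8) *
      ((Real.log n / n) ^ (2 * (β - 1) / (2 * β + d)) / α ^ 2) := by
  set P := problemParams Θ K LK β L M pmin pmax σ with hP
  set γ := 2 * (β - 1) / (2 * β + d) with hγ
  set q := 12 * order β + 8
  have hd1 : (1 : ℝ) ≤ d := by exact_mod_cast hd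
  have hγ0 : 0 ≤ γ := div_nonneg (by linarith) (by positivity)
  have hγ1 : γ ≤ 1 := by
    rw [hγ, div_le_one (by positivity)]; linarith
  have heig : 0 < P.eigK := kernelMinEig_pos hK (order β)
  have hG0 : 0 ≤ P.gradSq := div_nonneg (sq_nonneg _) heig.le
  have hzΘ : ∀ k ω, z k ω ∈ Θ := fun k ω => by rw [hz]; exact iterate_mem hc hz₁ _ _ _ _ k
  have hgr : ∀ w ∈ Θ, ‖gradient f w‖ ^ 2 ≤ P.gradSq := fun w hw => by
    rw [ConstParams.gradSq, le_div_iff₀ heig, mul_comm]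
    exact hf.kernelMinEig_mul_gradient_le hK hL hβ hw
  have hdq : 1 ≤ (d : ℝ) ^ q := one_le_pow₀ hd1
  set F := (10 * P.errFactor + 16 * P.gradSq) * (d : ℝ) ^ q / α ^ 2 with hF
  have hE0 : 0 ≤ P.errFactor * (d : ℝ) ^ q := by
    obtain ⟨Q, -, hQ, hb⟩ := exists_majorant_gradEst_poly hX hσ hξ hK hc hd hpmin hβ hL hf le_rfl
      (by omega : 1 ≤ n)
    have h1 : 0 ≤ ∫ ω, Q ω ∂μ :=
      integral_nonneg fun ω => (sq_nonneg _).trans (hb ω z₁ hz₁)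
    have h2 : 0 < bandwidth d β 1 ^ (2 * (β - 1)) :=
      Real.rpow_pos_of_pos (bandwidth_pos le_rfl) _
    exact nonneg_of_mul_nonneg_left (h1.trans hQ) h2
  have hF0 : 0 ≤ F := by
    rw [hF, add_mul]
    have : 0 ≤ 16 * P.gradSq * (d : ℝ) ^ q := by positivity
    have : 0 ≤ 10 * P.errFactor * (d : ℝ) ^ q := by linarith
    positivity
  have hstep : ∀ k, 1 ≤ k → k + 1 ≤ n → ∫ ω, ‖z (k + 1) ω - xstar‖ ^ 2 ∂μ ≤
      (1 - 2 / k) * ∫ ω, ‖z k ω - xstar‖ ^ 2 ∂μ + F * (Real.log (k + 1) / k) ^ γ / k := by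
    intro k hk hkn
    have hk1 : (1 : ℝ) ≤ k := by exact_mod_cast hk
    have hk0 : (0 : ℝ) < k := by linarith
    obtain ⟨Q, hQi, hQ, hb⟩ := exists_majorant_gradEst_poly hX hσ hξ hK hc hd hpmin hβ hL hf hk
      (by omega : k ≤ n)
    rw [bandwidth_rpow hk, ← hγ] at hQ
    set ρ := (Real.log (k + 1) / k) ^ γ with hρ
    have hρk : 1 / (k : ℝ) ≤ 2 * ρ := by
      have h1 : Real.log (k + 1) / k ≤ ρ :=
        Real.self_le_rpow_of_le_one (log_div_pos hk).le (log_div_le_one hk) hγ1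
      have h2 : (1 / 2 : ℝ) / k ≤ Real.log (k + 1) / k := by
        gcongr; exact half_le_log hk
      have h3 : 1 / (k : ℝ) = 2 * ((1 / 2) / k) := by ring
      linarith
    have hpt : ∀ ω, ‖z (k + 1) ω - xstar‖ ^ 2 ≤ (1 - 2 / k) * ‖z k ω - xstar‖ ^ 2 +
        (10 * Q ω + 8 * P.gradSq / k) / (α ^ 2 * k) := by
      intro ω
      obtain ⟨j, rfl⟩ : ∃ j, k = j + 1 := ⟨k - 1, by omega⟩
      have h1 := hf.norm_step_sub_sq_le hc hconv hα hgrad hk1 (hzΘ (j + 1) ω)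
        (gradEst (order β) K (bandwidth d β (j + 1)) (regParam d β (j + 1)) (j + 1)
          (fun i => X i ω) (fun i => f (X i ω) + ξ i ω) (z (j + 1) ω))
      have h2 : z (j + 1 + 1) ω = proj Θ (z (j + 1) ω - (2 / (α * (j + 1 : ℕ))) •
          gradEst (order β) K (bandwidth d β (j + 1)) (regParam d β (j + 1)) (j + 1)
            (fun i => X i ω) (fun i => f (X i ω) + ξ i ω) (z (j + 1) ω)) := by
        rw [hz, hz]; rfl
      rw [h2]
      refine h1.trans ?_
      gcongr
      · exact hb ω _ (hzΘ _ ω)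
      · exact hgr _ (hzΘ _ ω)
    have hi1 : Integrable (fun ω => (1 - 2 / (k : ℝ)) * ‖z k ω - xstar‖ ^ 2) μ :=
      (hint k (by omega)).const_mul _
    have hi2 : Integrable (fun ω => 10 * Q ω + 8 * P.gradSq / k) μ :=
      (hQi.const_mul 10).add (integrable_const _)
    calc _ ≤ ∫ ω, ((1 - 2 / k) * ‖z k ω - xstar‖ ^ 2 +
          (10 * Q ω + 8 * P.gradSq / k) / (α ^ 2 * k)) ∂μ :=
          integral_mono (hint (k + 1) hkn) (hi1.add (hi2.div_const _)) hpt
      _ = (1 - 2 / k) * ∫ ω, ‖z k ω - xstar‖ ^ 2 ∂μ +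
          (10 * ∫ ω, Q ω ∂μ + 8 * P.gradSq / k) / (α ^ 2 * k) := by
          rw [integral_add hi1 (hi2.div_const _), integral_const_mul, integral_div,
            integral_add (hQi.const_mul 10) (integrable_const _), integral_const_mul]
          simp
      _ ≤ (1 - 2 / k) * ∫ ω, ‖z k ω - xstar‖ ^ 2 ∂μ +
          (10 * (P.errFactor * (d : ℝ) ^ q * ρ) + 16 * P.gradSq * (d : ℝ) ^ q * ρ) /
            (α ^ 2 * k) := by
          gcongr
          have h1 : 8 * P.gradSq / k ≤ 16 * P.gradSq * ρ := by
            have := mul_le_mul_of_nonneg_left hρk (by positivity : 0 ≤ 8 * P.gradSq)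
            calc 8 * P.gradSq / k = 8 * P.gradSq * (1 / k) := by ring
              _ ≤ _ := by linarith
          refine h1.trans ?_
          have hρ0 : 0 ≤ ρ := Real.rpow_nonneg (log_div_pos hk).le _
          refine mul_le_mul_of_nonneg_right ?_ hρ0
          exact le_mul_of_one_le_right (by positivity) hdq
      _ = _ := by rw [hF]; field_simp
  obtain ⟨k, rfl⟩ : ∃ k, n = k + 1 := ⟨n - 1, by omega⟩
  have hk : 1 ≤ k := by omega
  have hk1 : (1 : ℝ) ≤ k := by exact_mod_cast hk
  have hrec := le_of_recursion (r := fun k => ∫ ω, ‖z k ω - xstar‖ ^ 2 ∂μ) hF0 hγ0 hγ1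
    (integral_nonneg fun ω => sq_nonneg _) hstep hk le_rfl
  have hlogn : 0 ≤ Real.log (k + 1) / (k + 1) :=
    div_nonneg (Real.log_nonneg (by linarith)) (by linarith)
  have hlast : (Real.log (k + 1) / k) ^ γ ≤ 2 * (Real.log (k + 1) / (k + 1)) ^ γ := by
    calc _ ≤ (2 * (Real.log (k + 1) / (k + 1))) ^ γ := by
          refine Real.rpow_le_rpow (log_div_pos hk).le ?_ hγ0
          have h1 : 0 ≤ Real.log ((k : ℝ) + 1) := Real.log_nonneg (by linarith)
          rw [← mul_div_assoc, div_le_div_iff₀ (by linarith) (by linarith)]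
          nlinarith
      _ = 2 ^ γ * (Real.log (k + 1) / (k + 1)) ^ γ := Real.mul_rpow (by norm_num) hlogn
      _ ≤ _ := by
          gcongr
          exact Real.rpow_le_self_of_one_le (by norm_num) hγ1
  push_cast
  calc _ ≤ F * (Real.log (k + 1) / k) ^ γ := hrec
    _ ≤ F * (2 * (Real.log (k + 1) / (k + 1)) ^ γ) := by gcongr
    _ = _ := by rw [hF]; ring

end Risk

end PassiveDesign

theorem theorem1 :
    ∃ (q : ℝ → ℕ) (c : ConstParams → ℝ), (∀ P, 0 < c P) ∧
      ∀ (d : ℕ) (_ : 1 ≤ d) (Θ : Set (Vec d)) (_ : IsCompact Θ) (_ : Convex ℝ Θ)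
        (β L M pmin pmax σ : ℝ) (_ : 2 ≤ β) (_ : 0 < L) (_ : 0 < pmin) (_ : 0 < σ)
        (K : Vec d → ℝ) (LK : NNReal) (_ : IsKernel K LK)
        (α : ℝ) (_ : 0 < α) (f : Vec d → ℝ) (xstar : Vec d)
        (_ : RegressionClass Θ β L α M f xstar) (_ : gradient f xstar = 0)
        (n : ℕ) (_ : 2 ≤ n)
        (Ω : Type*) [MeasurableSpace Ω] (μ : Measure Ω) [IsProbabilityMeasure μ]
        (X : ℕ → Ω → Vec d) (ξ : ℕ → Ω → ℝ)
        (_ : IsDesign μ n Θ pmin pmax X) (_ : IsNoise μ n X σ ξ)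
        (z₁ : Vec d) (_ : z₁ ∈ Θ) (z : ℕ → Ω → Vec d)
        (_ : ∀ k ω, z k ω =
          iterate Θ β α K z₁ (fun i => X i ω) (fun i => f (X i ω) + ξ i ω) k),
        Integrable (fun ω => ‖z n ω - xstar‖ ^ 2) μ ∧
        ∫ ω, ‖z n ω - xstar‖ ^ 2 ∂μ ≤
          c { β := β, L := L, M := M, pmin := pmin, pmax := pmax, σ := σ,
              diam := Metric.diam Θ, supK := ⨆ u, K u, lipK := LK,
              eigK := kernelMinEig (order β) K } * (d : ℝ) ^ q β *
          min 1 ((Real.log n / n) ^ (2 * (β - 1) / (2 * β + d)) / α ^ 2) := by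
  refine ⟨fun β => 12 * order β + 8, ConstParams.riskFactor, ConstParams.riskFactor_pos, ?_⟩
  intro d hd Θ hc hconv β L M pmin pmax σ hβ hL hpmin hσ K LK hK α hα f xstar hf hgrad n hn Ω _ μ _
    X ξ hX hξ z₁ hz₁ z hz
  have hzΘ : ∀ k ω, z k ω ∈ Θ := fun k ω => by rw [hz]; exact iterate_mem hc hz₁ _ _ _ _ k
  have hdist : ∀ k ω, ‖z k ω - xstar‖ ^ 2 ≤ Metric.diam Θ ^ 2 := fun k ω => by
    gcongr
    rw [← dist_eq_norm]
    exact Metric.dist_le_diam_of_mem hc.isBounded (hzΘ k ω) hf.mem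
  have hfc := hf.holder.continuous hβ
  have hint : ∀ k ≤ n, Integrable (fun ω => ‖z k ω - xstar‖ ^ 2) μ := fun k hk => by
    have hm : Measurable (z k) := by
      have h1 := measurable_iterate hK hc hconv hz₁ β α (x := fun ω i => X i ω)
        (y := fun ω i => f (X i ω) + ξ i ω) (fun i hi => hX.measurable i hi)
        (fun i hi => (hfc.measurable.comp (hX.measurable i hi)).add (hξ.measurable i hi)) k hk
      rwa [← funext fun ω => hz k ω] at h1
    refine Integrable.of_bound (by fun_prop) (Metric.diam Θ ^ 2)
      (Filter.Eventually.of_forall fun ω => ?_)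
    rw [Real.norm_eq_abs, abs_of_nonneg (sq_nonneg _)]
    exact hdist k ω
  refine ⟨hint n le_rfl, ?_⟩
  change _ ≤ (problemParams Θ K LK β L M pmin pmax σ).riskFactor * _ * _
  have hrisk := integral_norm_iterate_sub_sq_le hX hσ hξ hK hc hconv hd hpmin hβ hL hα hf hgrad hn
    hz₁ hz hint
  set P := problemParams Θ K LK β L M pmin pmax σ
  have hd1 : (1 : ℝ) ≤ d := by exact_mod_cast hd
  have hdq : 1 ≤ (d : ℝ) ^ (12 * order β + 8) := one_le_pow₀ hd1
  have hdiam : ∫ ω, ‖z n ω - xstar‖ ^ 2 ∂μ ≤ P.riskFactor * (d : ℝ) ^ (12 * order β + 8) := by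
    have h1 : ∫ ω, ‖z n ω - xstar‖ ^ 2 ∂μ ≤ Metric.diam Θ ^ 2 := by
      have := integral_mono (hint n le_rfl) (integrable_const _) (hdist n)
      simpa using this
    have h2 : Metric.diam Θ ^ 2 ≤ P.riskFactor := by
      have : P.diam = Metric.diam Θ := rfl
      rw [ConstParams.riskFactor, this]
      have := abs_nonneg (2 * (10 * P.errFactor + 16 * P.gradSq))
      linarith
    exact (h1.trans h2).trans (le_mul_of_one_le_right P.riskFactor_pos.le hdq)
  rcases min_choice (1 : ℝ) ((Real.log n / n) ^ (2 * (β - 1) / (2 * β + d)) / α ^ 2) with h | h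
  · rw [h, mul_one]
    exact hdiam
  · rw [h]
    refine hrisk.trans ?_
    have hlog : 0 ≤ Real.log n / n :=
      div_nonneg (Real.log_natCast_nonneg n) (Nat.cast_nonneg n)
    gcongr
    rw [ConstParams.riskFactor]
    have := le_abs_self (2 * (10 * P.errFactor + 16 * P.gradSq))
    nlinarith [sq_nonneg P.diam]
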